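/- Let $G=(V,\to)$ be a finite directed graph (self-loops allowed, not necessarily connected) and let $D$ be a depth-first forest of $G$ with its parents, depth-first numbering (DFN) and post depth-first numbering; $D$ is produced by some complete depth-first search of $G$. Edges of $G$ are classified by $D$ as back edges ($B$: the target is an ancestor of the source or equal to it), tree edges, and cross/forward edges. Consider the following algorithm $\mathtt{ConstructWTO}^{BU}(G,D)$, which computes a set $X$ of new elements (exits), a set $\rightharpoonup$ of scheduling constraints on $V\cup X$, and a set $\dashrightarrow\ \subseteq X\times V$ of stabilization constraints. *Phase 1 ($\mathtt{ConstructWPO}^{BU}(G,D,\mathit{true})$).* A disjoint-set structure (union by rank, path compression) maintains a partition of $V$ into sets with representatives; initially $\mathrm{rep}(v)=\mathrm{exit}[v]=v$, and $\mathrm{merge}(v,h)$ unites the sets of $v$ and $h$ and makes $h$ the representative. All cross/forward edges $(u,v)$ are removed and stored in $R[\mathrm{lca}_D(u,v)]$ (lowest common ancestors are computed off-line with disjoint sets; a virtual root above all trees of $D$ serves vertices of different trees). For each vertex $v$, $O[v]$ is the set of the original non-back edges that currently target $v$. For each $h\in V$ in descending DFN: every $(u,v)\in R[h]$ is restored as an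 edge $(u,\mathrm{rep}(v))$ and $(u,v)$ is added to $O[\mathrm{rep}(v)]$; $P_h=\{\mathrm{rep}(p):(p,h)\in B\}$; $N_h$ is the set of all vertices found by a backward worklist search that starts from $P_h\setminus\{h\}$, follows the current non-back edges, replaces every predecessor $p$ by $\mathrm{rep}(p)$, and does not enter $h$; if $P_h\neq\emptyset$, then for every $v\in N_h$ the constraints $(\mathrm{exit}[\mathrm{rep}(u)],v')$ for $(u,v')\in O[v]$ and $(\mathrm{exit}[\mathrm{rep}(u)],v)$ for the current non-back edges $(u,v)$ are added to $\rightharpoonup$, a new exit $x_h$ is created, $(\mathrm{exit}[\mathrm{rep}(p)],x_h)$ for $p\in P_h$ is added to $\rightharpoonup$, $(x_h,h)$ is added to $\dashrightarrow$, $\mathrm{exit}[h]:=x_h$, and every $v\in N_h$ is merged into $h$. After the loop the edges stored at the virtual root are restored in the same way, and the same two kinds of constraints as for $v\in N_h$ are added for every $v\in V$ with $\mathrm{rep}(v)=v$. *Phase 2.* The elements of $V\cup X$ without predecessor in $\rightharpoonup$ are pushed on a stack and all counters $\mathrm{count}[w]$ are set to $0$. While the stack is non-empty, an element $v$ is popped,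 $(\mathit{prev},v)$ is added to $\rightharpoonup$ if there is a previously popped element $\mathit{prev}$, and for each $v\rightharpoonup w$ the counter $\mathrm{count}[w]$ is increased by one and $w$ is pushed when it reaches the number of predecessors of $w$ in $\rightharpoonup$. The result is $(V,X,\rightharpoonup,\dashrightarrow)$. **Theorem.** The running time of $\mathtt{ConstructWTO}^{BU}(G,D)$ is almost linear. Precisely, implement the algorithm on a unit-cost random access machine (registers, arrays, constants, successor, predecessor, comparisons; every evaluated expression node, assignment and test costs one step), with the edges of $G$ given as an array in arbitrary order without repetition, $D$ given by the arrays of parents, DFN and post-DFN, sets of edges and constraints stored as linked lists or arrays, and disjoint sets stored as rooted trees with union by rank and path compression. Then there is a constant $C$ such that for every $G$ and every depth-first forest $D$ of $G$ the program halts after at most $$C\,\bigl(|V|+|{\to}|+1\bigr)\,\bigl(\alpha(|V|)+1\bigr)$$ steps, where $\alpha(n)=\min\{k: n\le A(k,k)\}$ is the inverse of the (Ackermann–Péter) function $A$. -/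

import Mathlib

namespace WTO

/-! ### A unit-cost random access machine

Memory consists of finitely many registers and finitely many unbounded arrays of natural numbers.
The arithmetic of the machine is restricted to constants, successor, (truncated) predecessor and
comparison, so that `t` steps can increase the numbers in memory by at most `O(t)`.  Every
node of an expression that is evaluated, every assignment and every test costs one step. -/

/-- The registers. -/
inductive Reg
  -- input: number of vertices, number of edges, and the Boolean parameter `lift`
  | n | m | lift
  -- counters: number of elements of `V ∪ X`, number of scheduling constraints
  | xc | fc
  -- local variables
  | i | j | k | e | p | q | u | v | w | h | x | np | nw | sp | prev
  -- local variables of the disjoint-set operations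
  | fx | fy | fr | ra | rb
  deriving DecidableEq

/-- The arrays. -/
inductive Arr
  -- input: the edge `e` goes from `src e` to `tgt e`; the depth-first forest
  | src | tgt | par | dfn | post
  -- the inverses of `dfn` and `post`
  | ord | pord
  -- linked lists of edges: back edges by target, cross/forward edges by source,
  -- the map `R`, and current non-back edges by current target
  | bHd | bNxt | cHd | cNxt | rHd | rNxt | inHd | inNxt
  -- disjoint sets: parent pointers, ranks, representative of the set with a given root
  | uf | rank | name
  -- the map `exit`, the stabilization constraints, and membership marks
  | ex | nest | mark | pmark
  -- the sequences `P_h` and `N_h` followed by `W_h`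
  | pl | wl
  -- scheduling constraints: sources, targets, linked lists by source, number of predecessors
  | fsrc | ftgt | fHd | fNxt | npred
  -- the arrays of the final topological traversal
  | count | stack
  deriving DecidableEq

inductive Exp
  | lit (c : ℕ)
  | reg (z : Reg)
  | get (a : Arr) (i : Exp)
  | succ (e : Exp)
  | pred (e : Exp)

inductive Test
  | eq (e f : Exp)
  | lt (e f : Exp)
  | not (b : Test)
  | and (b c : Test)

inductive Cmd
  | skip
  | set (z : Reg) (e : Exp)
  | store (a : Arr) (i e : Exp)
  | seq (c d : Cmd)
  | ite (b : Test) (c d : Cmd)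
  | loop (b : Test) (c : Cmd)

structure Mem where
  reg : Reg → ℕ
  arr : Arr → ℕ → ℕ

def Mem.setReg (s : Mem) (z : Reg) (c : ℕ) : Mem :=
  { s with reg := Function.update s.reg z c }

def Mem.setArr (s : Mem) (a : Arr) (i c : ℕ) : Mem :=
  { s with arr := Function.update s.arr a (Function.update (s.arr a) i c) }

def Exp.eval (s : Mem) : Exp → ℕ
  | .lit c => c
  | .reg z => s.reg z
  | .get a i => s.arr a (i.eval s)
  | .succ e => e.eval s + 1
  | .pred e => e.eval s - 1

def Exp.cost : Exp → ℕ
  | .lit _ => 1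
  | .reg _ => 1
  | .get _ i => i.cost + 1
  | .succ e => e.cost + 1
  | .pred e => e.cost + 1

def Test.Holds (s : Mem) : Test → Prop
  | .eq e f => e.eval s = f.eval s
  | .lt e f => e.eval s < f.eval s
  | .not b => ¬ b.Holds s
  | .and b c => b.Holds s ∧ c.Holds s

def Test.cost : Test → ℕ
  | .eq e f => e.cost + f.cost + 1
  | .lt e f => e.cost + f.cost + 1
  | .not b => b.cost + 1
  | .and b c => b.cost + c.cost + 1

/-- `Exec c s t s'`: started in memory `s`, the program `c` halts after exactly `t` steps in
memory `s'`. -/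
inductive Exec : Cmd → Mem → ℕ → Mem → Prop
  | skip (s : Mem) : Exec .skip s 1 s
  | set (z : Reg) (e : Exp) (s : Mem) :
      Exec (.set z e) s (e.cost + 1) (s.setReg z (e.eval s))
  | store (a : Arr) (i e : Exp) (s : Mem) :
      Exec (.store a i e) s (i.cost + e.cost + 1) (s.setArr a (i.eval s) (e.eval s))
  | seq {c d : Cmd} {s s' s'' : Mem} {t t' : ℕ} (h₁ : Exec c s t s') (h₂ : Exec d s' t' s'') :
      Exec (.seq c d) s (t + t') s''
  | ite_true {b : Test} {c d : Cmd} {s s' : Mem} {t : ℕ} (hb : b.Holds s) (h₁ : Exec c s t s') :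
      Exec (.ite b c d) s (b.cost + 1 + t) s'
  | ite_false {b : Test} {c d : Cmd} {s s' : Mem} {t : ℕ} (hb : ¬ b.Holds s)
      (h₁ : Exec d s t s') : Exec (.ite b c d) s (b.cost + 1 + t) s'
  | loop_false {b : Test} {c : Cmd} {s : Mem} (hb : ¬ b.Holds s) :
      Exec (.loop b c) s (b.cost + 1) s
  | loop_true {b : Test} {c : Cmd} {s s' s'' : Mem} {t t' : ℕ} (hb : b.Holds s)
      (h₁ : Exec c s t s') (h₂ : Exec (.loop b c) s' t' s'') :
      Exec (.loop b c) s (b.cost + 1 + t + t') s''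

/-- The machine is deterministic: a program has at most one running time and one result. -/
theorem Exec.deterministic {c : Cmd} {s s₁ s₂ : Mem} {t₁ t₂ : ℕ} (h₁ : Exec c s t₁ s₁)
    (h₂ : Exec c s t₂ s₂) : t₁ = t₂ ∧ s₁ = s₂ := by
  induction h₁ generalizing t₂ s₂ with
  | skip | set | store => cases h₂; exact ⟨rfl, rfl⟩
  | seq _ _ ih₁ ih₂ =>
    cases h₂ with
    | seq k₁ k₂ =>
      obtain ⟨rfl, rfl⟩ := ih₁ k₁
      obtain ⟨rfl, rfl⟩ := ih₂ k₂
      exact ⟨rfl, rfl⟩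
  | ite_true hb _ ih =>
    cases h₂ with
    | ite_true _ k => obtain ⟨rfl, rfl⟩ := ih k; exact ⟨rfl, rfl⟩
    | ite_false hb' _ => exact absurd hb hb'
  | ite_false hb _ ih =>
    cases h₂ with
    | ite_true hb' _ => exact absurd hb' hb
    | ite_false _ k => obtain ⟨rfl, rfl⟩ := ih k; exact ⟨rfl, rfl⟩
  | loop_false hb =>
    cases h₂ with
    | loop_false _ => exact ⟨rfl, rfl⟩
    | loop_true hb' _ _ => exact absurd hb' hb
  | loop_true hb _ _ ih₁ ih₂ =>
    cases h₂ with
    | loop_false hb' => exact absurd hb hb'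
    | loop_true _ k₁ k₂ =>
      obtain ⟨rfl, rfl⟩ := ih₁ k₁
      obtain ⟨rfl, rfl⟩ := ih₂ k₂
      exact ⟨rfl, rfl⟩

instance : Coe Reg Exp := ⟨Exp.reg⟩

instance : CoeFun Arr (fun _ => Exp → Exp) := ⟨Exp.get⟩

/-! ### The program -/

section Program

open Reg Arr Exp

local infixr:30 " ;; " => Cmd.seq
local infix:40 " ≔ " => Cmd.set
local notation:40 a:max "⟦" i "⟧" " ≔ " e:41 => Cmd.store a i e
local infix:50 " ≐ " => Test.eq
local infix:50 " ≺ " => Test.lt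

/-- `if b then c`. -/
def onlyIf (b : Test) (c : Cmd) : Cmd := .ite b c .skip

/-- `for z = 0, …, bound - 1 do body`. -/
def forRange (z : Reg) (bound : Exp) (body : Cmd) : Cmd :=
  z ≔ lit 0 ;;
  .loop (z ≺ bound) (
    body ;;
    z ≔ succ z)

/-- Insert the edge with number `e` into the linked list number `a` of the family `(hd, nxt)`:
`hd a` is one more than the number of the first edge of the list, and `0` if it is empty. -/
def insertInto (hd nxt : Arr) (a : Exp) : Cmd :=
  nxt⟦e⟧ ≔ hd a ;;
  hd⟦a⟧ ≔ succ e

/-- For every edge number `e` in the linked list number `a` of the family `(hd, nxt)`. -/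
def forList (hd nxt : Arr) (a : Exp) (body : Cmd) : Cmd :=
  p ≔ hd a ;;
  .loop (.not (p ≐ lit 0)) (
    e ≔ pred p ;;
    p ≔ nxt e ;;
    body)

/-! Disjoint sets: union by rank and path compression.  The array `name` keeps the prescribed
representative of each set at the root of its tree. -/

/-- `rep(z) := z` for every vertex `z`, and for the virtual root `n`. -/
def makeSets : Cmd :=
  forRange i (succ n) (
    uf⟦i⟧ ≔ i ;;
    rank⟦i⟧ ≔ lit 0 ;;
    name⟦i⟧ ≔ i)

/-- Compute in `fr` the root of the tree that contains `fx`, with path compression. -/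
def findRoot : Cmd :=
  fr ≔ fx ;;
  .loop (.not (uf fr ≐ fr)) (fr ≔ uf fr) ;;
  .loop (.not (uf fx ≐ fr)) (
    fy ≔ uf fx ;;
    uf⟦fx⟧ ≔ fr ;;
    fx ≔ fy)

/-- `z := rep(a)`. -/
def rep (z : Reg) (a : Exp) : Cmd :=
  fx ≔ a ;;
  findRoot ;;
  z ≔ name fr

/-- `merge(a, b)`: unite the sets of `a` and `b`; the representative becomes `b`. -/
def merge (a b : Exp) : Cmd :=
  fx ≔ a ;; findRoot ;; ra ≔ fr ;;
  fx ≔ b ;; findRoot ;; rb ≔ fr ;;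
  onlyIf (.not (ra ≐ rb)) (
    .ite (rank ra ≺ rank rb)
      (uf⟦ra⟧ ≔ rb)
      (uf⟦rb⟧ ≔ ra ;;
       onlyIf (rank ra ≐ rank rb) (rank⟦ra⟧ ≔ succ (rank ra)) ;;
       rb ≔ ra)) ;;
  name⟦rb⟧ ≔ b

/-- Add the scheduling constraint from `a` to `b`. -/
def addConstraint (a b : Exp) : Cmd :=
  fsrc⟦fc⟧ ≔ a ;;
  ftgt⟦fc⟧ ≔ b ;;
  fNxt⟦fc⟧ ≔ fHd a ;;
  fc ≔ succ fc ;;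
  fHd⟦a⟧ ≔ fc ;;
  npred⟦b⟧ ≔ succ (npred b)

/-- Initialization: no exits and no constraints, `exit[z] := z`, `R[z] := ∅`; vertices are
listed by DFN and post-DFN; edges are classified as back edges (the target is an ancestor of the
source), tree edges, and cross/forward edges.  The lists `inHd` and `inNxt` receive the tree edges:
these are the edges of the graph without back edges after the removal of the cross/forward
edges. -/
def setUp : Cmd :=
  xc ≔ n ;;
  fc ≔ lit 0 ;;
  forRange v n (
    ex⟦v⟧ ≔ v ;;
    bHd⟦v⟧ ≔ lit 0 ;; cHd⟦v⟧ ≔ lit 0 ;; rHd⟦v⟧ ≔ lit 0 ;; inHd⟦v⟧ ≔ lit 0 ;;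
    fHd⟦v⟧ ≔ lit 0 ;; npred⟦v⟧ ≔ lit 0 ;;
    mark⟦v⟧ ≔ n ;; pmark⟦v⟧ ≔ n ;;
    ord⟦dfn v⟧ ≔ v ;;
    pord⟦post v⟧ ≔ v) ;;
  rHd⟦n⟧ ≔ lit 0 ;;
  forRange e m (
    u ≔ src e ;;
    v ≔ tgt e ;;
    .ite (.and (.not (dfn u ≺ dfn v)) (.not (post v ≺ post u)))
      (insertInto bHd bNxt v)
      (.ite (par v ≐ u)
        (insertInto inHd inNxt v)
        (insertInto cHd cNxt u)))

/-- `removeAllCrossForwardEdges()`: every cross/forward edge `(w, z)` is put into `R[lca(w, z)]`.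
All lowest common ancestors are found off-line with disjoint sets: the vertices `w` are visited in
order of increasing post-DFN, and a visited vertex is merged into its parent; as `z` is finished
before `w`, the current representative of `z`, its first unvisited ancestor, is
`lca(w, z)`.  The number `n` is a virtual root, the parent of the roots of all trees of the forest:
it is the lowest common ancestor of two vertices of different trees. -/
def removeAllCrossForwardEdges : Cmd :=
  makeSets ;;
  forRange j n (
    w ≔ pord j ;;
    forList cHd cNxt w (
      rep q (tgt e) ;;
      insertInto rHd rNxt q) ;;
    merge w (par w))

/-- `restoreCrossForwardEdges(h)`: every edge `(y, z)` in `R[h]` is restored as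
`(y, rep(z))`.  Since an edge keeps its number, this records in `O[rep(z)]` also the original
edge: the list of `z` in `inHd`, `inNxt` holds the numbers of the edges that currently target
`z`, while `src` and `tgt` of these numbers are the original edges, i.e. `O[z]`. -/
def restoreCrossForwardEdges : Cmd :=
  forList rHd rNxt h (
    rep q (tgt e) ;;
    insertInto inHd inNxt q)

/-- `findNestedSCCs(h)`: on exit `pl 0, …, pl (np - 1)` is `P_h` and `wl 0, …, wl (nw - 1)` is
`N_h`.  During the search `N_h` is `wl 0, …, wl (k - 1)` and the worklist `W_h` is
`wl k, …, wl (nw - 1)`; `mark z = h` means that `z` belongs to one of the two. -/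
def findNestedSCCs : Cmd :=
  np ≔ lit 0 ;;
  forList bHd bNxt h (
    rep q (src e) ;;
    onlyIf (.not (pmark q ≐ h)) (
      pmark⟦q⟧ ≔ h ;;
      pl⟦np⟧ ≔ q ;;
      np ≔ succ np)) ;;
  nw ≔ lit 0 ;;
  forRange j np (
    q ≔ pl j ;;
    onlyIf (.not (q ≐ h)) (
      mark⟦q⟧ ≔ h ;;
      wl⟦nw⟧ ≔ q ;;
      nw ≔ succ nw)) ;;
  k ≔ lit 0 ;;
  .loop (k ≺ nw) (
    v ≔ wl k ;;
    k ≔ succ k ;;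
    forList inHd inNxt v (
      rep q (src e) ;;
      onlyIf (.and (.not (mark q ≐ h)) (.not (q ≐ h))) (
        mark⟦q⟧ ≔ h ;;
        wl⟦nw⟧ ≔ q ;;
        nw ≔ succ nw)))

/-- Add the scheduling constraints `(exit[rep(y)], z)` for `(y, z)` in `O[v]`; if `lift` is true,
add also `(exit[rep(y)], v)` for the current non-back edges `(y, v)`. -/
def addConstraintsTo : Cmd :=
  forList inHd inNxt v (
    rep q (src e) ;;
    addConstraint (ex q) (tgt e)) ;;
  onlyIf (lift ≐ lit 1) (
    forList inHd inNxt v (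
      rep q (src e) ;;
      addConstraint (ex q) v))

/-- `constructWPOForSCC(h)`. -/
def constructWPOForSCC : Cmd :=
  findNestedSCCs ;;
  onlyIf (.not (np ≐ lit 0)) (
    forRange k nw (
      v ≔ wl k ;;
      addConstraintsTo) ;;
    -- a new exit
    x ≔ xc ;;
    xc ≔ succ xc ;;
    fHd⟦x⟧ ≔ lit 0 ;;
    npred⟦x⟧ ≔ lit 0 ;;
    forRange j np (
      rep q (pl j) ;;
      addConstraint (ex q) x) ;;
    nest⟦x⟧ ≔ h ;;
    ex⟦h⟧ ≔ x ;;
    forRange k nw (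
      merge (wl k) h))

/-- `connectWPOsOfMaximalSCCs()`. -/
def connectWPOsOfMaximalSCCs : Cmd :=
  forRange v n (
    rep q v ;;
    onlyIf (q ≐ v) addConstraintsTo)

/-- `ConstructWPO^BU(G, D, lift)`.  The vertices are the numbers below `n`, and the exits are the
numbers from `n` to `xc - 1`.  The edges between different trees of the forest, which are stored
at the virtual root, are restored after the loop. -/
def constructWPOBU : Cmd :=
  setUp ;;
  removeAllCrossForwardEdges ;;
  makeSets ;;
  i ≔ n ;;
  .loop (lit 0 ≺ i) (
    i ≔ pred i ;;
    h ≔ ord i ;;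
    restoreCrossForwardEdges ;;
    constructWPOForSCC) ;;
  h ≔ n ;;
  restoreCrossForwardEdges ;;
  connectWPOsOfMaximalSCCs

/-- `ConstructWTO^BU(G, D)`.  On exit `V ∪ X` consists of the numbers below `xc`; the scheduling
constraints are the pairs `(fsrc c, ftgt c)` with `c < fc` (a pair may be repeated, and is then
counted as often in `count` as in `npred`); the stabilization constraints are
`(z, nest z)` for `n ≤ z < xc`.  The register `prev` holds `0` for nil, and otherwise one more
than the previous element. -/
def constructWTOBU : Cmd :=
  lift ≔ lit 1 ;;
  constructWPOBU ;;
  sp ≔ lit 0 ;;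
  forRange v xc (
    count⟦v⟧ ≔ lit 0 ;;
    onlyIf (npred v ≐ lit 0) (
      stack⟦sp⟧ ≔ v ;;
      sp ≔ succ sp)) ;;
  prev ≔ lit 0 ;;
  .loop (lit 0 ≺ sp) (
    sp ≔ pred sp ;;
    v ≔ stack sp ;;
    onlyIf (.not (prev ≐ lit 0)) (addConstraint (pred prev) v) ;;
    prev ≔ succ v ;;
    forList fHd fNxt v (
      w ≔ ftgt e ;;
      count⟦w⟧ ≔ succ (count w) ;;
      onlyIf (count w ≐ npred w) (
        stack⟦sp⟧ ≔ w ;;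
        sp ≔ succ sp)))

end Program

/-! ### Depth-first forests -/

/-- A state of a depth-first search: the stack of open vertices, the vertices in order of
discovery, the vertices in order of finishing, and the parents. -/
structure DFSState (V : Type) where
  stack : List V
  discovered : List V
  finished : List V
  parent : V → Option V

/-- The steps of a (nondeterministic) depth-first search of a directed graph. -/
inductive DFSStep {V : Type} [DecidableEq V] (G : Digraph V) : DFSState V → DFSState V → Prop
  | root (d f : List V) (p : V → Option V) (v : V) (hv : v ∉ d) :
      DFSStep G ⟨[], d, f, p⟩ ⟨[v], d ++ [v], f, Function.update p v none⟩
  | discover (st d f : List V) (p : V → Option V) (u v : V) (huv : G.Adj u v) (hv : v ∉ d) :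
      DFSStep G ⟨u :: st, d, f, p⟩ ⟨v :: u :: st, d ++ [v], f, Function.update p v (some u)⟩
  | finish (st d f : List V) (p : V → Option V) (u : V) (hu : ∀ v, G.Adj u v → v ∈ d) :
      DFSStep G ⟨u :: st, d, f, p⟩ ⟨st, d, f ++ [u], p⟩

/-- A rooted forest on `{0, …, n - 1}` with a numbering and a post-numbering of its vertices. -/
structure NumberedForest (n : ℕ) where
  parent : Fin n → Option (Fin n)
  dfn : Fin n → ℕ
  post : Fin n → ℕ

/-- `D` is a depth-first forest of `G`: some complete depth-first search of `G` has the parents,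
the depth-first numbering and the post depth-first numbering of `D`. -/
def IsDepthFirstForest {n : ℕ} (G : Digraph (Fin n)) (D : NumberedForest n) : Prop :=
  ∃ d f : List (Fin n),
    Relation.ReflTransGen (DFSStep G) ⟨[], [], [], fun _ => none⟩ ⟨[], d, f, D.parent⟩ ∧
    (∀ v, v ∈ d) ∧
    (∀ v, D.dfn v = d.idxOf v) ∧
    (∀ v, D.post v = f.idxOf v)

/-- The list `edges` enumerates the edges of `G` without repetition. -/
def IsEdgeList {n : ℕ} (G : Digraph (Fin n)) (edges : List (Fin n × Fin n)) : Prop :=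
  edges.Nodup ∧ ∀ u v, (u, v) ∈ edges ↔ G.Adj u v

/-- The memory `s` contains the graph with edge list `edges` and the forest `D` as input; roots
have the parent `n`.  Nothing is assumed about the rest of the memory. -/
structure HoldsInput {n : ℕ} (s : Mem) (edges : List (Fin n × Fin n)) (D : NumberedForest n) :
    Prop where
  n_eq : s.reg .n = n
  m_eq : s.reg .m = edges.length
  src_eq : ∀ i : Fin edges.length, s.arr .src i = (edges.get i).1
  tgt_eq : ∀ i : Fin edges.length, s.arr .tgt i = (edges.get i).2
  par_eq : ∀ v : Fin n, s.arr .par v = ((D.parent v).map Fin.val).getD n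
  dfn_eq : ∀ v : Fin n, s.arr .dfn v = D.dfn v
  post_eq : ∀ v : Fin n, s.arr .post v = D.post v

/-- The inverse Ackermann function: the least `k` with `n ≤ ack k k`. -/
noncomputable def invAck (n : ℕ) : ℕ := sInf {k : ℕ | n ≤ ack k k}

end WTO

namespace WTO

/-! Apart from path compression, the program executes `O(n + m)` commands.  A vertex that enters
`N_h` is merged into `h` and is then no longer a representative, so that each edge list is searched
a bounded number of times.  A traversal of an edge list adds at most one constraint per edge, hence
there are `O(n + m)` constraints; the topological traversal is linear in their number because an
element is pushed only once, when its counter reaches the number of its predecessors.  The factor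
`α(n)` comes from the disjoint sets alone: with Tarjan's potential, which compares the ranks of a
node and its parent by means of the Ackermann function, finding a root with path compression has
amortized cost `O(α(n) + 1)`.  Taking this cost as the unit of amortized time, the whole program
runs in `O(n + m)` units. -/

/-! ### Amortized execution -/

attribute [simp] Exp.eval Test.Holds

@[simp] theorem Mem.setReg_reg (s : Mem) (z y : Reg) (c : ℕ) :
    (s.setReg z c).reg y = if y = z then c else s.reg y := by
  simp [Mem.setReg, Function.update_apply]

@[simp] theorem Mem.setReg_arr (s : Mem) (z : Reg) (c : ℕ) : (s.setReg z c).arr = s.arr := rfl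

@[simp] theorem Mem.setArr_reg (s : Mem) (a : Arr) (i c : ℕ) : (s.setArr a i c).reg = s.reg := rfl

@[simp] theorem Mem.setArr_arr (s : Mem) (a b : Arr) (i c : ℕ) :
    (s.setArr a i c).arr b = if b = a then Function.update (s.arr a) i c else s.arr b := by
  simp [Mem.setArr, Function.update_apply]

/-- The registers that occur as the target of an assignment in the program; Boolean-valued, so that
`c.writesReg z = false` is proved by `rfl`. -/
def Cmd.writesReg : Cmd → Reg → Bool
  | .skip, _ => false
  | .set z _, y => z = y
  | .store _ _ _, _ => false
  | .seq c d, y => c.writesReg y || d.writesReg y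
  | .ite _ c d, y => c.writesReg y || d.writesReg y
  | .loop _ c, y => c.writesReg y

/-- The arrays that occur as the target of a store in the program. -/
def Cmd.writesArr : Cmd → Arr → Bool
  | .skip, _ => false
  | .set _ _, _ => false
  | .store a _ _, b => a = b
  | .seq c d, b => c.writesArr b || d.writesArr b
  | .ite _ c d, b => c.writesArr b || d.writesArr b
  | .loop _ c, b => c.writesArr b

/-- The memories agree outside the registers in `R` and the arrays in `A`. -/
structure AgreeOff (R : Reg → Bool) (A : Arr → Bool) (s s' : Mem) : Prop where
  reg : ∀ z, R z = false → s'.reg z = s.reg z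
  arr : ∀ a, A a = false → s'.arr a = s.arr a

namespace AgreeOff

variable {R R' : Reg → Bool} {A A' : Arr → Bool} {s s' s'' : Mem}

theorem refl (R : Reg → Bool) (A : Arr → Bool) (s : Mem) : AgreeOff R A s s :=
  ⟨fun _ _ => rfl, fun _ _ => rfl⟩

theorem trans (h : AgreeOff R A s s') (h' : AgreeOff R A s' s'') : AgreeOff R A s s'' :=
  ⟨fun z hz => (h'.reg z hz).trans (h.reg z hz), fun a ha => (h'.arr a ha).trans (h.arr a ha)⟩

theorem mono (h : AgreeOff R A s s') (hR : ∀ z, R' z = false → R z = false)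
    (hA : ∀ a, A' a = false → A a = false) : AgreeOff R' A' s s' :=
  ⟨fun z hz => h.reg z (hR z hz), fun a ha => h.arr a (hA a ha)⟩

theorem setReg (h : AgreeOff R A s s') {z : Reg} {c : ℕ} (hz : R z = true) :
    AgreeOff R A s (s'.setReg z c) := by
  refine ⟨fun y hy => ?_, h.arr⟩
  have hne : y ≠ z := by rintro rfl; simp [hz] at hy
  simpa [hne] using h.reg y hy

theorem setArr (h : AgreeOff R A s s') {a : Arr} {i c : ℕ} (ha : A a = true) :
    AgreeOff R A s (s'.setArr a i c) := by
  refine ⟨h.reg, fun b hb => ?_⟩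
  have hne : b ≠ a := by rintro rfl; simp [ha] at hb
  simpa [hne] using h.arr b hb

end AgreeOff

/-- The memories differ only in registers and arrays that the program writes. -/
abbrev Cmd.Frame (c : Cmd) (s s' : Mem) : Prop := AgreeOff c.writesReg c.writesArr s s'

namespace Cmd.Frame

variable {c d : Cmd} {s s' : Mem}

theorem set (z : Reg) (e : Exp) (s : Mem) (k : ℕ) : (Cmd.set z e).Frame s (s.setReg z k) :=
  (AgreeOff.refl _ _ s).setReg (by simp [writesReg])

theorem store (a : Arr) (i e : Exp) (s : Mem) (j k : ℕ) :
    (Cmd.store a i e).Frame s (s.setArr a j k) :=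
  (AgreeOff.refl _ _ s).setArr (by simp [writesArr])

theorem seq_left (h : c.Frame s s') (d : Cmd) : (Cmd.seq c d).Frame s s' :=
  h.mono (by simp +contextual [writesReg]) (by simp +contextual [writesArr])

theorem seq_right (h : d.Frame s s') (c : Cmd) : (Cmd.seq c d).Frame s s' :=
  h.mono (by simp +contextual [writesReg]) (by simp +contextual [writesArr])

theorem ite_left (h : c.Frame s s') (b : Test) (d : Cmd) : (Cmd.ite b c d).Frame s s' :=
  h.mono (by simp +contextual [writesReg]) (by simp +contextual [writesArr])

theorem ite_right (h : d.Frame s s') (b : Test) (c : Cmd) : (Cmd.ite b c d).Frame s s' :=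
  h.mono (by simp +contextual [writesReg]) (by simp +contextual [writesArr])

theorem loop (h : c.Frame s s') (b : Test) : (Cmd.loop b c).Frame s s' := h

theorem forList (h : c.Frame s s') (hd nxt : Arr) (a : Exp) : (forList hd nxt a c).Frame s s' :=
  seq_right (loop (seq_right (seq_right h _) _) _) _

end Cmd.Frame

theorem Exec.frame {c : Cmd} {s s' : Mem} {t : ℕ} (h : Exec c s t s') : c.Frame s s' := by
  induction h with
  | skip | loop_false => exact .refl _ _ _
  | set z e s => exact .set z e s _
  | store a i e s => exact .store a i e s _ _
  | seq _ _ ih₁ ih₂ => exact (ih₁.seq_left _).trans (ih₂.seq_right _)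
  | ite_true _ _ ih => exact ih.ite_left _ _
  | ite_false _ _ ih => exact ih.ite_right _ _
  | loop_true _ _ _ ih₁ ih₂ => exact (ih₁.loop _).trans ih₂

/-- A scheme for counting amortized time: a potential, which depends on the parent pointers and
the ranks of the disjoint sets, and the number of steps in a unit of amortized time.  A unit pays
for any single command of the programs considered here, whose expressions and tests cost less than
20 steps. -/
structure Amortization where
  pot : (ℕ → ℕ) → (ℕ → ℕ) → ℕ
  unit : ℕ
  le_unit : 20 ≤ unit

/-- Total correctness with amortized time: started in `s`, the program `c` halts in a memory `s'`
within amortized time at most `u`, for some `u` and `s'` with `Q u s'`. -/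
def Run (A : Amortization) (c : Cmd) (s : Mem) (Q : ℕ → Mem → Prop) : Prop :=
  ∃ u s' t, Exec c s t s' ∧
    t + A.pot (s'.arr .uf) (s'.arr .rank) ≤ A.pot (s.arr .uf) (s.arr .rank) + A.unit * u ∧ Q u s'

namespace Run

variable {A : Amortization} {b : Test} {c d : Cmd} {s : Mem} {Q Q' : ℕ → Mem → Prop}

theorem imp (h : Run A c s Q) (hQ : ∀ u s', Q u s' → c.Frame s s' → Q' u s') : Run A c s Q' := by
  obtain ⟨u, s', t, hx, ht, hq⟩ := h
  exact ⟨u, s', t, hx, ht, hQ u s' hq hx.frame⟩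

theorem seq (h : Run A c s fun u s' => Run A d s' fun u' => Q (u + u')) :
    Run A (.seq c d) s Q := by
  obtain ⟨u, s', t, hx, ht, u', s'', t', hx', ht', hq⟩ := h
  exact ⟨u + u', s'', t + t', hx.seq hx', by rw [mul_add]; omega, hq⟩

theorem bind (h : Run A c s Q)
    (h' : ∀ u s', Q u s' → c.Frame s s' → Run A d s' fun u' => Q' (u + u')) :
    Run A (.seq c d) s Q' :=
  (h.imp h').seq

theorem skip (h : Q 1 s) : Run A .skip s Q :=
  ⟨1, s, 1, .skip s, by have := A.le_unit; omega, h⟩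

theorem set {z : Reg} {e : Exp} (he : e.cost < 20) (h : Q 1 (s.setReg z (e.eval s))) :
    Run A (.set z e) s Q :=
  ⟨1, _, _, .set z e s, by have := A.le_unit; simp only [Mem.setReg_arr]; omega, h⟩

theorem set_seq {z : Reg} {e : Exp} (he : e.cost < 20)
    (h : Run A c (s.setReg z (e.eval s)) fun u => Q (1 + u)) :
    Run A (.seq (.set z e) c) s Q :=
  seq (set he h)

theorem store {a : Arr} {i e : Exp} (ha : a ≠ .uf ∧ a ≠ .rank) (he : i.cost + e.cost < 20)
    (h : Q 1 (s.setArr a (i.eval s) (e.eval s))) : Run A (.store a i e) s Q := by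
  refine ⟨1, _, _, .store a i e s, ?_, h⟩
  have := A.le_unit
  simp only [Mem.setArr_arr, ha.1.symm, ha.2.symm, if_false]
  omega

theorem store_seq {a : Arr} {i e : Exp} (ha : a ≠ .uf ∧ a ≠ .rank) (he : i.cost + e.cost < 20)
    (h : Run A c (s.setArr a (i.eval s) (e.eval s)) fun u => Q (1 + u)) :
    Run A (.seq (.store a i e) c) s Q :=
  seq (store ha he h)

theorem ite (hb : b.cost < 20) (h₁ : b.Holds s → Run A c s fun u => Q (1 + u))
    (h₂ : ¬ b.Holds s → Run A d s fun u => Q (1 + u)) : Run A (.ite b c d) s Q := by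
  have := A.le_unit
  by_cases h : b.Holds s
  · obtain ⟨u, s', t, hx, ht, hq⟩ := h₁ h
    exact ⟨1 + u, s', _, .ite_true h hx, by rw [mul_add]; omega, hq⟩
  · obtain ⟨u, s', t, hx, ht, hq⟩ := h₂ h
    exact ⟨1 + u, s', _, .ite_false h hx, by rw [mul_add]; omega, hq⟩

theorem onlyIf (hb : b.cost < 20) (h₁ : b.Holds s → Run A c s fun u => Q (1 + u))
    (h₂ : ¬ b.Holds s → Q 2 s) : Run A (onlyIf b c) s Q :=
  ite hb h₁ fun h => skip (h₂ h)

theorem loop_of_not_holds (hb : b.cost < 20) (h : ¬ b.Holds s) (hQ : Q 1 s) :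
    Run A (.loop b c) s Q :=
  ⟨1, s, _, .loop_false h, by have := A.le_unit; omega, hQ⟩

theorem loop_of_holds (hb : b.cost < 20) (h : b.Holds s)
    (hc : Run A c s fun u s' => Run A (.loop b c) s' fun u' => Q (1 + u + u')) :
    Run A (.loop b c) s Q := by
  obtain ⟨u, s', t, hx, ht, u', s'', t', hx', ht', hQ⟩ := hc
  have := A.le_unit
  exact ⟨1 + u + u', s'', _, .loop_true h hx hx', by rw [mul_add, mul_add]; omega, hQ⟩

/-- The first argument of the invariant `I` is the variant of the loop, and the second one is the
amortized time so far. -/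
theorem loop (hb : b.cost < 20) (I : ℕ → ℕ → Mem → Prop) {k₀ : ℕ} (h₀ : I k₀ 0 s)
    (step : ∀ k u s', (Cmd.loop b c).Frame s s' → I k u s' → b.Holds s' →
      Run A c s' fun u' s'' => ∃ k' < k, I k' (u + (1 + u')) s'')
    (final : ∀ k u s', (Cmd.loop b c).Frame s s' → I k u s' → ¬ b.Holds s' → Q (u + 1) s') :
    Run A (.loop b c) s Q := by
  suffices ∀ k u s', (Cmd.loop b c).Frame s s' → I k u s' →
      Run A (.loop b c) s' fun u' => Q (u + u') by
    simpa using this k₀ 0 s (.refl _ _ _) h₀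
  intro k
  induction k using Nat.strong_induction_on with
  | _ k ih =>
    intro u s' hF hI
    by_cases h : b.Holds s'
    · refine loop_of_holds hb h ((step k u s' hF hI h).imp ?_)
      rintro u' s'' ⟨k', hk', hI'⟩ hf
      simpa only [add_assoc] using ih k' hk' _ s'' (hF.trans (hf.loop b)) hI'
    · exact loop_of_not_holds hb h (final k u s' hF hI h)

/-- The invariant `I` is indexed by the value of the counter and the amortized time so far. -/
theorem forRange {z : Reg} {bound : Exp} (B : ℕ) (I : ℕ → ℕ → Mem → Prop)
    (hb : bound.cost < 18) (hz : c.writesReg z = false)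
    (hB : ∀ s', (WTO.forRange z bound c).Frame s s' → bound.eval s' = B)
    (h₀ : I 0 1 (s.setReg z 0))
    (step : ∀ k u s', (WTO.forRange z bound c).Frame s s' → I k u s' → s'.reg z = k → k < B →
      Run A c s' fun u' s'' => I (k + 1) (u + u' + 2) (s''.setReg z (k + 1)))
    (final : ∀ u s', (WTO.forRange z bound c).Frame s s' → I B u s' → s'.reg z = B →
      Q (u + 1) s') : Run A (WTO.forRange z bound c) s Q := by
  have frame {s'} (h : (Cmd.loop (.lt z bound) (.seq c (.set z (.succ z)))).Frame
      (s.setReg z 0) s') : (WTO.forRange z bound c).Frame s s' :=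
    ((Cmd.Frame.set z (.lit 0) s 0).seq_left _).trans (h.seq_right _)
  refine set_seq (by decide) (loop (by simp only [Test.cost, Exp.cost]; omega)
    (fun k u s' => ∃ i ≤ B, I i (u + 1) s' ∧ k = B - i ∧ s'.reg z = i) (k₀ := B)
    ⟨0, Nat.zero_le _, h₀, rfl, by simp⟩ ?_ ?_)
  · rintro _ u s' hF ⟨i, -, hI, rfl, hi⟩ hlt
    simp only [Test.Holds, Exp.eval, hi, hB s' (frame hF)] at hlt
    refine bind (step i _ s' (frame hF) hI hi hlt) fun u' s'' hI' hf => set (by simp [Exp.cost]) ?_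
    have hz' : s''.reg z = i := by rw [hf.reg z hz, hi]
    refine ⟨B - (i + 1), by omega, i + 1, hlt, ?_, rfl, by simp [hz']⟩
    simp only [Exp.eval, hz']
    convert hI' using 1
    omega
  · rintro _ u s' hF ⟨i, hiB, hI, rfl, hi⟩ hlt
    simp only [Test.Holds, Exp.eval, hi, hB s' (frame hF)] at hlt
    obtain rfl : i = B := by omega
    rw [add_comm 1]
    exact final _ _ (frame hF) hI hi

end Run

/-! ### The potential of a disjoint-set forest -/

theorem ack_succ_eq_iterate (k a : ℕ) : ack (k + 1) a = (ack k)^[a + 1] 1 := by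
  induction a with
  | zero => simp
  | succ a ih => rw [ack_succ_succ, ih, ← Function.iterate_succ_apply' (ack k) (a + 1) 1]

theorem exists_iterate_le_lt {f : ℕ → ℕ} {a b n : ℕ} (hab : a ≤ b) (hb : b < f^[n + 1] a) :
    ∃ i ≤ n, f^[i] a ≤ b ∧ b < f^[i + 1] a := by
  induction n with
  | zero => exact ⟨0, le_rfl, hab, hb⟩
  | succ n ih =>
    by_cases h : b < f^[n + 1] a
    · obtain ⟨i, hi, hlt⟩ := ih h
      exact ⟨i, by omega, hlt⟩
    · exact ⟨n + 1, le_rfl, by omega, hb⟩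

/-- The level of a node of rank `a` whose parent has rank `b`: the largest `k < L` with
`ack k a ≤ b`. -/
def level (L a b : ℕ) : ℕ := Nat.findGreatest (fun k => ack k a ≤ b) (L - 1)

theorem level_lt {L : ℕ} (hL : 0 < L) (a b : ℕ) : level L a b < L :=
  (Nat.findGreatest_le _).trans_lt (by omega)

theorem ack_level_le {L a b : ℕ} (h : a < b) : ack (level L a b) a ≤ b :=
  Nat.findGreatest_spec (P := fun k => ack k a ≤ b) (Nat.zero_le _) (by simpa using h)

theorem lt_ack_level_succ {L a b : ℕ} (hb : b < ack L a) : b < ack (level L a b + 1) a := by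
  by_contra! hle
  by_cases h : level L a b + 1 ≤ L - 1
  · exact Nat.findGreatest_is_greatest (P := fun k => ack k a ≤ b) (Nat.lt_succ_self _) h hle
  · have : ack L a ≤ ack (level L a b + 1) a := ack_mono_left a (by omega)
    omega

/-- The potential of a node of rank `a` whose parent has rank `b`: the number of thresholds
`(ack k)^[i] a` with `k < L` and `1 ≤ i ≤ a + 1` that the rank of the parent has still to pass. -/
def nodePot (L a b : ℕ) : ℕ :=
  ((Finset.range L ×ˢ Finset.Icc 1 (a + 1)).filter fun q => b < (ack q.1)^[q.2] a).card

theorem nodePot_le (L a b : ℕ) : nodePot L a b ≤ L * (a + 1) :=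
  (Finset.card_filter_le _ _).trans (by simp)

theorem nodePot_anti (L a : ℕ) {b b' : ℕ} (h : b ≤ b') : nodePot L a b' ≤ nodePot L a b :=
  Finset.card_le_card (Finset.monotone_filter_right _ fun _ _ hq => h.trans_lt hq)

theorem nodePot_lt_of_threshold {L a b r k i : ℕ} (hbr : b ≤ r) (hk : k < L) (hi : 1 ≤ i)
    (hia : i ≤ a + 1) (hb : b < (ack k)^[i] a) (hr : (ack k)^[i] a ≤ r) :
    nodePot L a r < nodePot L a b := by
  refine Finset.card_lt_card ((Finset.ssubset_iff_of_subset
    (Finset.monotone_filter_right _ fun _ _ hq => hbr.trans_lt hq)).2 ⟨(k, i), ?_, ?_⟩)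
  · simp only [Finset.mem_filter, Finset.mem_product, Finset.mem_range, Finset.mem_Icc]
    exact ⟨⟨hk, hi, hia⟩, hb⟩
  · simp only [Finset.mem_filter, not_and, not_lt]
    exact fun _ => hr

/-- If a later node of the path, of rank `c` and with a parent of rank `d`, has the same level `k`,
then the last iterate of `ack k` at `a` that does not exceed `b` is at most `c`, so that the next
one is at most `d ≤ r`: the node passes one more threshold when `r` replaces `b`. -/
theorem nodePot_lt_of_level_eq {L a b c d r : ℕ} (ha : 1 ≤ a) (hab : a < b) (hbc : b ≤ c)
    (hcd : c < d) (hdr : d ≤ r) (hr : r < ack L 1) (hlev : level L a b = level L c d) :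
    nodePot L a r < nodePot L a b := by
  have hL : 0 < L := Nat.pos_of_ne_zero (by rintro rfl; simp only [ack_zero] at hr; omega)
  have hbL : b < ack (level L a b + 1) a :=
    lt_ack_level_succ (by have := ack_mono_right L ha; omega)
  have hd : ack (level L a b) c ≤ d := hlev ▸ ack_level_le hcd
  have hmono : Monotone (ack (level L a b)) := ack_mono_right _
  rw [ack_succ_eq_iterate] at hbL
  obtain ⟨i, hi, hle, hlt⟩ := exists_iterate_le_lt hab.le (hbL.trans_le (hmono.iterate _ ha))
  refine nodePot_lt_of_threshold (by omega) (level_lt hL a b) (by omega) (by omega) hlt ?_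
  rw [Function.iterate_succ_apply']
  exact (hmono (hle.trans hbc)).trans (hd.trans hdr)

/-- The list of the nodes below the root `r` on the path of parent pointers from a node to `r`. -/
inductive IsPath (uf : ℕ → ℕ) (r : ℕ) : ℕ → List ℕ → Prop
  | nil (hr : uf r = r) : IsPath uf r r []
  | cons {x : ℕ} {l : List ℕ} (hx : uf x ≠ x) (hl : IsPath uf r (uf x) l) : IsPath uf r x (x :: l)

theorem IsPath.uf_root {uf : ℕ → ℕ} {r x : ℕ} {l : List ℕ} (h : IsPath uf r x l) : uf r = r := by
  induction h with
  | nil hr => exact hr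
  | cons _ _ ih => exact ih

/-- A forest on the nodes below `N`, given by parent pointers (a root points to itself), with its
ranks and the root of each node.  Every link removes a root and raises ranks by at most one, whence
the bound `rank_le`. -/
structure IsForest (N : ℕ) (uf rank root : ℕ → ℕ) : Prop where
  uf_lt : ∀ x < N, uf x < N
  rank_lt : ∀ x < N, uf x ≠ x → rank x < rank (uf x)
  root_lt : ∀ x < N, root x < N
  uf_root : ∀ x < N, uf (root x) = root x
  root_uf : ∀ x < N, root (uf x) = root x
  root_eq : ∀ x < N, uf x = x → root x = x
  rank_le : ∀ x < N, rank x + ((Finset.range N).filter fun y => uf y = y).card ≤ N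

namespace IsForest

variable {N r x : ℕ} {uf rank root : ℕ → ℕ} {l : List ℕ}

theorem rank_lt_card (h : IsForest N uf rank root) (hx : x < N) : rank x < N := by
  have hroots : 0 < ((Finset.range N).filter fun y => uf y = y).card :=
    Finset.card_pos.2 ⟨root x, by simp [h.root_lt x hx, h.uf_root x hx]⟩
  have := h.rank_le x hx
  omega

theorem exists_path (h : IsForest N uf rank root) (hx : x < N) : ∃ l, IsPath uf (root x) x l := by
  induction hk : N - rank x using Nat.strong_induction_on generalizing x with
  | _ k ih =>
    by_cases hu : uf x = x
    · exact ⟨[], (h.root_eq x hx hu).symm ▸ .nil hu⟩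
    · have hrank := h.rank_lt x hx hu
      have hlt := h.rank_lt_card hx
      obtain ⟨l, hl⟩ := ih _ (by omega) (h.uf_lt x hx) rfl
      exact ⟨x :: l, .cons hu (h.root_uf x hx ▸ hl)⟩

theorem root_eq_of_path (h : IsForest N uf rank root) (hx : x < N) (hl : IsPath uf r x l) :
    root x = r := by
  induction hl with
  | nil hr => exact h.root_eq r hx hr
  | @cons x _ _ _ ih => rw [← h.root_uf x hx, ih (h.uf_lt x hx)]

theorem rank_le_rank_root (h : IsForest N uf rank root) (hx : x < N) :
    rank x ≤ rank (root x) := by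
  obtain ⟨l, hl⟩ := h.exists_path hx
  generalize root x = r at hl
  induction hl with
  | nil => exact le_rfl
  | @cons x _ hu _ ih => exact (h.rank_lt x hx hu).le.trans (ih (h.uf_lt x hx))

theorem rank_uf_le_rank_root (h : IsForest N uf rank root) (hx : x < N) :
    rank (uf x) ≤ rank (root x) :=
  h.root_uf x hx ▸ h.rank_le_rank_root (h.uf_lt x hx)

theorem mem_path (h : IsForest N uf rank root) (hx : x < N) (hl : IsPath uf r x l) {y : ℕ}
    (hy : y ∈ l) : y < N ∧ uf y ≠ y ∧ root y = r ∧ rank x ≤ rank y := by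
  induction hl with
  | nil => simp at hy
  | @cons x l hu hl ih =>
    rcases List.mem_cons.1 hy with rfl | hy
    · exact ⟨hx, hu, h.root_eq_of_path hx (.cons hu hl), le_rfl⟩
    · obtain ⟨hyN, huy, hroot, hrank⟩ := ih (h.uf_lt x hx) hy
      exact ⟨hyN, huy, hroot, (h.rank_lt x hx hu).le.trans hrank⟩

theorem nodup_path (h : IsForest N uf rank root) (hx : x < N) (hl : IsPath uf r x l) :
    l.Nodup := by
  induction hl with
  | nil => exact List.nodup_nil
  | @cons x l hu hl ih =>
    refine List.nodup_cons.2 ⟨fun hmem => ?_, ih (h.uf_lt x hx)⟩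
    have hle := (h.mem_path (h.uf_lt x hx) hl hmem).2.2.2
    exact absurd (h.rank_lt x hx hu) (by omega)

/-- Redirecting the nodes of a path to the root lowers the potential of every node whose level
occurs again later on the path; hence only one node per level is left unpaid. -/
theorem sum_nodePot_add_length_le (h : IsForest N uf rank root) {L : ℕ} (hN : N < ack L 1)
    (hx : x < N) (hl : IsPath uf r x l) :
    (l.map fun y => nodePot L (rank y + 1) (rank r + 1)).sum + l.length ≤
      (l.map fun y => nodePot L (rank y + 1) (rank (uf y) + 1)).sum +
        (l.map fun y => level L (rank y + 1) (rank (uf y) + 1)).toFinset.card := by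
  induction hl with
  | nil => simp
  | @cons x l hu hl ih =>
    have hux := h.uf_lt x hx
    have hroot := h.root_eq_of_path hx (.cons hu hl)
    have hanti : nodePot L (rank x + 1) (rank r + 1) ≤ nodePot L (rank x + 1) (rank (uf x) + 1) :=
      nodePot_anti _ _ (by have := h.rank_uf_le_rank_root hx; rw [hroot] at this; omega)
    have ih := ih hux
    simp only [List.map_cons, List.sum_cons, List.length_cons, List.toFinset_cons]
    by_cases hmem : level L (rank x + 1) (rank (uf x) + 1) ∈
        (l.map fun y => level L (rank y + 1) (rank (uf y) + 1)).toFinset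
    · rw [Finset.insert_eq_of_mem hmem]
      obtain ⟨z, hz, hlev⟩ := List.mem_map.1 (List.mem_toFinset.1 hmem)
      obtain ⟨hzN, huz, hzr, hxz⟩ := h.mem_path hux hl hz
      have hxlt := h.rank_lt x hx hu
      have hzlt := h.rank_lt z hzN huz
      have hzle := h.rank_uf_le_rank_root hzN
      have hrN := h.rank_lt_card (h.root_lt z hzN)
      rw [hzr] at hzle hrN
      have : nodePot L (rank x + 1) (rank r + 1) < nodePot L (rank x + 1) (rank (uf x) + 1) :=
        nodePot_lt_of_level_eq (c := rank z + 1) (d := rank (uf z) + 1) (by omega) (by omega)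
          (by omega) (by omega) (by omega) (by omega) hlev.symm
      omega
    · rw [Finset.card_insert_of_notMem hmem]
      omega

end IsForest

/-- The contribution of the node `x` to the potential of a disjoint-set forest.  Ranks are increased
by one because `nodePot_lt_of_level_eq` needs positive ranks. -/
def pointPot (L : ℕ) (uf rank : ℕ → ℕ) (x : ℕ) : ℕ :=
  if uf x = x then L * (rank x + 2) else nodePot L (rank x + 1) (rank (uf x) + 1)

/-- The potential of a disjoint-set forest on the nodes below `N`. -/
def forestPot (L N : ℕ) (uf rank : ℕ → ℕ) : ℕ := ∑ x ∈ Finset.range N, pointPot L uf rank x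

/-- The parent pointers after the compression of the path `l` to the root `r`. -/
def compressed (uf : ℕ → ℕ) (r : ℕ) (l : List ℕ) : ℕ → ℕ := fun y => if y ∈ l then r else uf y

namespace IsForest

variable {N L r x : ℕ} {uf rank root : ℕ → ℕ} {l : List ℕ}

theorem compressed_eq_self_iff (h : IsForest N uf rank root) (hx : x < N) (hl : IsPath uf r x l)
    (y : ℕ) : compressed uf r l y = y ↔ uf y = y := by
  unfold compressed
  split_ifs with hy
  · have hne := (h.mem_path hx hl hy).2.1
    simp only [hne, iff_false]
    rintro rfl
    exact hne hl.uf_root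
  · rfl

theorem forestPot_compressed_add_length_le (h : IsForest N uf rank root) (hL : 0 < L)
    (hN : N < ack L 1) (hx : x < N) (hl : IsPath uf r x l) :
    forestPot L N (compressed uf r l) rank + l.length ≤ forestPot L N uf rank + L := by
  have hpath := h.sum_nodePot_add_length_le hN hx hl
  have hlevels : (l.map fun y => level L (rank y + 1) (rank (uf y) + 1)).toFinset.card ≤ L := by
    refine (Finset.card_le_card (t := Finset.range L) fun k hk => ?_).trans_eq
      (Finset.card_range L)
    obtain ⟨z, -, rfl⟩ := List.mem_map.1 (List.mem_toFinset.1 hk)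
    exact Finset.mem_range.2 (level_lt hL _ _)
  have hsub : l.toFinset ⊆ Finset.range N := fun y hy =>
    Finset.mem_range.2 (h.mem_path hx hl (List.mem_toFinset.1 hy)).1
  have hoff : ∑ y ∈ Finset.range N \ l.toFinset, pointPot L (compressed uf r l) rank y =
      ∑ y ∈ Finset.range N \ l.toFinset, pointPot L uf rank y :=
    Finset.sum_congr rfl fun y hy => by
      have hy : y ∉ l := by simpa using (Finset.mem_sdiff.1 hy).2
      simp [pointPot, compressed, hy]
  have hnew : ∑ y ∈ l.toFinset, pointPot L (compressed uf r l) rank y =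
      ∑ y ∈ l.toFinset, nodePot L (rank y + 1) (rank r + 1) :=
    Finset.sum_congr rfl fun y hy => by
      have hy := List.mem_toFinset.1 hy
      rw [pointPot, if_neg (mt (h.compressed_eq_self_iff hx hl y).1 (h.mem_path hx hl hy).2.1),
        compressed, if_pos hy]
  have hold : ∑ y ∈ l.toFinset, pointPot L uf rank y =
      ∑ y ∈ l.toFinset, nodePot L (rank y + 1) (rank (uf y) + 1) :=
    Finset.sum_congr rfl fun y hy => if_neg (h.mem_path hx hl (List.mem_toFinset.1 hy)).2.1
  have hnd := h.nodup_path hx hl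
  rw [← List.sum_toFinset _ hnd, ← List.sum_toFinset _ hnd] at hpath
  unfold forestPot
  rw [← Finset.sum_sdiff hsub, ← Finset.sum_sdiff hsub, hoff, hnew, hold]
  omega

theorem compressed (h : IsForest N uf rank root) (hx : x < N) (hl : IsPath uf r x l) :
    IsForest N (compressed uf r l) rank root := by
  have hfix := h.compressed_eq_self_iff hx hl
  have hrN : r < N := h.root_eq_of_path hx hl ▸ h.root_lt x hx
  refine ⟨fun y hy => ?_, fun y hy hne => ?_, h.root_lt, fun y hy => (hfix _).2 (h.uf_root y hy),
    fun y hy => ?_, fun y hy hu => h.root_eq y hy ((hfix y).1 hu), fun y hy => ?_⟩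
  · unfold WTO.compressed
    split_ifs
    exacts [hrN, h.uf_lt y hy]
  · have hlt := h.rank_lt y hy (mt (hfix y).2 hne)
    unfold WTO.compressed
    split_ifs with hmem
    · exact hlt.trans_le ((h.mem_path hx hl hmem).2.2.1 ▸ h.rank_uf_le_rank_root hy)
    · exact hlt
  · unfold WTO.compressed
    split_ifs with hmem
    · rw [h.root_eq r hrN hl.uf_root, (h.mem_path hx hl hmem).2.2.1]
    · exact h.root_uf y hy
  · simpa only [hfix] using h.rank_le y hy

end IsForest

section Link

variable {N L a b c : ℕ} {uf rank root : ℕ → ℕ}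

theorem update_eq_self_iff (hab : a ≠ b) (y : ℕ) :
    Function.update uf a b y = y ↔ uf y = y ∧ y ≠ a := by
  by_cases hy : y = a
  · subst hy; simp [hab.symm]
  · simp [hy]

theorem card_roots_update_add_one (ha : a < N) (hua : uf a = a) (hab : a ≠ b) :
    ((Finset.range N).filter fun y => Function.update uf a b y = y).card + 1 =
      ((Finset.range N).filter fun y => uf y = y).card := by
  rw [← Finset.card_erase_add_one (a := a) (s := (Finset.range N).filter fun y => uf y = y)
    (by simp [ha, hua])]
  congr 2
  ext y
  simp only [Finset.mem_filter, Finset.mem_erase, update_eq_self_iff hab]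
  tauto

/-- The symmetric shape of the new root function does not show which root has become the child. -/
theorem IsForest.link (h : IsForest N uf rank root) (ha : a < N) (hb : b < N)
    (hua : uf a = a) (hub : uf b = b) (hab : a ≠ b) (hac : rank a < c) (hbc : rank b ≤ c)
    (hcb : c ≤ rank b + 1) :
    IsForest N (Function.update uf a b) (Function.update rank b c)
      (fun x => if root x = a ∨ root x = b then b else root x) := by
  have hroot (y : ℕ) : (if root y = a ∨ root y = b then b else root y) =
      if root y = a then b else root y := by grind
  have hrank : ∀ y, rank y ≤ Function.update rank b c y := fun y => by
    by_cases hy : y = b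
    · subst hy; simpa using hbc
    · simp [hy]
  simp only [hroot]
  refine ⟨fun y hy => ?_, fun y hy hne => ?_, fun y hy => ?_, fun y hy => ?_, fun y hy => ?_,
    fun y hy hu => ?_, fun y hy => ?_⟩
  · by_cases hya : y = a
    · subst hya; simpa using hb
    · simpa [hya] using h.uf_lt y hy
  · by_cases hya : y = a
    · subst hya; simpa [hab] using hac
    · rw [Function.update_of_ne hya] at hne ⊢
      rw [Function.update_of_ne (by rintro rfl; exact hne hub)]
      exact (h.rank_lt y hy hne).trans_le (hrank _)
  · split_ifs
    exacts [hb, h.root_lt y hy]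
  · rw [update_eq_self_iff hab]
    split_ifs with hya
    exacts [⟨hub, hab.symm⟩, ⟨h.uf_root y hy, hya⟩]
  · by_cases hya : y = a
    · subst hya; simp [h.root_eq y ha hua, h.root_eq b hb hub, hab.symm]
    · simp [hya, h.root_uf y hy]
  · rw [update_eq_self_iff hab] at hu
    simp [h.root_eq y hy hu.1, hu.2]
  · have hcard := card_roots_update_add_one (uf := uf) ha hua hab
    have hy := h.rank_le y hy
    have hb := h.rank_le b hb
    by_cases hyb : y = b
    · rw [hyb, Function.update_self]; omega
    · rw [Function.update_of_ne hyb]; omega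

theorem forestPot_update_uf_le (hua : uf a = a) (hab : a ≠ b) :
    forestPot L N (Function.update uf a b) rank ≤ forestPot L N uf rank := by
  refine Finset.sum_le_sum fun x _ => ?_
  by_cases hxa : x = a
  · subst hxa
    simpa [pointPot, hab.symm, hua] using nodePot_le L (rank x + 1) (rank b + 1)
  · simp [pointPot, hxa]

theorem forestPot_update_rank_le (hb : b < N) (hub : uf b = b) :
    forestPot L N uf (Function.update rank b (rank b + 1)) ≤ forestPot L N uf rank + L := by
  have hbN : b ∈ Finset.range N := Finset.mem_range.2 hb
  unfold forestPot
  rw [← Finset.add_sum_erase _ _ hbN, ← Finset.add_sum_erase _ _ hbN]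
  have hroot : pointPot L uf (Function.update rank b (rank b + 1)) b =
      pointPot L uf rank b + L := by
    simp only [pointPot, hub, if_true, Function.update_self]
    ring
  have hrest : ∑ x ∈ (Finset.range N).erase b,
      pointPot L uf (Function.update rank b (rank b + 1)) x ≤
        ∑ x ∈ (Finset.range N).erase b, pointPot L uf rank x := by
    refine Finset.sum_le_sum fun x hx => ?_
    have hxb := Finset.ne_of_mem_erase hx
    unfold pointPot
    rw [Function.update_of_ne hxb]
    split_ifs
    · exact le_rfl
    · refine nodePot_anti _ _ ?_
      by_cases hux : uf x = b <;> simp [hux]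
  omega

end Link

theorem le_ack_invAck (n : ℕ) : n ≤ ack (invAck n) (invAck n) :=
  Nat.sInf_mem (s := {k : ℕ | n ≤ ack k k}) ⟨n, (lt_ack_right n n).le⟩

theorem succ_lt_ack_invAck_add_four (n : ℕ) : n + 1 < ack (invAck n + 4) 1 := by
  set k := invAck n
  have hk : n ≤ ack (k + 2) 1 := by
    calc n ≤ ack k k := le_ack_invAck n
      _ ≤ ack (k + 1) (ack (k + 1) 1) :=
        (ack_mono_left k (Nat.le_succ k)).trans
          (ack_mono_right _ (by have := add_lt_ack (k + 1) 1; omega))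
      _ = ack (k + 2) 1 := by rw [ack_succ_succ (k + 1) 0, ack_succ_zero]
  have h₃ : ack (k + 2) 1 < ack (k + 3) 1 := ack_strictMono_left 1 (Nat.lt_succ_self _)
  have h₄ : ack (k + 3) 1 < ack (k + 4) 1 := ack_strictMono_left 1 (Nat.lt_succ_self _)
  omega

local infixr:30 " ;; " => Cmd.seq
local infix:40 " ≔ " => Cmd.set
local notation:40 a:max "⟦" i "⟧" " ≔ " e:41 => Cmd.store a i e
local infix:50 " ≐ " => Test.eq
local infix:50 " ≺ " => Test.lt

/-! ### Disjoint sets -/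

section Fragments

open Reg Arr Exp

/-- The first loop of `findRoot`. -/
def climb : Cmd := .loop (.not (uf fr ≐ fr)) (fr ≔ uf fr)

/-- The second loop of `findRoot`. -/
def compress : Cmd := .loop (.not (uf fx ≐ fr)) (fy ≔ uf fx ;; uf⟦fx⟧ ≔ fr ;; fx ≔ fy)

/-- The part of `merge` that finds a root. -/
def findRootOf (z : Reg) (a : Exp) : Cmd := (fx ≔ a ;; findRoot) ;; z ≔ fr

/-- The part of `merge` that links the roots `ra` and `rb`. -/
def linkRoots : Cmd :=
  onlyIf (.not (ra ≐ rb)) (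
    .ite (rank ra ≺ rank rb)
      (uf⟦ra⟧ ≔ rb)
      (uf⟦rb⟧ ≔ ra ;;
       onlyIf (rank ra ≐ rank rb) (rank⟦ra⟧ ≔ succ (rank ra)) ;;
       rb ≔ ra))

end Fragments

/-- The amortization of the operations on disjoint sets of the numbers up to `n`.  A node of a path
costs 9 steps in `climb` and 14 steps in `compress`, whence the factor 23. -/
noncomputable def setAmortization (n : ℕ) : Amortization where
  pot uf rank := 23 * forestPot (invAck n + 4) (n + 1) uf rank
  unit := 100 * (invAck n + 5)
  le_unit := by omega

theorem IsPath.congr {uf uf' : ℕ → ℕ} {r x : ℕ} {l : List ℕ} (h : IsPath uf r x l)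
    (hl : ∀ y ∈ l, uf' y = uf y) (hr : uf' r = uf r) : IsPath uf' r x l := by
  induction h with
  | nil h => exact .nil (hr.trans h)
  | @cons x l hx _ ih =>
    have hux := hl x (by simp)
    refine .cons (by rwa [hux]) ?_
    rw [hux]
    exact ih fun y hy => hl y (by simp [hy])

theorem compressed_nil (uf : ℕ → ℕ) (r : ℕ) : compressed uf r [] = uf := by
  funext y
  simp [compressed]

theorem IsPath.compressed_eq_of_uf_eq {uf : ℕ → ℕ} {r x : ℕ} {l : List ℕ} (h : IsPath uf r x l)
    (hr : uf x = r) : compressed uf r l = uf := by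
  cases h with
  | nil => exact compressed_nil uf r
  | cons _ hl =>
    have hroot := hl.uf_root
    cases hl with
    | nil =>
      funext y
      by_cases hy : y = x <;> simp [compressed, hy]
    | cons hux _ => exact absurd (by rw [hr, hroot]) hux

theorem compressed_update {uf : ℕ → ℕ} {r x : ℕ} {l : List ℕ} (hx : x ∉ l) :
    compressed (Function.update uf x r) r l = compressed uf r (x :: l) := by
  funext y
  by_cases hy : y = x
  · subst hy; simp [compressed, hx]
  · simp [compressed, hy]

theorem exec_climb {s : Mem} {r : ℕ} {l : List ℕ} (h : IsPath (s.arr .uf) r (s.reg .fr) l) :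
    Exec climb s (9 * l.length + 6) (s.setReg .fr r) := by
  generalize hx : s.reg .fr = x at h
  generalize huf : s.arr .uf = uf at h
  induction h generalizing s with
  | nil hr =>
    have hs : s.setReg .fr r = s := by rw [← hx]; simp [Mem.setReg]
    rw [hs]
    exact .loop_false (by simpa [hx, huf] using hr)
  | @cons x l hux _ ih =>
    have hexec := Exec.loop_true (b := .not (.eq (.get .uf (.reg .fr)) (.reg .fr)))
      (by simpa [hx, huf] using hux) (Exec.set .fr (.get .uf (.reg .fr)) s)
      (ih (by simp [hx, huf]) (by simpa using huf))
    have hs : (s.setReg .fr (s.arr .uf (s.reg .fr))).setReg .fr r = s.setReg .fr r := by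
      simp [Mem.setReg]
    rw [show Exp.eval s (.get .uf (.reg .fr)) = s.arr .uf (s.reg .fr) from rfl, hs] at hexec
    convert hexec using 1
    · rfl
    · simp only [List.length_cons, Test.cost, Exp.cost]
      omega

theorem exec_compress {s : Mem} {r : ℕ} {l : List ℕ} (h : IsPath (s.arr .uf) r (s.reg .fx) l)
    (hl : l.Nodup) (hr : s.reg .fr = r) :
    ∃ t s', Exec compress s t s' ∧ t ≤ 14 * l.length + 6 ∧
      s'.arr .uf = compressed (s.arr .uf) r l := by
  induction l generalizing s with
  | nil =>
    cases h with
    | nil hux =>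
      exact ⟨_, s, .loop_false (by simp [hux, hr]), by simp [Test.cost, Exp.cost],
        (compressed_nil _ _).symm⟩
  | cons x l ih =>
    by_cases hroot : s.arr .uf (s.reg .fx) = r
    · exact ⟨_, s, .loop_false (by simp [hroot, hr]), by simp [Test.cost, Exp.cost],
        (h.compressed_eq_of_uf_eq hroot).symm⟩
    cases h with | cons hux h =>
    obtain ⟨hxl, hl⟩ := List.nodup_cons.1 hl
    have hxr : r ≠ s.reg .fx := by
      rintro rfl
      exact hux h.uf_root
    set s₁ := ((s.setReg .fy (s.arr .uf (s.reg .fx))).setArr .uf (s.reg .fx) r).setReg .fx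
      (s.arr .uf (s.reg .fx)) with hs₁
    have hbody := Exec.seq (Exec.set .fy (.get .uf (.reg .fx)) s) (Exec.seq
      (Exec.store .uf (.reg .fx) (.reg .fr) _) (Exec.set .fx (.reg .fy) _))
    have huf : s₁.arr .uf = Function.update (s.arr .uf) (s.reg .fx) r := by simp [hs₁]
    have hfx : s₁.reg .fx = s.arr .uf (s.reg .fx) := by simp [hs₁]
    have hpath : IsPath (s₁.arr .uf) r (s₁.reg .fx) l := by
      rw [huf, hfx]
      refine h.congr (fun y hy => Function.update_of_ne ?_ _ _) (Function.update_of_ne hxr _ _)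
      rintro rfl
      exact hxl hy
    obtain ⟨t, s', hexec, ht, hs'⟩ := ih hpath hl (by simp [hs₁, hr])
    refine ⟨_, s', .loop_true (t' := t) (by simp [hroot, hr]) hbody ?_, ?_,
      by rw [hs', huf, compressed_update hxl]⟩
    · simpa [hr, hs₁, compress] using hexec
    simp only [List.length_cons, Test.cost, Exp.cost]
    omega

theorem run_findRoot {n : ℕ} {s : Mem} {root : ℕ → ℕ}
    (h : IsForest (n + 1) (s.arr .uf) (s.arr .rank) root) (hx : s.reg .fx ≤ n) :
    Run (setAmortization n) findRoot s fun u s' => u = 1 ∧ s'.reg .fr = root (s.reg .fx) ∧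
      IsForest (n + 1) (s'.arr .uf) (s'.arr .rank) root := by
  have hx : s.reg .fx < n + 1 := by omega
  obtain ⟨l, hl⟩ := h.exists_path hx
  have hclimb := exec_climb (s := s.setReg .fr (s.reg .fx)) (r := root (s.reg .fx)) (l := l)
    (by simpa using hl)
  obtain ⟨t, s', hcompress, ht, huf⟩ := exec_compress
    (s := (s.setReg .fr (s.reg .fx)).setReg .fr (root (s.reg .fx))) (r := root (s.reg .fx)) (l := l)
    (by simpa using hl) (h.nodup_path hx hl) (by simp)
  have hfr := hcompress.frame.reg .fr (by decide)
  have hrank := hcompress.frame.arr .rank (by decide)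
  simp only [Mem.setReg_arr, Mem.setReg_reg, if_true] at hfr hrank huf
  refine ⟨1, s', _, (Exec.set .fr (.reg .fx) s).seq (hclimb.seq hcompress), ?_, rfl, hfr, ?_⟩
  · have := h.forestPot_compressed_add_length_le (L := invAck n + 4) (by omega)
      (succ_lt_ack_invAck_add_four n) hx hl
    rw [huf, hrank]
    simp only [setAmortization, Exp.cost]
    omega
  · rw [huf, hrank]
    exact h.compressed hx hl

theorem Run.store_uf {n : ℕ} {s : Mem} {i e : Exp} {Q : ℕ → Mem → Prop}
    (he : i.cost + e.cost < 20) (hi : s.arr .uf (i.eval s) = i.eval s)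
    (hie : i.eval s ≠ e.eval s) (h : Q 1 (s.setArr .uf (i.eval s) (e.eval s))) :
    Run (setAmortization n) (.store .uf i e) s Q := by
  refine ⟨1, _, _, .store .uf i e s, ?_, h⟩
  have := forestPot_update_uf_le (L := invAck n + 4) (N := n + 1) (rank := s.arr .rank) hi hie
  simp only [setAmortization, Mem.setArr_arr, reduceCtorEq, if_true, if_false]
  omega

theorem Run.store_rank {n : ℕ} {s : Mem} {i : Exp} {Q : ℕ → Mem → Prop} (hc : i.cost < 10)
    (hin : i.eval s < n + 1) (hi : s.arr .uf (i.eval s) = i.eval s)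
    (h : Q 1 (s.setArr .rank (i.eval s) (s.arr .rank (i.eval s) + 1))) :
    Run (setAmortization n) (.store .rank i (.succ (.get .rank i))) s Q := by
  refine ⟨1, _, _, .store .rank i _ s, ?_, h⟩
  have := forestPot_update_rank_le (L := invAck n + 4) (rank := s.arr .rank) hin hi
  simp only [setAmortization, Mem.setArr_arr, reduceCtorEq, if_true, if_false, Exp.eval, Exp.cost]
  omega

theorem Run.of_le {A : Amortization} {c : Cmd} {s : Mem} {Q : Mem → Prop} {k : ℕ}
    (h : Run A c s fun u s' => u ≤ k ∧ Q s') : Run A c s fun u s' => u = k ∧ Q s' := by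
  obtain ⟨u, s', t, hexec, ht, hu, hQ⟩ := h
  exact ⟨k, s', t, hexec, ht.trans (Nat.add_le_add_left (Nat.mul_le_mul_left _ hu) _), rfl, hQ⟩

theorem Run.seq_assoc {A : Amortization} {c d e : Cmd} {s : Mem} {Q : ℕ → Mem → Prop}
    (h : Run A (.seq (.seq c d) e) s Q) : Run A (.seq c (.seq d e)) s Q := by
  obtain ⟨u, s', t, hexec, ht, hQ⟩ := h
  cases hexec with | seq hcd he =>
  cases hcd with | seq hc hd =>
  exact ⟨u, s', _, hc.seq (hd.seq he), by omega, hQ⟩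

theorem Cmd.Frame.seq_assoc {c d e : Cmd} {s s' : Mem}
    (h : (Cmd.seq (.seq c d) e).Frame s s') : (Cmd.seq c (.seq d e)).Frame s s' :=
  h.mono (by simp +contextual [writesReg]) (by simp +contextual [writesArr])

theorem run_findRootOf {n : ℕ} {s : Mem} {root : ℕ → ℕ} (z : Reg) {a : Exp}
    (h : IsForest (n + 1) (s.arr .uf) (s.arr .rank) root) (ha : a.cost < 20) (hx : a.eval s ≤ n) :
    Run (setAmortization n) (findRootOf z a) s fun u s' => u = 3 ∧ s'.reg z = root (a.eval s) ∧
      IsForest (n + 1) (s'.arr .uf) (s'.arr .rank) root := by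
  refine Run.seq (Run.set_seq ha ((run_findRoot (by simpa using h) (by simpa using hx)).imp ?_))
  rintro u s' ⟨hu, hfr, h'⟩ -
  exact Run.set (by decide) ⟨by omega, by simpa using hfr, h'⟩

theorem run_linkRoots {n : ℕ} {s : Mem} {root : ℕ → ℕ}
    (h : IsForest (n + 1) (s.arr .uf) (s.arr .rank) root)
    (hp : s.reg .ra < n + 1) (hq : s.reg .rb < n + 1)
    (hup : s.arr .uf (s.reg .ra) = s.reg .ra) (huq : s.arr .uf (s.reg .rb) = s.reg .rb) :
    Run (setAmortization n) linkRoots s fun u s' => u = 7 ∧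
      (s'.reg .rb = s.reg .ra ∨ s'.reg .rb = s.reg .rb) ∧
      IsForest (n + 1) (s'.arr .uf) (s'.arr .rank)
        (fun z => if root z = s.reg .ra ∨ root z = s.reg .rb then s'.reg .rb else root z) := by
  refine Run.of_le (Run.onlyIf (by decide) (fun hpq => ?_) fun hpq => ?_)
  · simp only [Test.Holds, Exp.eval] at hpq
    refine Run.ite (by decide) (fun hlt => ?_) fun hlt => ?_
    · refine Run.store_uf (by decide) (by simpa using hup) (by simpa using hpq)
        ⟨by omega, .inr rfl, ?_⟩
      simpa using h.link hp hq hup huq hpq hlt le_rfl (Nat.le_succ _)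
    simp only [Test.Holds, Exp.eval, not_lt] at hlt
    refine (Run.store_uf (by decide) (by simpa using huq) (by simpa using Ne.symm hpq) ?_).seq
    have hup' : Function.update (s.arr .uf) (s.reg .rb) (s.reg .ra) (s.reg .ra) = s.reg .ra := by
      rw [Function.update_of_ne hpq, hup]
    refine Run.seq (Run.onlyIf (by decide) (fun heq => ?_) fun heq => ?_)
    · have heq : s.arr .rank (s.reg .ra) = s.arr .rank (s.reg .rb) := by simpa using heq
      refine Run.store_rank (by decide) (by simpa using hp) (by simpa using hup')
        (Run.set (by decide) ⟨by omega, .inl (by simp), ?_⟩)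
      simpa [or_comm] using h.link hq hp huq hup (Ne.symm hpq) (by omega) (Nat.le_succ _) le_rfl
    · have heq : s.arr .rank (s.reg .ra) ≠ s.arr .rank (s.reg .rb) := by simpa using heq
      refine Run.set (by decide) ⟨by omega, .inl (by simp), ?_⟩
      simpa [or_comm] using h.link hq hp huq hup (Ne.symm hpq) (by omega) le_rfl (Nat.le_succ _)
  · simp only [Test.Holds, Exp.eval, not_not] at hpq
    refine ⟨by omega, .inr rfl, ?_⟩
    convert h using 2 with z
    grind

/-- Disjoint sets of the numbers below `N`, with the representative `rp x` of the set of `x`.  The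
representative is stored, in the array `name`, at the root of the tree that represents the set. -/
def IsSets (N : ℕ) (uf rank name rp : ℕ → ℕ) : Prop :=
  ∃ root, IsForest N uf rank root ∧
    ∀ x < N, rp x < N ∧ root (rp x) = root x ∧ rp x = name (root x)

theorem IsSets.rp_rp {N : ℕ} {uf rank name rp : ℕ → ℕ} (h : IsSets N uf rank name rp) {x : ℕ}
    (hx : x < N) : rp (rp x) = rp x := by
  obtain ⟨root, -, h⟩ := h
  obtain ⟨hlt, hroot, hname⟩ := h x hx
  rw [(h _ hlt).2.2, hroot, ← hname]

theorem run_rep {n : ℕ} {s : Mem} {rp : ℕ → ℕ} (z : Reg) {a : Exp}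
    (h : IsSets (n + 1) (s.arr .uf) (s.arr .rank) (s.arr .name) rp)
    (ha : a.cost < 20) (hx : a.eval s ≤ n) :
    Run (setAmortization n) (rep z a) s fun u s' => u = 3 ∧ s'.reg z = rp (a.eval s) ∧
      IsSets (n + 1) (s'.arr .uf) (s'.arr .rank) (s'.arr .name) rp := by
  obtain ⟨root, h, hr⟩ := h
  refine Run.set_seq ha ((run_findRoot (by simpa using h) (by simpa using hx)).bind ?_)
  rintro u s' ⟨rfl, hfr, h'⟩ hf
  have hname : s'.arr .name = s.arr .name := hf.arr .name (by decide)
  refine Run.set (by decide) ⟨rfl, ?_, root, h', ?_⟩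
  · simp [hfr, hname, (hr _ (Nat.lt_succ_of_le hx)).2.2]
  · simpa [hname] using hr

/-- The representatives after the sets of `x` and `y` have been united. -/
def mergeRep (rp : ℕ → ℕ) (x y : ℕ) : ℕ → ℕ :=
  fun z => if rp z = rp x ∨ rp z = rp y then y else rp z

theorem IsSets.mergeRep {N r x y : ℕ} {uf rank name rp root : ℕ → ℕ}
    (h : IsForest N uf rank fun z => if root z = root x ∨ root z = root y then r else root z)
    (hr : r = root x ∨ r = root y)
    (hrp : ∀ z < N, rp z < N ∧ root (rp z) = root z ∧ rp z = name (root z))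
    (hx : x < N) (hy : y < N) :
    IsSets N uf rank (Function.update name r y) (mergeRep rp x y) := by
  have heq : ∀ {v w : ℕ}, v < N → w < N → (rp v = rp w ↔ root v = root w) := fun hv hw =>
    ⟨fun h => by rw [← (hrp _ hv).2.1, ← (hrp _ hw).2.1, h],
      fun h => by rw [(hrp _ hv).2.2, (hrp _ hw).2.2, h]⟩
  refine ⟨_, h, fun z hz => ?_⟩
  obtain ⟨hlt, hroot, hname⟩ := hrp z hz
  unfold WTO.mergeRep
  simp only [heq hz hx, heq hz hy]
  by_cases hc : root z = root x ∨ root z = root y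
  · simp [hc, hy]
  · have hne : root z ≠ r := by grind
    simp only [hc, if_false, Function.update_of_ne hne, hroot]
    exact ⟨hlt, trivial, hname⟩

theorem run_merge {n : ℕ} {s : Mem} {rp : ℕ → ℕ} {a b : Exp} {x y : ℕ}
    (h : IsSets (n + 1) (s.arr .uf) (s.arr .rank) (s.arr .name) rp)
    (ha : a.cost < 20) (hb : b.cost < 19)
    (hax : a.eval s = x) (hby : ∀ s', (merge a b).Frame s s' → b.eval s' = y)
    (hx : x ≤ n) (hy : y ≤ n) :
    Run (setAmortization n) (merge a b) s fun u s' => u = 14 ∧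
      IsSets (n + 1) (s'.arr .uf) (s'.arr .rank) (s'.arr .name) (mergeRep rp x y) := by
  obtain ⟨root, h, hrp⟩ := h
  rw [← Nat.lt_succ_iff] at hx hy
  refine Run.seq_assoc (Run.seq_assoc (.bind (run_findRootOf .ra h ha (by omega)) ?_))
  rintro _ s₁ ⟨rfl, hra, h₁⟩ hf₁
  have hF₁ : (merge a b).Frame s s₁ := (hf₁.seq_left _).seq_assoc.seq_assoc
  have hb₁ := hby _ hF₁
  refine Run.seq_assoc (Run.seq_assoc (.bind (run_findRootOf .rb h₁ (by omega) (by omega)) ?_))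
  rintro _ s₂ ⟨rfl, hrb, h₂⟩ hf₂
  have hF₂ : (merge a b).Frame s s₂ := hF₁.trans
    (((hf₂.seq_left _).seq_assoc.seq_assoc.seq_right (findRootOf .ra a)).seq_assoc.seq_assoc)
  have hra : s₂.reg .ra = root x := by rw [hf₂.reg .ra rfl, hra, hax]
  have hrb : s₂.reg .rb = root y := by rw [hrb, hb₁]
  refine (run_linkRoots h₂ (hra ▸ h₂.root_lt x hx) (hrb ▸ h₂.root_lt y hy)
    (hra ▸ h₂.uf_root x hx) (hrb ▸ h₂.uf_root y hy)).bind ?_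
  rintro _ s₃ ⟨rfl, hr, h₃⟩ hf₃
  have hF₃ : (merge a b).Frame s s₃ := hF₂.trans
    ((((hf₃.seq_left _).seq_right (findRootOf .rb b)).seq_assoc.seq_assoc.seq_right
      (findRootOf .ra a)).seq_assoc.seq_assoc)
  have hname : s₃.arr .name = s.arr .name := by
    rw [hf₃.arr .name (by decide), hf₂.arr .name rfl, hf₁.arr .name rfl]
  rw [hra, hrb] at hr h₃
  refine Run.store (by decide) (by simp only [Exp.cost]; omega) ⟨rfl, ?_⟩
  simp only [Exp.eval, hby _ hF₃, Mem.setArr_arr, if_true, reduceCtorEq, if_false, hname]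
  exact IsSets.mergeRep h₃ hr hrp hx hy

/-- The amortization with the same unit and without potential, for the part of a program that runs
before the disjoint sets have been initialized. -/
def Amortization.plain (A : Amortization) : Amortization where
  pot _ _ := 0
  unit := A.unit
  le_unit := A.le_unit

theorem Run.plain_store {A : Amortization} {a : Arr} {i e : Exp} {s : Mem} {Q : ℕ → Mem → Prop}
    (he : i.cost + e.cost < 20) (h : Q 1 (s.setArr a (i.eval s) (e.eval s))) :
    Run A.plain (.store a i e) s Q :=
  ⟨1, _, _, .store a i e s, by
    have := A.le_unit
    simp only [Amortization.plain]
    omega, h⟩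

theorem Run.plain_bind {A : Amortization} {k : ℕ} {c d : Cmd} {s : Mem} {Q Q' : ℕ → Mem → Prop}
    (h : Run A.plain c s Q)
    (hd : ∀ u s', Q u s' → c.Frame s s' →
      A.pot (s'.arr .uf) (s'.arr .rank) ≤ A.unit * k ∧
      Run A d s' fun u' => Q' (u + k + u')) :
    Run A.plain (.seq c d) s Q' := by
  obtain ⟨u, s₁, t, hc, ht, hQ⟩ := h
  obtain ⟨hk, u', s₂, t', hd, ht', hQ'⟩ := hd u s₁ hQ hc.frame
  refine ⟨u + k + u', s₂, t + t', hc.seq hd, ?_, hQ'⟩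
  simp only [Amortization.plain] at ht ⊢
  rw [mul_add, mul_add]
  omega

theorem IsSets.of_singletons {N : ℕ} {uf rank name : ℕ → ℕ} (huf : ∀ x < N, uf x = x)
    (hrank : ∀ x < N, rank x = 0) (hname : ∀ x < N, name x = x) :
    IsSets N uf rank name id := by
  refine ⟨id, ⟨?_, ?_, fun x hx => hx, huf, huf, fun x _ _ => rfl, ?_⟩,
    fun x hx => ⟨hx, rfl, (hname x hx).symm⟩⟩
  · intro x hx
    rwa [huf x hx]
  · intro x hx hne
    exact absurd (huf x hx) hne
  · intro x hx
    rw [hrank x hx, zero_add]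
    exact (Finset.card_filter_le _ _).trans (by simp)

theorem forestPot_singletons {L N : ℕ} {uf rank : ℕ → ℕ} (huf : ∀ x < N, uf x = x)
    (hrank : ∀ x < N, rank x = 0) : forestPot L N uf rank = N * (L * 2) := by
  have h : ∀ x ∈ Finset.range N, pointPot L uf rank x = L * 2 := fun x hx => by
    rw [Finset.mem_range] at hx
    simp [pointPot, huf x hx, hrank x hx]
  rw [forestPot, Finset.sum_congr rfl h]
  simp

theorem run_makeSets {n : ℕ} {s : Mem} (hn : s.reg .n = n) :
    Run (setAmortization n).plain makeSets s fun u s' => u = 5 * (n + 1) + 2 ∧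
      (setAmortization n).pot (s'.arr .uf) (s'.arr .rank) ≤ (setAmortization n).unit * (n + 1) ∧
      IsSets (n + 1) (s'.arr .uf) (s'.arr .rank) (s'.arr .name) id := by
  refine Run.forRange (n + 1) (fun k u s => u = 5 * k + 1 ∧ (∀ x < k, s.arr .uf x = x) ∧
    (∀ x < k, s.arr .rank x = 0) ∧ ∀ x < k, s.arr .name x = x)
    (by decide) (by decide) ?_ ⟨rfl, by simp⟩ ?_ ?_
  · intro s' hF
    simp [hF.reg .n (by decide), hn]
  · rintro k u s - ⟨hu, huf, hrank, hname⟩ hi -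
    refine (Run.plain_store (by decide) ((Run.plain_store (by decide)
      (Run.plain_store (by decide) ⟨by omega, ?_⟩)).seq)).seq
    simp only [Exp.eval, Mem.setArr_arr, Mem.setArr_reg, Mem.setReg_arr, hi, reduceCtorEq, if_true,
      if_false, Function.update_apply]
    grind
  · rintro u s - ⟨hu, huf, hrank, hname⟩ -
    refine ⟨by omega, ?_, .of_singletons huf hrank hname⟩
    simp only [setAmortization, forestPot_singletons huf hrank]
    nlinarith

/-! ### Linked lists -/

/-- The linked list that starts at a pointer: one more than the first element, or zero. -/
inductive IsLinkedList (nxt : ℕ → ℕ) : ℕ → List ℕ → Prop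
  | nil : IsLinkedList nxt 0 []
  | cons {e : ℕ} {l : List ℕ} : IsLinkedList nxt (nxt e) l → IsLinkedList nxt (e + 1) (e :: l)

theorem IsLinkedList.congr {nxt nxt' : ℕ → ℕ} {l : List ℕ} {p : ℕ} (h : IsLinkedList nxt p l)
    (hn : ∀ e ∈ l, nxt' e = nxt e) : IsLinkedList nxt' p l := by
  induction h with
  | nil => exact .nil
  | @cons e l _ ih =>
    rw [List.forall_mem_cons] at hn
    exact .cons (hn.1 ▸ ih hn.2)

/-- The invariant `I` is indexed by the elements that remain and the amortized time so far. -/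
theorem Run.forList {A : Amortization} {hd nxt : Arr} {a : Exp} {body : Cmd} {s₀ : Mem}
    {Q : ℕ → Mem → Prop} {l : List ℕ} (hl : IsLinkedList (s₀.arr nxt) (s₀.arr hd (a.eval s₀)) l)
    (I : List ℕ → ℕ → Mem → Prop) (ha : a.cost < 19) (hp : body.writesReg .p = false)
    (hn : body.writesArr nxt = false) (h₀ : I l 1 (s₀.setReg .p (s₀.arr hd (a.eval s₀))))
    (step : ∀ e l u s p, (WTO.forList hd nxt a body).Frame s₀ s → I (e :: l) u s →
      Run A body ((s.setReg .e e).setReg .p p) fun u' s' => I l (u + u' + 3) s')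
    (final : ∀ u s, (WTO.forList hd nxt a body).Frame s₀ s → I [] u s → Q (u + 1) s) :
    Run A (WTO.forList hd nxt a body) s₀ Q := by
  have hF : (WTO.forList hd nxt a body).Frame s₀ s₀ := .refl _ _ _
  have he {s : Mem} {c : ℕ} (h : (WTO.forList hd nxt a body).Frame s₀ s) :=
    h.setReg (z := .e) (c := c) (by simp [WTO.forList, Cmd.writesReg])
  have hp' {s : Mem} {c : ℕ} (h : (WTO.forList hd nxt a body).Frame s₀ s) :=
    h.setReg (z := .p) (c := c) (by simp [WTO.forList, Cmd.writesReg])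
  refine Run.set_seq (by simp only [Exp.cost]; omega) (Run.loop (by decide)
    (fun k u s => ∃ l, (WTO.forList hd nxt a body).Frame s₀ s ∧ I l (u + 1) s ∧
      IsLinkedList (s.arr nxt) (s.reg .p) l ∧ k = l.length)
    (k₀ := l.length) ⟨l, hp' hF, h₀, by simpa using hl, rfl⟩ ?_ ?_)
  · rintro k u s - ⟨l, hF, hI, hl, rfl⟩ hne
    generalize hpe : s.reg .p = p at hl
    cases hl with
    | nil => exact absurd hpe hne
    | @cons e l hl =>
      refine Run.set_seq (by decide) (Run.set_seq (by simp [Exp.cost]) ?_)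
      simp only [Exp.eval, hpe, Nat.add_sub_cancel, Mem.setReg_arr, Mem.setReg_reg, if_true]
      refine (step e l _ s (s.arr nxt e) hF hI).imp fun u' s' hI' hf => ?_
      refine ⟨l.length, by simp, l, (hp' (he hF)).trans (hf.forList hd nxt a), ?_, ?_, rfl⟩
      · convert hI' using 1
        omega
      · rw [hf.arr nxt hn, hf.reg .p hp]
        simpa using hl
  · rintro k u s - ⟨l, hF, hI, hl, rfl⟩ hne
    simp only [Test.Holds, Exp.eval, not_not] at hne
    rw [hne] at hl
    cases hl
    rw [add_comm 1]
    exact final _ _ hF hI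

/-- The linked list that starts at the pointer `p` has the elements `S`, without repetition. -/
def IsListOf (nxt : ℕ → ℕ) (p : ℕ) (S : Finset ℕ) : Prop :=
  ∃ l, IsLinkedList nxt p l ∧ l.Nodup ∧ l.toFinset = S

theorem IsListOf.empty (nxt : ℕ → ℕ) : IsListOf nxt 0 ∅ :=
  ⟨[], .nil, List.nodup_nil, rfl⟩

theorem IsListOf.update {nxt : ℕ → ℕ} {p : ℕ} {S : Finset ℕ} (h : IsListOf nxt p S) {e : ℕ}
    (he : e ∉ S) (c : ℕ) : IsListOf (Function.update nxt e c) p S := by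
  obtain ⟨l, hl, hnodup, rfl⟩ := h
  refine ⟨l, hl.congr fun x hx => Function.update_of_ne ?_ _ _, hnodup, rfl⟩
  rintro rfl
  exact he (List.mem_toFinset.2 hx)

theorem IsListOf.cons {nxt : ℕ → ℕ} {p : ℕ} {S : Finset ℕ} (h : IsListOf nxt p S) {e : ℕ}
    (he : e ∉ S) : IsListOf (Function.update nxt e p) (e + 1) (insert e S) := by
  obtain ⟨l, hl, hnodup, rfl⟩ := h.update he p
  exact ⟨e :: l, .cons (by simpa using hl),
    List.nodup_cons.2 ⟨fun hm => he (List.mem_toFinset.2 hm), hnodup⟩, List.toFinset_cons⟩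

/-- The families of linked lists of edges: back edges by target, cross/forward edges by source,
removed edges by lowest common ancestor, and current non-back edges by current target. -/
inductive Family
  | back | cross | removed | current
  deriving DecidableEq

namespace Family

/-- The array of the heads of the lists. -/
def hd : Family → Arr
  | back => .bHd
  | cross => .cHd
  | removed => .rHd
  | current => .inHd

/-- The array of the successors in the lists. -/
def nxt : Family → Arr
  | back => .bNxt
  | cross => .cNxt
  | removed => .rNxt
  | current => .inNxt

theorem hd_inj {K L : Family} : K.hd = L.hd ↔ K = L := by cases K <;> cases L <;> decide

theorem nxt_inj {K L : Family} : K.nxt = L.nxt ↔ K = L := by cases K <;> cases L <;> decide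

theorem hd_ne_nxt (K L : Family) : K.hd ≠ L.nxt := by cases K <;> cases L <;> decide

/-- The lists of a family are numbered by vertices, and for removed edges also by the virtual root
`n`. -/
def bound (n : ℕ) : Family → ℕ
  | removed => n + 1
  | _ => n

end Family

/-- The place of an edge: `some (K, a)` if it is in list number `a` of the family `K`, and `none` if
it is in no list. -/
abbrev Location := Option (Family × ℕ)

/-- The edges, among those with numbers below `m`, in list number `a` of the family `K`. -/
def edgesAt (m : ℕ) (loc : ℕ → Location) (K : Family) (a : ℕ) : Finset ℕ :=
  {e ∈ Finset.range m | loc e = some (K, a)}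

section EdgesAt

variable {m : ℕ} {loc : ℕ → Location} {K : Family} {a e : ℕ} {k : Location}

theorem edgesAt_update_of_ne (he : loc e ≠ some (K, a)) (hk : k ≠ some (K, a)) :
    edgesAt m (Function.update loc e k) K a = edgesAt m loc K a := by
  refine Finset.filter_congr fun x _ => ?_
  by_cases hx : x = e
  · subst hx; simp [he, hk]
  · simp [hx]

theorem edgesAt_update_self (he : e < m) :
    edgesAt m (Function.update loc e (some (K, a))) K a = insert e (edgesAt m loc K a) := by
  ext x
  by_cases hx : x = e
  · subst hx; simp [edgesAt, he]
  · simp [edgesAt, hx]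

end EdgesAt

/-- For every family `K`, the lists with numbers satisfying `I K` are represented in memory. -/
def HasLists (m : ℕ) (loc : ℕ → Location) (I : Family → ℕ → Prop) (s : Mem) : Prop :=
  ∀ K a, I K a → IsListOf (s.arr K.nxt) (s.arr K.hd a) (edgesAt m loc K a)

namespace HasLists

variable {m : ℕ} {loc : ℕ → Location} {I J : Family → ℕ → Prop} {s s' : Mem}

theorem mono (h : HasLists m loc I s) (hJ : ∀ K a, J K a → I K a) : HasLists m loc J s :=
  fun K a ha => h K a (hJ K a ha)

theorem frame {R : Reg → Bool} {A : Arr → Bool} (h : HasLists m loc I s) (hf : AgreeOff R A s s')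
    (hA : ∀ K : Family, (A K.hd || A K.nxt) = false) : HasLists m loc I s' := fun K a ha => by
  obtain ⟨hhd, hnxt⟩ := Bool.or_eq_false_iff.1 (hA K)
  rw [hf.arr _ hhd, hf.arr _ hnxt]
  exact h K a ha

theorem insert (h : HasLists m loc I s) {e : ℕ} (he : e < m)
    (hJ : ∀ K b, J K b → I K b ∧ loc e ≠ some (K, b)) (L : Family) (x : ℕ) :
    HasLists m (Function.update loc e (some (L, x))) J
      ((s.setArr L.nxt e (s.arr L.hd x)).setArr L.hd x (e + 1)) := by
  intro K b hb
  obtain ⟨hI, hloc⟩ := hJ K b hb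
  have hlist := h K b hI
  have hmem : e ∉ edgesAt m loc K b := fun h => hloc (Finset.mem_filter.1 h).2
  simp only [Mem.setArr_arr, Family.hd_inj, Family.nxt_inj, Family.hd_ne_nxt,
    (Family.hd_ne_nxt _ _).symm, if_false]
  by_cases hK : K = L
  · subst hK
    simp only [if_true]
    by_cases hbx : b = x
    · subst hbx
      rw [Function.update_self, edgesAt_update_self he]
      exact hlist.cons hmem
    · rw [Function.update_of_ne hbx, edgesAt_update_of_ne hloc (by simp [Ne.symm hbx])]
      exact hlist.update hmem _
  · rw [if_neg hK, if_neg hK, edgesAt_update_of_ne hloc (by simp [Ne.symm hK])]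
    exact hlist

theorem run_insertInto (h : HasLists m loc I s) {A : Amortization} {L : Family} {a : Exp} {x : ℕ}
    (he : s.reg .e < m) (hJ : ∀ K b, J K b → I K b ∧ loc (s.reg .e) ≠ some (K, b))
    (hc : a.cost < 15) (ha : ∀ s', (insertInto L.hd L.nxt a).Frame s s' → a.eval s' = x) :
    Run A (insertInto L.hd L.nxt a) s fun u s' => u = 2 ∧
      HasLists m (Function.update loc (s.reg .e) (some (L, x))) J s' := by
  have hF : (insertInto L.hd L.nxt a).Frame s s := .refl _ _ _
  refine Run.store_seq (by cases L <;> decide) (by simp only [Exp.cost]; omega)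
    (Run.store (by cases L <;> decide) (by simp only [Exp.cost]; omega) ⟨rfl, ?_⟩)
  rw [ha _ (hF.setArr (by simp [insertInto, Cmd.writesArr]))]
  simpa [ha _ hF] using h.insert he hJ L x

end HasLists

theorem sum_comp_update_add {ι α : Type*} [DecidableEq ι] {S : Finset ι} (f : α → ℕ) (g : ι → α)
    {i : ι} (hi : i ∈ S) (x : α) :
    ∑ j ∈ S, f (Function.update g i x j) + f (g i) = ∑ j ∈ S, f (g j) + f x := by
  rw [← Finset.add_sum_erase _ _ hi, ← Finset.add_sum_erase _ _ hi, Function.update_self,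
    Finset.sum_congr rfl fun j hj => by rw [Function.update_of_ne (Finset.mem_erase.1 hj).1]]
  omega

/-! ### Scheduling constraints -/

/-- The memory represents the scheduling constraints: there are `fc` of them, on the elements below
`xc`, they are listed by source, and `npred` counts them by target. -/
structure HasConstraints (s : Mem) : Prop where
  src_lt : ∀ c < s.reg .fc, s.arr .fsrc c < s.reg .xc
  tgt_lt : ∀ c < s.reg .fc, s.arr .ftgt c < s.reg .xc
  list : ∀ v < s.reg .xc, IsListOf (s.arr .fNxt) (s.arr .fHd v)
    {c ∈ Finset.range (s.reg .fc) | s.arr .fsrc c = v}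
  npred_eq : ∀ v < s.reg .xc, s.arr .npred v =
    Finset.card {c ∈ Finset.range (s.reg .fc) | s.arr .ftgt c = v}

theorem HasConstraints.frame {R : Reg → Bool} {A : Arr → Bool} {s s' : Mem}
    (h : HasConstraints s) (hf : AgreeOff R A s s') (hR : (R .xc || R .fc) = false)
    (hA : (A .fsrc || A .ftgt || A .fHd || A .fNxt || A .npred) = false) : HasConstraints s' := by
  simp only [Bool.or_eq_false_iff] at hR hA
  obtain ⟨hxc, hfc⟩ := hR
  obtain ⟨⟨⟨⟨hfsrc, hftgt⟩, hfHd⟩, hfNxt⟩, hnpred⟩ := hA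
  obtain ⟨hsrc, htgt, hlist, hnpred_eq⟩ := h
  constructor <;> simpa only [hf.reg _ hxc, hf.reg _ hfc, hf.arr _ hfsrc, hf.arr _ hftgt,
    hf.arr _ hfHd, hf.arr _ hfNxt, hf.arr _ hnpred]

theorem filter_range_succ_update {f : ℕ → ℕ} {k x v : ℕ} :
    {c ∈ Finset.range (k + 1) | Function.update f k x c = v} = if v = x then
      insert k {c ∈ Finset.range k | f c = v} else {c ∈ Finset.range k | f c = v} := by
  ext c
  by_cases hc : c = k
  · subst hc
    by_cases hv : v = x <;> simp [hv, eq_comm]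
  · by_cases hv : v = x <;> simp [hc, hv] <;> omega

/-- The memory after the scheduling constraint from `x` to `y` has been added. -/
def Mem.addConstraint (s : Mem) (x y : ℕ) : Mem :=
  ((((((s.setArr .fsrc (s.reg .fc) x).setArr .ftgt (s.reg .fc) y).setArr .fNxt (s.reg .fc)
    (s.arr .fHd x)).setReg .fc (s.reg .fc + 1)).setArr .fHd x (s.reg .fc + 1)).setArr .npred y
    (s.arr .npred y + 1))

theorem HasConstraints.addConstraint {s : Mem} {x y : ℕ} (h : HasConstraints s)
    (hx : x < s.reg .xc) (hy : y < s.reg .xc) : HasConstraints (s.addConstraint x y) := by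
  constructor <;> simp only [Mem.addConstraint, Mem.setArr_arr, Mem.setArr_reg, Mem.setReg_reg,
    Mem.setReg_arr, reduceCtorEq, if_false, if_true, filter_range_succ_update]
  · intro c hc
    rw [Function.update_apply]
    split_ifs
    · exact hx
    · exact h.src_lt c (by omega)
  · intro c hc
    rw [Function.update_apply]
    split_ifs
    · exact hy
    · exact h.tgt_lt c (by omega)
  · intro v hv
    have hl := h.list v hv
    rw [Function.update_apply]
    split_ifs with hvx
    · subst hvx
      exact hl.cons (by simp)
    · exact hl.update (by simp) _
  · intro v hv
    have hnpred := h.npred_eq v hv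
    rw [Function.update_apply]
    split_ifs with hvy
    · rw [Finset.card_insert_of_notMem (by simp), ← hnpred, hvy]
    · exact hnpred

theorem run_addConstraint {A : Amortization} {s : Mem} {a b : Exp} {x y : ℕ} {Q : ℕ → Mem → Prop}
    (hca : a.cost < 15) (hcb : b.cost < 8)
    (ha : ∀ s', (addConstraint a b).Frame s s' → a.eval s' = x)
    (hb : ∀ s', (addConstraint a b).Frame s s' → b.eval s' = y) (h : Q 6 (s.addConstraint x y)) :
    Run A (addConstraint a b) s Q := by
  have hF : (addConstraint a b).Frame s s := .refl _ _ _
  refine Run.store_seq (by decide) (by simp only [Exp.cost]; omega) ?_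
  simp only [Exp.eval, ha _ hF]
  replace hF := hF.setArr (a := .fsrc) (i := s.reg .fc) (c := x) rfl
  refine Run.store_seq (by decide) (by simp only [Exp.cost]; omega) ?_
  simp only [Exp.eval, hb _ hF, Mem.setArr_reg]
  replace hF := hF.setArr (a := .ftgt) (i := s.reg .fc) (c := y) rfl
  refine Run.store_seq (by decide) (by simp only [Exp.cost]; omega) ?_
  simp only [Exp.eval, ha _ hF, Mem.setArr_reg, Mem.setArr_arr, reduceCtorEq, if_false]
  replace hF := hF.setArr (a := .fNxt) (i := s.reg .fc) (c := s.arr .fHd x) rfl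
  refine Run.set_seq (by decide) ?_
  simp only [Exp.eval, Mem.setArr_reg]
  replace hF := hF.setReg (z := .fc) (c := s.reg .fc + 1) rfl
  refine Run.store_seq (by decide) (by simp only [Exp.cost]; omega) ?_
  simp only [Exp.eval, ha _ hF, Mem.setArr_reg, Mem.setReg_reg, if_true]
  replace hF := hF.setArr (a := .fHd) (i := x) (c := s.reg .fc + 1) rfl
  refine Run.store (by decide) (by simp only [Exp.cost]; omega) ?_
  simpa [hb _ hF, Mem.addConstraint] using h

/-- The memory represents the scheduling constraints and the exits: `ex v` is `exit[v]`. -/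
structure HasExits (n : ℕ) (s : Mem) : Prop where
  constraints : HasConstraints s
  le_xc : n ≤ s.reg .xc
  ex_lt : ∀ v < n, s.arr .ex v < s.reg .xc

theorem HasExits.frame {n : ℕ} {R : Reg → Bool} {A : Arr → Bool} {s s' : Mem}
    (h : HasExits n s) (hf : AgreeOff R A s s') (hR : (R .xc || R .fc) = false)
    (hA : (A .ex || (A .fsrc || A .ftgt || A .fHd || A .fNxt || A .npred)) = false) :
    HasExits n s' := by
  rw [Bool.or_eq_false_iff] at hA
  have hxc := hf.reg _ (Bool.or_eq_false_iff.1 hR).1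
  refine ⟨h.constraints.frame hf hR hA.2, ?_, ?_⟩
  · exact hxc ▸ h.le_xc
  · rw [hf.arr _ hA.1, hxc]
    exact h.ex_lt

/-! ### Initialization -/

/-- The memory holds a graph with `n` vertices and `m` edges, parents, and two numberings. -/
structure HasGraph (n m : ℕ) (s : Mem) : Prop where
  n_eq : s.reg .n = n
  m_eq : s.reg .m = m
  src_lt : ∀ e < m, s.arr .src e < n
  tgt_lt : ∀ e < m, s.arr .tgt e < n
  par_le : ∀ v < n, s.arr .par v ≤ n
  dfn : Set.BijOn (s.arr .dfn) (Set.Iio n) (Set.Iio n)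
  post : Set.BijOn (s.arr .post) (Set.Iio n) (Set.Iio n)

theorem HasGraph.frame {n m : ℕ} {R : Reg → Bool} {A : Arr → Bool} {s s' : Mem}
    (h : HasGraph n m s) (hf : AgreeOff R A s s') (hR : (R .n || R .m) = false)
    (hA : (A .src || A .tgt || A .par || A .dfn || A .post) = false) : HasGraph n m s' := by
  simp only [Bool.or_eq_false_iff] at hR hA
  obtain ⟨hn, hm⟩ := hR
  obtain ⟨⟨⟨⟨hsrc, htgt⟩, hpar⟩, hdfn⟩, hpost⟩ := hA
  obtain ⟨h₁, h₂, h₃, h₄, h₅, h₆, h₇⟩ := h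
  constructor <;> simpa only [hf.reg _ hn, hf.reg _ hm, hf.arr _ hsrc, hf.arr _ htgt,
    hf.arr _ hpar, hf.arr _ hdfn, hf.arr _ hpost]

/-- The part of the initialization that concerns the vertex `v`. -/
structure IsCleared (s : Mem) (v : ℕ) : Prop where
  ex_eq : s.arr .ex v = v
  hd_eq : ∀ K : Family, s.arr K.hd v = 0
  fHd_eq : s.arr .fHd v = 0
  npred_eq : s.arr .npred v = 0
  ord_dfn : s.arr .ord (s.arr .dfn v) = v
  pord_post : s.arr .pord (s.arr .post v) = v

/-- The result of the initialization. -/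
structure IsSetUp (n m : ℕ) (s : Mem) : Prop where
  lists : ∃ loc, HasLists m loc (fun K a => a < K.bound n) s
  ord : Set.LeftInvOn (s.arr .ord) (s.arr .dfn) (Set.Iio n)
  pord : Set.LeftInvOn (s.arr .pord) (s.arr .post) (Set.Iio n)
  xc_eq : s.reg .xc = n
  fc_eq : s.reg .fc = 0
  exits : HasExits n s

section Fragments

open Reg Arr Exp

/-- The body of the loop over the vertices in `setUp`. -/
def clearVertex : Cmd :=
  ex⟦v⟧ ≔ v ;;
  bHd⟦v⟧ ≔ lit 0 ;; cHd⟦v⟧ ≔ lit 0 ;; rHd⟦v⟧ ≔ lit 0 ;; inHd⟦v⟧ ≔ lit 0 ;;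
  fHd⟦v⟧ ≔ lit 0 ;; npred⟦v⟧ ≔ lit 0 ;;
  mark⟦v⟧ ≔ n ;; pmark⟦v⟧ ≔ n ;;
  ord⟦dfn v⟧ ≔ v ;;
  pord⟦post v⟧ ≔ v

/-- The body of the loop over the edges in `setUp`. -/
def classifyEdge : Cmd :=
  u ≔ src e ;;
  v ≔ tgt e ;;
  .ite (.and (.not (dfn u ≺ dfn v)) (.not (post v ≺ post u)))
    (insertInto bHd bNxt v)
    (.ite (par v ≐ u)
      (insertInto inHd inNxt v)
      (insertInto cHd cNxt u))

end Fragments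

theorem run_clearVertices {A : Amortization} {n : ℕ} {s : Mem} (hn : s.reg .n = n)
    (hdfn : Set.InjOn (s.arr .dfn) (Set.Iio n)) (hpost : Set.InjOn (s.arr .post) (Set.Iio n)) :
    Run A (forRange .v (.reg .n) clearVertex) s fun u s' =>
      u = 13 * n + 2 ∧ ∀ v < n, IsCleared s' v := by
  refine Run.forRange n (fun k u s => u = 13 * k + 1 ∧ ∀ v < k, IsCleared s v) (by decide)
    (by decide) (fun s' hF => by simp [hF.reg .n rfl, hn]) ⟨rfl, by simp⟩ ?_ ?_
  · rintro k u s' hF ⟨hu, hcleared⟩ hi hk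
    iterate 10 refine Run.store_seq (by decide) (by decide) ?_
    refine Run.store (by decide) (by decide) ⟨by omega, fun v hv => ?_⟩
    have hdfn' : s'.arr .dfn = s.arr .dfn := hF.arr _ rfl
    have hpost' : s'.arr .post = s.arr .post := hF.arr _ rfl
    by_cases hvk : v = k
    · subst hvk
      refine ⟨?_, fun K => ?_, ?_, ?_, ?_, ?_⟩
      case refine_2 => cases K <;> simp [Family.hd, hi]
      all_goals simp [hi]
    · have hv : v < k := by omega
      have hdv : s'.arr .dfn v ≠ s'.arr .dfn k := hdfn' ▸ hdfn.ne (hv.trans hk) hk hvk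
      have hpv : s'.arr .post v ≠ s'.arr .post k := hpost' ▸ hpost.ne (hv.trans hk) hk hvk
      obtain ⟨hex, hhd, hfHd, hnpred, hord, hpord⟩ := hcleared v hv
      refine ⟨?_, fun K => ?_, ?_, ?_, ?_, ?_⟩
      case refine_2 =>
        have := hhd K
        cases K <;> simpa [Family.hd, hi, hvk] using this
      all_goals simp [hi, hvk, hdv, hpv, hex, hfHd, hnpred, hord, hpord]
  · rintro u s' - ⟨hu, hcleared⟩ -
    exact ⟨by omega, hcleared⟩

theorem run_classifyEdges {A : Amortization} {n m : ℕ} {s : Mem} (hg : HasGraph n m s)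
    (hl : HasLists m (fun _ => none) (fun K a => a < K.bound n) s) :
    Run A (forRange .e (.reg .m) classifyEdge) s fun u s' =>
      u ≤ 8 * m + 2 ∧ ∃ loc, HasLists m loc (fun K a => a < K.bound n) s' := by
  refine Run.forRange m (fun k u s => u ≤ 8 * k + 1 ∧ ∃ loc,
    HasLists m loc (fun K a => a < K.bound n) s ∧ ∀ e, k ≤ e → loc e = none) (by decide)
    (by decide) (fun s' hF => by simp [hF.reg .m rfl, hg.m_eq]) ⟨le_rfl, _, hl, by simp⟩ ?_ ?_
  · rintro k u s' - ⟨hu, loc, hl, hnone⟩ hi hk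
    refine Run.set_seq (by decide) (Run.set_seq (by decide) ?_)
    set s₁ := (s'.setReg .u (Exp.eval s' (.get .src (.reg .e)))).setReg .v
      (Exp.eval (s'.setReg .u (Exp.eval s' (.get .src (.reg .e)))) (.get .tgt (.reg .e))) with hs₁
    have he : s₁.reg .e = k := by simp [hs₁, hi]
    have hinsert (L : Family) (z : Reg)
        (hz : (insertInto L.hd L.nxt (.reg z)).writesReg z = false) :
        Run A (insertInto L.hd L.nxt (.reg z)) s₁ fun u s => u = 2 ∧ ∃ loc,
          HasLists m loc (fun K a => a < K.bound n) (s.setReg .e (k + 1)) ∧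
            ∀ e, k + 1 ≤ e → loc e = none := by
      refine (HasLists.run_insertInto (s := s₁) (x := s₁.reg z) hl (he ▸ hk)
        (fun K b hb => ⟨hb, by simp [he, hnone]⟩) (by simp [Exp.cost])
        fun s hf => hf.reg z hz).imp ?_
      rintro u s ⟨rfl, hl⟩ -
      refine ⟨rfl, _, hl, fun e hke => ?_⟩
      rw [he, Function.update_of_ne (by omega), hnone e (by omega)]
    refine Run.ite (by decide) (fun _ => (hinsert .back .v rfl).imp ?_) fun _ =>
      Run.ite (by decide) (fun _ => (hinsert .current .v rfl).imp ?_)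
        fun _ => (hinsert .cross .u rfl).imp ?_
    all_goals
      rintro u' s'' ⟨rfl, h⟩ -
      exact ⟨by omega, h⟩
  · rintro u s' - ⟨hu, loc, hl, -⟩ -
    exact ⟨by omega, loc, hl⟩

theorem run_setUp {A : Amortization} {n m : ℕ} {s : Mem} (hg : HasGraph n m s) :
    Run A setUp s fun u s' => u ≤ 17 * (n + m + 1) ∧ IsSetUp n m s' := by
  refine Run.set_seq (by decide) (Run.set_seq (by decide) ?_)
  simp only [Exp.eval, hg.n_eq]
  have hg₀ : HasGraph n m ((s.setReg .xc n).setReg .fc 0) :=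
    hg.frame (((AgreeOff.refl setUp.writesReg setUp.writesArr s).setReg rfl).setReg rfl) rfl rfl
  refine (run_clearVertices hg₀.n_eq hg₀.dfn.injOn hg₀.post.injOn).bind ?_
  rintro _ s₁ ⟨rfl, h₁⟩ hf₁
  have hg₁ := hg₀.frame hf₁ rfl rfl
  refine Run.store_seq (by decide) (by decide) ?_
  simp only [Exp.eval, hg₁.n_eq]
  have hg₂ : HasGraph n m (s₁.setArr .rHd n 0) :=
    hg₁.frame ((AgreeOff.refl setUp.writesReg setUp.writesArr s₁).setArr rfl) rfl rfl
  have hl₂ : HasLists m (fun _ => none) (fun K a => a < K.bound n) (s₁.setArr .rHd n 0) := by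
    intro K a ha
    have hhd : (s₁.setArr .rHd n 0).arr K.hd a = 0 := by
      by_cases han : a = n
      · cases K <;> simp_all [Family.hd, Family.bound]
      · have hlt : a < n := by cases K <;> simp only [Family.bound] at ha <;> omega
        have := (h₁ a hlt).hd_eq K
        cases K <;> simp_all [Family.hd]
    rw [hhd, show edgesAt m (fun _ => none) K a = ∅ by simp [edgesAt]]
    exact .empty _
  refine (run_classifyEdges hg₂ hl₂).imp ?_
  rintro u s₃ ⟨hu, hl⟩ hf₃
  have harr (a : Arr) (ha : (forRange .e (.reg .m) classifyEdge).writesArr a = false)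
      (hrHd : a ≠ .rHd) : s₃.arr a = s₁.arr a := by simp [hf₃.arr a ha, hrHd]
  have hxc : s₃.reg .xc = n := (hf₃.reg _ rfl).trans (hf₁.reg _ rfl)
  have hfc : s₃.reg .fc = 0 := (hf₃.reg _ rfl).trans (hf₁.reg _ rfl)
  refine ⟨by omega, hl, fun v hv => ?_, fun v hv => ?_, hxc, hfc,
    ⟨by simp [hfc], by simp [hfc], fun v hv => ?_, fun v hv => ?_⟩, hxc.ge, fun v hv => ?_⟩
  · rw [harr .ord rfl (by decide), harr .dfn rfl (by decide), (h₁ v hv).ord_dfn]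
  · rw [harr .pord rfl (by decide), harr .post rfl (by decide), (h₁ v hv).pord_post]
  · rw [hfc, harr .fHd rfl (by decide), (h₁ v (hxc ▸ hv)).fHd_eq]
    exact .empty _
  · rw [hfc, harr .npred rfl (by decide), (h₁ v (hxc ▸ hv)).npred_eq]
    rfl
  · rw [hxc, harr .ex rfl (by decide), (h₁ v hv).ex_eq]
    exact hv

/-! ### Moving edges between lists -/

/-- The disjoint sets in memory have the representatives `rp`. -/
def HasSets (n : ℕ) (rp : ℕ → ℕ) (s : Mem) : Prop :=
  IsSets (n + 1) (s.arr .uf) (s.arr .rank) (s.arr .name) rp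

theorem HasSets.frame {n : ℕ} {rp : ℕ → ℕ} {R : Reg → Bool} {A : Arr → Bool} {s s' : Mem}
    (h : HasSets n rp s) (hf : AgreeOff R A s s') (hA : (A .uf || A .rank || A .name) = false) :
    HasSets n rp s' := by
  simp only [Bool.or_eq_false_iff] at hA
  obtain ⟨⟨huf, hrank⟩, hname⟩ := hA
  rw [HasSets, hf.arr _ huf, hf.arr _ hrank, hf.arr _ hname]
  exact h

/-- The loop that moves the edges from a list of the family `K` to those lists of the family `L`
that are numbered by the representatives of their targets. -/
def moveEdges (K L : Family) (a : Exp) : Cmd :=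
  forList K.hd K.nxt a (
    rep .q (.get .tgt (.reg .e)) ;;
    insertInto L.hd L.nxt (.reg .q))

/-- Moving an edge takes 8 units, which the weight of its location pays for. -/
theorem run_moveEdges {n m x : ℕ} {s : Mem} {rp : ℕ → ℕ} {loc : ℕ → Location}
    {I : Family → ℕ → Prop} {K L : Family} {a : Exp} (wt : Location → ℕ) (hKL : K ≠ L)
    (hwt : ∀ q, wt (some (L, q)) + 8 ≤ wt (some (K, x))) (htgt : ∀ e < m, s.arr .tgt e ≤ n)
    (hr : HasSets n rp s) (hl : HasLists m loc I s) (hca : a.cost < 19) (hax : a.eval s = x)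
    (hI : I K x) :
    Run (setAmortization n) (moveEdges K L a) s fun u s' => ∃ loc', HasSets n rp s' ∧
      HasLists m loc' (fun J b => I J b ∧ (J, b) ≠ (K, x)) s' ∧
      u + ∑ e ∈ Finset.range m, wt (loc' e) ≤ ∑ e ∈ Finset.range m, wt (loc e) + 2 := by
  obtain ⟨l, hlist, hnodup, hmem⟩ := hl K x hI
  refine Run.forList (l := l) (by rwa [hax]) (fun l u s => ∃ loc', HasSets n rp s ∧
    HasLists m loc' (fun J b => I J b ∧ (J, b) ≠ (K, x)) s ∧ l.Nodup ∧
    (∀ e ∈ l, e < m ∧ loc' e = some (K, x)) ∧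
    u + ∑ e ∈ Finset.range m, wt (loc' e) ≤ ∑ e ∈ Finset.range m, wt (loc e) + 1)
    hca rfl ?_ ?_ ?_ ?_
  · cases K <;> cases L <;> first | rfl | exact absurd rfl hKL
  · refine ⟨loc, hr, hl.mono fun J b h => h.1, hnodup, fun e he => ?_, by omega⟩
    simpa [hmem, edgesAt] using List.mem_toFinset.2 he
  · rintro e l u s₁ p hF ⟨loc, hr, hl, hnodup, hmem, hu⟩
    obtain ⟨hem, hloc⟩ := hmem e (by simp)
    have htgt : s₁.arr .tgt e ≤ n := by
      rw [hF.arr .tgt (by cases L <;> rfl)]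
      exact htgt e hem
    refine (run_rep .q (s := (s₁.setReg .e e).setReg .p p) (a := .get .tgt (.reg .e)) hr
      (by decide) (by simpa using htgt)).bind ?_
    rintro _ s₂ ⟨rfl, -, hr₂⟩ hf₂
    have he₂ : s₂.reg .e = e := by simp [hf₂.reg .e rfl]
    have hl₂ : HasLists m loc _ s₂ :=
      HasLists.frame (s := (s₁.setReg .e e).setReg .p p) hl hf₂ fun J => by cases J <;> rfl
    refine (hl₂.run_insertInto (a := .reg .q) (he₂ ▸ hem) (fun J b h => ⟨h, ?_⟩) (by decide)
      fun s hf => hf.reg .q rfl).imp ?_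
    · rw [he₂, hloc]
      exact fun h' => h.2 (Option.some.inj h').symm
    rintro _ s₃ ⟨rfl, hl₃⟩ hf₃
    refine ⟨_, HasSets.frame hr₂ hf₃ (by cases L <;> rfl), hl₃, hnodup.of_cons,
      fun e' he' => ?_, ?_⟩
    · rw [he₂, Function.update_of_ne]
      · exact hmem e' (List.mem_cons_of_mem _ he')
      · rintro rfl
        exact (List.nodup_cons.1 hnodup).1 he'
    · have hsum := sum_comp_update_add wt loc (Finset.mem_range.2 hem) (some (L, s₂.reg .q))
      rw [hloc] at hsum
      have := hwt (s₂.reg .q)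
      rw [he₂]
      omega
  · rintro u s - ⟨loc, hr, hl, -, -, hu⟩
    exact ⟨loc, hr, hl, by omega⟩

section RemoveAllCrossForwardEdges

open Reg Arr Exp

/-- The body of the loop in `removeAllCrossForwardEdges`. -/
def removeCrossForwardEdgesOf : Cmd :=
  w ≔ pord j ;;
  moveEdges .cross .removed w ;;
  merge w (par w)

end RemoveAllCrossForwardEdges

/-- The weight that pays for the removal of the cross/forward edges. -/
def removalWeight : Location → ℕ
  | some (.cross, _) => 8
  | _ => 0

theorem run_removeCrossForwardEdgesOf {n m k : ℕ} {s : Mem} {rp : ℕ → ℕ} {loc : ℕ → Location}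
    (hg : HasGraph n m s) (hpord : Set.LeftInvOn (s.arr .pord) (s.arr .post) (Set.Iio n))
    (hr : HasSets n rp s)
    (hl : HasLists m loc (fun K a => a < K.bound n ∧ (K = .cross → k ≤ s.arr .post a)) s)
    (hj : s.reg .j = k) (hk : k < n) :
    Run (setAmortization n) removeCrossForwardEdgesOf s fun u s' => ∃ loc' rp', HasSets n rp' s' ∧
      HasLists m loc' (fun K a => a < K.bound n ∧ (K = .cross → k + 1 ≤ s.arr .post a)) s' ∧
      u + ∑ e ∈ Finset.range m, removalWeight (loc' e) ≤
        ∑ e ∈ Finset.range m, removalWeight (loc e) + 17 := by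
  obtain ⟨w, hw, hpost⟩ : ∃ w < n, s.arr .post w = k := hg.post.surjOn hk
  have hwk : s.arr .pord k = w := hpost ▸ hpord hw
  refine Run.set_seq (by decide) ?_
  simp only [Exp.eval, hj, hwk]
  have hg₁ : HasGraph n m (s.setReg .w w) :=
    hg.frame (R := fun z => z = .w) (A := fun _ => false)
      ((AgreeOff.refl _ _ s).setReg rfl) rfl rfl
  refine (run_moveEdges removalWeight (x := w) (by decide) (by simp [removalWeight])
    (fun e he => (hg₁.tgt_lt e he).le) (s := s.setReg .w w) hr hl (by decide) (by simp)
    (by exact ⟨hw, fun _ => hpost.ge⟩)).bind ?_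
  rintro u s₂ ⟨loc', hr₂, hl₂, hu⟩ hf₂
  have hg₂ := hg₁.frame hf₂ rfl rfl
  have hw₂ : s₂.reg .w = w := by simp [hf₂.reg .w rfl]
  refine (run_merge (x := w) (y := s₂.arr .par w) hr₂ (by decide) (by decide) (by simp [hw₂])
    (fun s' hf => by simp [hf.reg .w rfl, hf.arr .par rfl, hw₂]) (le_of_lt hw)
    (hg₂.par_le w hw)).imp ?_
  rintro _ s₃ ⟨rfl, hr₃⟩ hf₃
  refine ⟨loc', _, hr₃, (hl₂.frame hf₃ fun K => by cases K <;> rfl).mono fun K a ha => ?_, by omega⟩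
  refine ⟨⟨ha.1, fun h => (ha.2 h).trans' k.le_succ⟩, ?_⟩
  rintro ⟨⟩
  have := ha.2 rfl
  omega

theorem run_removeAllCrossForwardEdges {n m : ℕ} {s : Mem} (hg : HasGraph n m s)
    (hs : IsSetUp n m s) :
    Run (setAmortization n).plain removeAllCrossForwardEdges s fun u s' =>
      u ≤ 25 * (n + m + 1) ∧
      ∃ loc, HasLists m loc (fun K a => a < K.bound n ∧ K ≠ .cross) s' := by
  refine (run_makeSets hg.n_eq).plain_bind (k := n + 1) ?_
  rintro _ s₀ ⟨rfl, hpot, hsets⟩ hf₀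
  have hg₀ := hg.frame hf₀ rfl rfl
  obtain ⟨loc, hl⟩ := hs.lists
  have hweight : ∑ e ∈ Finset.range m, removalWeight (loc e) ≤ 8 * m := by
    refine (Finset.sum_le_card_nsmul _ _ 8 fun e _ => ?_).trans (by simp [mul_comm])
    unfold removalWeight
    split <;> omega
  refine ⟨hpot, Run.forRange n (fun k u s => ∃ loc rp, HasSets n rp s ∧
    HasLists m loc (fun K a => a < K.bound n ∧ (K = .cross → k ≤ s₀.arr .post a)) s ∧
    u + ∑ e ∈ Finset.range m, removalWeight (loc e) ≤ 19 * k + 8 * m + 1) (by decide) (by decide)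
    (fun s hF => by simp [hF.reg .n rfl, hg₀.n_eq]) ?_ ?_ ?_⟩
  · exact ⟨loc, id, hsets,
      (hl.frame hf₀ fun K => by cases K <;> rfl).mono fun K a h => h.1, by omega⟩
  · rintro k u s hF ⟨loc, rp, hr, hl, hu⟩ hj hk
    have hpost : s.arr .post = s₀.arr .post := hF.arr _ rfl
    have hpord : Set.LeftInvOn (s.arr .pord) (s.arr .post) (Set.Iio n) := by
      rw [hF.arr _ rfl, hF.arr .post rfl, hf₀.arr .pord rfl, hf₀.arr .post rfl]
      exact hs.pord
    refine (run_removeCrossForwardEdgesOf (hg₀.frame hF rfl rfl) hpord hr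
      (by rwa [hpost]) hj hk).imp ?_
    rintro u' s' ⟨loc', rp', hr', hl', hu'⟩ -
    exact ⟨loc', rp', hr', by rwa [hpost] at hl', by omega⟩
  · rintro u s - ⟨loc, rp, -, hl, hu⟩ -
    refine ⟨by omega, loc, hl.mono fun K a ha => ⟨ha.1, fun h => absurd h ha.2⟩⟩

theorem run_restoreCrossForwardEdges {n m h : ℕ} {s : Mem} {rp : ℕ → ℕ} {loc : ℕ → Location}
    {I : Family → ℕ → Prop} (wt : Location → ℕ)
    (hwt : ∀ q, wt (some (.current, q)) + 8 ≤ wt (some (.removed, h)))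
    (hg : HasGraph n m s) (hr : HasSets n rp s) (hl : HasLists m loc I s) (hh : s.reg .h = h)
    (hI : I .removed h) :
    Run (setAmortization n) restoreCrossForwardEdges s fun u s' => ∃ loc', HasSets n rp s' ∧
      HasLists m loc' (fun K b => I K b ∧ (K, b) ≠ (.removed, h)) s' ∧
      u + ∑ e ∈ Finset.range m, wt (loc' e) ≤ ∑ e ∈ Finset.range m, wt (loc e) + 2 :=
  run_moveEdges wt (by decide) hwt (fun e he => (hg.tgt_lt e he).le) hr hl (by decide) hh hI

/-! ### Adding scheduling constraints -/

theorem HasExits.setReg {n : ℕ} {s : Mem} (h : HasExits n s) {z : Reg} (c : ℕ)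
    (hz : (z = .xc || z = .fc) = false) : HasExits n (s.setReg z c) :=
  h.frame (Cmd.Frame.set z (.lit 0) s c)
    (by simpa [Cmd.writesReg, eq_comm (a := z)] using hz) rfl

theorem HasExits.addConstraint {n x y : ℕ} {s : Mem} (h : HasExits n s) (hx : x < s.reg .xc)
    (hy : y < s.reg .xc) : HasExits n (s.addConstraint x y) :=
  ⟨h.constraints.addConstraint hx hy, h.le_xc, h.ex_lt⟩

/-- The loop that adds a constraint from `exit[rep(y)]` for every edge `(y, z)` in the list of
current non-back edges of `v`. -/
def addConstraintsFromExits (b : Exp) : Cmd :=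
  forList .inHd .inNxt (.reg .v) (
    rep .q (.get .src (.reg .e)) ;;
    addConstraint (.get .ex (.reg .q)) b)

theorem run_addConstraintsFromExits {n : ℕ} {s : Mem} {rp : ℕ → ℕ} {S : Finset ℕ} {b : Exp}
    {y : ℕ → ℕ} (hsrc : ∀ e ∈ S, s.arr .src e < n) (hr : HasSets n rp s)
    (hrp : ∀ x < n, rp x < n) (hx : HasExits n s)
    (hl : IsListOf (s.arr .inNxt) (s.arr .inHd (s.reg .v)) S) (hcb : b.cost < 8)
    (hb : ∀ s', (addConstraintsFromExits b).Frame s s' → b.eval s' = y (s'.reg .e))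
    (hy : ∀ e ∈ S, y e < n) :
    Run (setAmortization n) (addConstraintsFromExits b) s fun u s' => u = 12 * S.card + 2 ∧
      s'.reg .fc ≤ s.reg .fc + u ∧ HasSets n rp s' ∧ HasExits n s' := by
  obtain ⟨l, hlist, hnodup, rfl⟩ := hl
  simp only [List.mem_toFinset] at hsrc hy
  rw [List.toFinset_card_of_nodup hnodup]
  refine Run.forList (l := l) hlist (fun l' u s' => u + 12 * l'.length = 12 * l.length + 1 ∧
    l' ⊆ l ∧ s'.reg .fc ≤ s.reg .fc + u ∧ HasSets n rp s' ∧ HasExits n s')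
    (by decide) rfl rfl ?_ ?_ ?_
  · exact ⟨by omega, List.Subset.refl l, by simp, hr, hx.setReg _ rfl⟩
  · rintro e l' u s₁ p hF ⟨hu, hsub, hfc, hr, hx⟩
    obtain ⟨he, hsub⟩ := List.cons_subset.1 hsub
    have hsrc₁ : s₁.arr .src e < n := hF.arr .src rfl ▸ hsrc e he
    set s₂ := (s₁.setReg .e e).setReg .p p with hs₂
    have hF₂ : (addConstraintsFromExits b).Frame s s₂ := (hF.setReg rfl).setReg rfl
    refine (run_rep .q (s := s₂) (a := .get .src (.reg .e)) hr (by decide)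
      (by simpa [hs₂] using hsrc₁.le)).bind ?_
    rintro _ s₃ ⟨rfl, hq, hr₃⟩ hf₃
    have hx₃ : HasExits n s₃ := ((hx.setReg _ rfl).setReg _ rfl).frame hf₃ rfl rfl
    have hF₃ := hF₂.trans ((hf₃.seq_left _).forList .inHd .inNxt (.reg .v))
    have he₃ : s₃.reg .e = e := by simp [hf₃.reg .e rfl, hs₂]
    have hfc₃ : s₃.reg .fc = s₁.reg .fc := by simp [hf₃.reg .fc rfl, hs₂]
    have hq : s₃.reg .q < n := by simpa [hq, hs₂] using hrp _ hsrc₁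
    refine run_addConstraint (x := s₃.arr .ex (s₃.reg .q)) (y := y e) (by decide) hcb
      (fun s' hf => by simp [hf.arr .ex rfl, hf.reg .q rfl])
      (fun s' hf => ?_) ⟨?_, hsub, ?_, hr₃, hx₃.addConstraint (hx₃.ex_lt _ hq) ?_⟩
    · rw [hb s' (hF₃.trans ((hf.seq_right _).forList _ _ _)), hf.reg .e rfl, he₃]
    · rw [List.length_cons] at hu
      omega
    · simp only [Mem.addConstraint, Mem.setArr_reg, Mem.setReg_reg, if_true]
      omega
    · exact (hy e he).trans_le hx₃.le_xc
  · rintro u s₁ - ⟨hu, -, hfc, hr, hx⟩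
    rw [List.length_nil] at hu
    exact ⟨by omega, by omega, hr, hx⟩

theorem run_addConstraintsTo {n m v : ℕ} {s : Mem} {rp : ℕ → ℕ} {loc : ℕ → Location}
    {I : Family → ℕ → Prop} (hg : HasGraph n m s) (hr : HasSets n rp s)
    (hrp : ∀ x < n, rp x < n) (hx : HasExits n s) (hl : HasLists m loc I s) (hv : s.reg .v = v)
    (hI : I .current v) (hvn : v < n) :
    Run (setAmortization n) addConstraintsTo s fun u s' =>
      u ≤ 24 * (edgesAt m loc .current v).card + 5 ∧
      s'.reg .fc ≤ s.reg .fc + u ∧ HasSets n rp s' ∧ HasExits n s' := by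
  have hlt : ∀ e ∈ edgesAt m loc .current v, e < m := fun e he => by
    simpa using (Finset.mem_filter.1 he).1
  refine (run_addConstraintsFromExits (b := .get .tgt (.reg .e)) (y := s.arr .tgt)
    (fun e he => hg.src_lt e (hlt e he)) hr hrp hx (by rw [hv]; exact hl .current v hI)
    (by decide) (fun s' hf => by simp [hf.arr .tgt rfl])
    (fun e he => hg.tgt_lt e (hlt e he))).bind ?_
  rintro _ s₁ ⟨rfl, hfc₁, hr₁, hx₁⟩ hf₁
  have hv₁ : s₁.reg .v = v := (hf₁.reg .v rfl).trans hv
  refine Run.onlyIf (by decide) (fun _ => ?_) fun _ => ⟨by omega, by omega, hr₁, hx₁⟩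
  have hl₁ := hl .current v hI
  refine (run_addConstraintsFromExits (b := .reg .v) (y := fun _ => v)
    (fun e he => hf₁.arr .src rfl ▸ hg.src_lt e (hlt e he)) hr₁ hrp hx₁
    (by rw [hv₁, hf₁.arr .inNxt rfl, hf₁.arr .inHd rfl]; exact hl₁)
    (by decide) (fun s' hf => by simp [hf.reg .v rfl, hv₁]) (fun _ _ => hvn)).imp ?_
  rintro _ s₂ ⟨rfl, hfc₂, hr₂, hx₂⟩ -
  exact ⟨by omega, by omega, hr₂, hx₂⟩

/-! ### The search for nested components -/

/-- The sequences of vertices `P_h` and `N_h`; the latter is followed by the worklist `W_h`. -/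
inductive VertexSeq
  | preds | work

namespace VertexSeq

/-- The array of the entries. -/
def entries : VertexSeq → Arr
  | preds => .pl
  | work => .wl

/-- The array that marks the entries. -/
def marks : VertexSeq → Arr
  | preds => .pmark
  | work => .mark

/-- The register that holds the number of entries. -/
def len : VertexSeq → Reg
  | preds => .np
  | work => .nw

end VertexSeq

/-- The entries of the sequence `V` in memory are distinct, are marked with `h`, and satisfy `P`. -/
structure HasSeq (V : VertexSeq) (P : ℕ → Prop) (s : Mem) : Prop where
  spec : ∀ i < s.reg V.len, P (s.arr V.entries i)
  marks_eq : ∀ i < s.reg V.len, s.arr V.marks (s.arr V.entries i) = s.reg .h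
  injOn : Set.InjOn (s.arr V.entries) (Set.Iio (s.reg V.len))

namespace HasSeq

variable {V : VertexSeq} {P P' : ℕ → Prop} {s s' : Mem}

theorem of_len_eq_zero (h : s.reg V.len = 0) : HasSeq V P s := by
  constructor <;> simp [h]

theorem mono (h : HasSeq V P s) (hP : ∀ x, P x → P' x) : HasSeq V P' s :=
  ⟨fun i hi => hP _ (h.spec i hi), h.marks_eq, h.injOn⟩

theorem frame {R : Reg → Bool} {A : Arr → Bool} (h : HasSeq V P s) (hf : AgreeOff R A s s')
    (hR : (R V.len || R .h) = false) (hA : (A V.entries || A V.marks) = false) :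
    HasSeq V P s' := by
  simp only [Bool.or_eq_false_iff] at hR hA
  obtain ⟨h₁, h₂, h₃⟩ := h
  constructor <;>
    simpa only [hf.reg _ hR.1, hf.reg _ hR.2, hf.arr _ hA.1, hf.arr _ hA.2]

theorem len_le (h : HasSeq V P s) {n : ℕ} (hP : ∀ x, P x → x < n) : s.reg V.len ≤ n := by
  simpa using Finset.card_le_card_of_injOn (s := Finset.range (s.reg V.len)) (t := Finset.range n)
    (s.arr V.entries) (fun i hi => by simpa using hP _ (h.spec i (by simpa using hi)))
    (by rw [Finset.coe_range]; exact h.injOn)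

end HasSeq

/-- The command that marks the vertex in the register `q` and appends it to the sequence `V`. -/
def append (V : VertexSeq) : Cmd :=
  .store V.marks (.reg .q) (.reg .h) ;;
  .store V.entries (.reg V.len) (.reg .q) ;;
  V.len ≔ .succ (.reg V.len)

theorem run_append {A : Amortization} {V : VertexSeq} {P : ℕ → Prop} {s : Mem}
    (h : HasSeq V P s) (hP : P (s.reg .q)) (hq : ∀ i < s.reg V.len, s.arr V.entries i ≠ s.reg .q) :
    Run A (append V) s fun u s' => u = 3 ∧ HasSeq V P s' ∧ s'.reg V.len = s.reg V.len + 1 ∧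
      s'.arr V.entries = Function.update (s.arr V.entries) (s.reg V.len) (s.reg .q) := by
  refine Run.store_seq (by cases V <;> decide) (by cases V <;> decide)
    (Run.store_seq (by cases V <;> decide) (by cases V <;> decide)
      (Run.set (by cases V <;> decide) ?_))
  have hlen : Reg.h ≠ V.len := by cases V <;> decide
  have harr : V.marks ≠ V.entries := by cases V <;> decide
  have hold {i : ℕ} (hi : i < s.reg V.len) :
      Function.update (s.arr V.entries) (s.reg V.len) (s.reg .q) i = s.arr V.entries i :=
    Function.update_of_ne hi.ne _ _
  refine ⟨rfl, ⟨?_, ?_, ?_⟩, by simp, by simp [harr.symm]⟩ <;>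
    simp only [Exp.eval, Mem.setReg_reg, Mem.setReg_arr, Mem.setArr_reg, Mem.setArr_arr, harr,
      harr.symm, hlen, if_true, if_false]
  · refine Nat.forall_lt_succ_right.2 ⟨fun i hi => ?_, by simpa using hP⟩
    rw [hold hi]
    exact h.spec i hi
  · refine Nat.forall_lt_succ_right.2 ⟨fun i hi => ?_, by simp⟩
    rw [hold hi, Function.update_of_ne (hq i hi)]
    exact h.marks_eq i hi
  · rw [← Order.succ_eq_add_one, Order.Iio_succ_eq_insert, Set.injOn_insert (by simp)]
    refine ⟨h.injOn.congr fun i hi => (hold hi).symm, ?_⟩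
    rintro ⟨i, hi, heq⟩
    rw [hold hi, Function.update_self] at heq
    exact hq i hi heq

/-- The loop over an edge list of the family `K` that appends to the sequence `V` those
representatives of the sources that pass the test `b`. -/
def collectReps (K : Family) (a : Exp) (b : Test) (V : VertexSeq) : Cmd :=
  forList K.hd K.nxt a (
    rep .q (.get .src (.reg .e)) ;;
    onlyIf b (append V))

theorem run_collectReps {n : ℕ} {s : Mem} {rp : ℕ → ℕ} {K : Family} {a : Exp} {b : Test}
    {V : VertexSeq} {P : ℕ → Prop} {S : Finset ℕ} (hsrc : ∀ e ∈ S, s.arr .src e < n)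
    (hr : HasSets n rp s) (hl : IsListOf (s.arr K.nxt) (s.arr K.hd (a.eval s)) S)
    (hV : HasSeq V P s) (hca : a.cost < 19) (hcb : b.cost < 20)
    (hb : ∀ s', (collectReps K a b V).Frame s s' → b.Holds s' →
      s'.arr V.marks (s'.reg .q) ≠ s'.reg .h ∧
        ∀ e ∈ S, s'.reg .q = rp (s.arr .src e) → P (s'.reg .q)) :
    Run (setAmortization n) (collectReps K a b V) s fun u s' => u ≤ 10 * S.card + 2 ∧
      HasSets n rp s' ∧ HasSeq V P s' ∧ s.reg V.len ≤ s'.reg V.len ∧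
      s'.reg V.len ≤ s.reg V.len + S.card ∧
      ∀ i < s.reg V.len, s'.arr V.entries i = s.arr V.entries i := by
  obtain ⟨l, hlist, hnodup, rfl⟩ := hl
  simp only [List.mem_toFinset] at hsrc hb
  rw [List.toFinset_card_of_nodup hnodup]
  refine Run.forList (l := l) hlist (fun l' u s' => u + 10 * l'.length ≤ 10 * l.length + 1 ∧
    l' ⊆ l ∧ HasSets n rp s' ∧ HasSeq V P s' ∧ s.reg V.len ≤ s'.reg V.len ∧
    s'.reg V.len + l'.length ≤ s.reg V.len + l.length ∧
    ∀ i < s.reg V.len, s'.arr V.entries i = s.arr V.entries i)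
    hca (by cases V <;> rfl) (by cases K <;> cases V <;> rfl) ?_ ?_ ?_
  · have hlen : V.len ≠ .p := by cases V <;> decide
    exact ⟨by omega, List.Subset.refl l, hr,
      hV.frame (Cmd.Frame.set .p (.lit 0) s _) (by cases V <;> rfl) (by cases V <;> rfl),
      by simp [hlen]⟩
  · rintro e l' u s₁ p hF ⟨hu, hsub, hr, hV, hle, hlen, hpre⟩
    obtain ⟨he, hsub⟩ := List.cons_subset.1 hsub
    rw [List.length_cons] at hu hlen
    have hsrc₁ : s₁.arr .src = s.arr .src := hF.arr .src (by cases V <;> rfl)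
    refine (run_rep .q (s := (s₁.setReg .e e).setReg .p p) (a := .get .src (.reg .e)) hr
      (by decide) (by simpa [hsrc₁] using (hsrc e he).le)).bind ?_
    rintro _ s₂ ⟨rfl, hq, hr₂⟩ hf₂
    have hF₁ : AgreeOff (fun z => z = .e || z = .p || (rep .q (.get .src (.reg .e))).writesReg z)
        (rep .q (.get .src (.reg .e))).writesArr s₁ s₂ :=
      (((AgreeOff.refl _ _ s₁).setReg (by decide)).setReg (by decide)).trans
        (hf₂.mono (by simp) (by simp))
    have hF₂ := ((hF.setReg (by simp [forList, Cmd.writesReg])).setReg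
      (by simp [forList, Cmd.writesReg])).trans ((hf₂.seq_left _).forList K.hd K.nxt a)
    have hV₂ : HasSeq V P s₂ := hV.frame hF₁ (by cases V <;> rfl) (by cases V <;> rfl)
    have hlen₂ : s₂.reg V.len = s₁.reg V.len := hF₁.reg _ (by cases V <;> rfl)
    have hent₂ : s₂.arr V.entries = s₁.arr V.entries := hF₁.arr _ (by cases V <;> rfl)
    refine Run.onlyIf hcb (fun hbs => ?_) fun _ => ?_
    · obtain ⟨hmark, hP⟩ := hb s₂ hF₂ hbs
      refine (run_append hV₂ (hP e he (by simpa [hsrc₁] using hq)) fun i hi h => ?_).imp ?_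
      · exact hmark (h ▸ hV₂.marks_eq i hi)
      rintro _ s₃ ⟨rfl, hV₃, hlen₃, hent₃⟩ hf₃
      refine ⟨by omega, hsub, HasSets.frame hr₂ hf₃ (by cases V <;> rfl), hV₃, by omega, by omega,
        fun i hi => ?_⟩
      rw [hent₃, Function.update_of_ne (by omega), hent₂, hpre i hi]
    · exact ⟨by omega, hsub, hr₂, hV₂, by omega, by omega, by rwa [hent₂]⟩
  · rintro u s₁ - ⟨hu, -, hr, hV, hle, hlen, hpre⟩
    rw [List.length_nil] at hu hlen
    exact ⟨by omega, hr, hV, hle, by omega, hpre⟩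

section FindNestedSCCs

open Reg Arr Exp

/-- The loop in `findNestedSCCs` that computes `P_h`. -/
def findPreds : Cmd :=
  collectReps .back h (.not (pmark q ≐ h)) .preds

/-- The loop in `findNestedSCCs` that initializes the worklist with `P_h \ {h}`. -/
def initWorklist : Cmd :=
  forRange j np (
    q ≔ pl j ;;
    onlyIf (.not (q ≐ h)) (append .work))

/-- The worklist loop in `findNestedSCCs`. -/
def searchBackward : Cmd :=
  .loop (k ≺ nw) (
    v ≔ wl k ;;
    k ≔ succ k ;;
    collectReps .current v (.and (.not (mark q ≐ h)) (.not (q ≐ h))) .work)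

end FindNestedSCCs

theorem run_findPreds {n m a : ℕ} {s : Mem} {rp : ℕ → ℕ} {loc : ℕ → Location}
    {I : Family → ℕ → Prop} (hg : HasGraph n m s) (hr : HasSets n rp s) (hrp : ∀ x < n, rp x < n)
    (hl : HasLists m loc I s) (ha : I .back a) (hh : s.reg .h = a) (hnp : s.reg .np = 0) :
    Run (setAmortization n) findPreds s fun u s' => u ≤ 10 * (edgesAt m loc .back a).card + 2 ∧
      HasSets n rp s' ∧ s'.reg .np ≤ (edgesAt m loc .back a).card ∧
      HasSeq .preds (fun x => x < n ∧ rp x = x) s' := by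
  have hsrc : ∀ e ∈ edgesAt m loc .back a, s.arr .src e < n := fun e he =>
    hg.src_lt e (by simpa using (Finset.mem_filter.1 he).1)
  refine (run_collectReps (V := .preds) (P := fun x => x < n ∧ rp x = x)
    (S := edgesAt m loc .back a) hsrc hr (hh ▸ hl .back a ha) (.of_len_eq_zero hnp)
    (by decide) (by decide) fun s' _ hb => ?_).imp ?_
  · refine ⟨hb, fun e he hq => hq ▸ ?_⟩
    exact ⟨hrp _ (hsrc e he), hr.rp_rp ((hsrc e he).trans n.lt_succ_self)⟩
  · rintro u s' ⟨hu, hr', hV, -, hlen, -⟩ -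
    exact ⟨hu, hr', by simpa [VertexSeq.len, hnp] using hlen, hV⟩

theorem run_initWorklist {A : Amortization} {a b : ℕ} {s : Mem} {P : ℕ → Prop}
    (hp : HasSeq .preds P s) (hh : s.reg .h = a) (hnp : s.reg .np = b) (hnw : s.reg .nw = 0) :
    Run A initWorklist s fun u s' => u ≤ 7 * b + 2 ∧ s'.reg .nw ≤ b ∧
      HasSeq .work (fun x => P x ∧ x ≠ a) s' := by
  refine Run.forRange b (fun k u s' => u ≤ 7 * k + 1 ∧ s'.reg .nw ≤ k ∧
    HasSeq .work (fun x => (P x ∧ x ≠ a) ∧ ∃ i < k, s.arr .pl i = x) s')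
    (by decide) rfl (fun s' hF => (hF.reg .np rfl).trans hnp) ?_ ?_ ?_
  · exact ⟨by omega, by simp [hnw], .of_len_eq_zero hnw⟩
  · rintro k u s₁ hF ⟨hu, hnw, hV⟩ hj hk
    have hpl : s₁.arr .pl = s.arr .pl := hF.arr .pl rfl
    have hkp : k < s.reg .np := by omega
    refine Run.set_seq (by decide) ?_
    simp only [Exp.eval, hj, hpl]
    set s₂ := s₁.setReg .q (s.arr .pl k) with hs₂
    have hmono (x) : ((P x ∧ x ≠ a) ∧ ∃ i < k, s.arr .pl i = x) →
        (P x ∧ x ≠ a) ∧ ∃ i < k + 1, s.arr .pl i = x :=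
      And.imp_right fun ⟨i, hi, hx⟩ => ⟨i, hi.trans k.lt_succ_self, hx⟩
    have hV₂ := hV.frame (Cmd.Frame.set .q (.lit 0) s₁ (s.arr .pl k)) rfl rfl
    refine Run.onlyIf (by decide) (fun hne => ?_) fun _ => ?_
    · have hne : s.arr .pl k ≠ a := by simpa [hs₂, hF.reg .h rfl, hh] using hne
      refine (run_append (hV₂.mono hmono) ?_ fun i hi h => ?_).imp ?_
      · exact ⟨⟨hp.spec k hkp, hne⟩, k, k.lt_succ_self, rfl⟩
      · obtain ⟨-, i', hi', heq⟩ := hV₂.spec i hi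
        exact hi'.ne (hp.injOn (hi'.trans hkp) hkp (heq.trans h))
      rintro _ s₃ ⟨rfl, hV₃, hlen, -⟩ -
      have hlen : s₃.reg .nw = s₁.reg .nw + 1 := hlen
      exact ⟨by omega, by simpa [hlen], hV₃.frame (Cmd.Frame.set .j (.lit 0) _ _) rfl rfl⟩
    · exact ⟨by omega, by simpa [hs₂] using hnw.trans k.le_succ,
        (hV₂.frame (Cmd.Frame.set .j (.lit 0) _ _) rfl rfl).mono hmono⟩
  · rintro u s₁ - ⟨hu, hnw, hV⟩ -
    exact ⟨by omega, hnw, hV.mono fun x h => h.1⟩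

theorem run_searchBackward {n m a : ℕ} {s : Mem} {rp : ℕ → ℕ} {loc : ℕ → Location}
    {I : Family → ℕ → Prop} (hg : HasGraph n m s) (hr : HasSets n rp s)
    (hrp : ∀ x < n, rp x < n) (hl : HasLists m loc I s) (hI : ∀ v < n, I .current v)
    (hh : s.reg .h = a) (hk : s.reg .k = 0)
    (hw : HasSeq .work (fun x => (x < n ∧ rp x = x) ∧ x ≠ a) s) :
    Run (setAmortization n) searchBackward s fun u s' => HasSets n rp s' ∧
      HasSeq .work (fun x => (x < n ∧ rp x = x) ∧ x ≠ a) s' ∧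
      (s.reg .nw = 0 → s'.reg .nw = 0) ∧
      u ≤ ∑ i ∈ Finset.range (s'.reg .nw),
        (10 * (edgesAt m loc .current (s'.arr .wl i)).card + 5) + 1 := by
  refine Run.loop (by decide) (fun κ u s' => HasSets n rp s' ∧
    HasSeq .work (fun x => (x < n ∧ rp x = x) ∧ x ≠ a) s' ∧ (s.reg .nw = 0 → s'.reg .nw = 0) ∧
    s'.reg .k ≤ s'.reg .nw ∧ κ = n - s'.reg .k ∧ u ≤ ∑ i ∈ Finset.range (s'.reg .k),
      (10 * (edgesAt m loc .current (s'.arr .wl i)).card + 5)) (k₀ := n)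
    ⟨hr, hw, id, by omega, by omega, by omega⟩ ?_ ?_
  · rintro _ u s₁ hF ⟨hr₁, hw₁, h0, -, rfl, hu⟩ hlt
    simp only [Test.Holds, Exp.eval] at hlt
    set k := s₁.reg .k with hk₁
    set x := s₁.arr .wl k with hx
    have hxn : x < n := (hw₁.spec k hlt).1.1
    have hkn : k < n := hlt.trans_le (hw₁.len_le fun x hx => hx.1.1)
    refine Run.set_seq (by decide) (Run.set_seq (by decide) ?_)
    simp only [Exp.eval, Mem.setReg_reg, reduceCtorEq, if_false, ← hk₁, ← hx]
    set s₂ := (s₁.setReg .v x).setReg .k (k + 1) with hs₂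
    have hF₂ : searchBackward.Frame s s₂ := (hF.setReg (by decide)).setReg (by decide)
    have hg₂ := hg.frame hF₂ rfl rfl
    have hS : ∀ e ∈ edgesAt m loc .current x, s₂.arr .src e < n := fun e he =>
      hg₂.src_lt e (by simpa using (Finset.mem_filter.1 he).1)
    refine (run_collectReps (V := .work) (P := fun x => (x < n ∧ rp x = x) ∧ x ≠ a) hS hr₁
      (hl.frame hF₂ (fun K => by cases K <;> rfl) .current x (hI x hxn))
      (hw₁.frame (((AgreeOff.refl (fun z => z = .v || z = .k) (fun _ => false) s₁).setReg
        rfl).setReg rfl) rfl rfl) (by decide) (by decide) fun s' hf hb => ?_).imp ?_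
    · have hh' : s'.reg .h = a := (hf.reg .h rfl).trans ((hF₂.reg .h rfl).trans hh)
      refine ⟨hb.1, fun e he hq => ⟨hq ▸ ⟨hrp _ (hS e he),
        hr.rp_rp ((hS e he).trans n.lt_succ_self)⟩, fun h => hb.2 (h.trans hh'.symm)⟩⟩
    · rintro u' s₃ ⟨hu', hr₃, hw₃, hle, -, hpre⟩ hf
      have hle : s₁.reg .nw ≤ s₃.reg .nw := hle
      have hpre : ∀ i < s₁.reg .nw, s₃.arr .wl i = s₁.arr .wl i := hpre
      have hk₃ : s₃.reg .k = k + 1 := by simp [hf.reg .k rfl, hs₂]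
      refine ⟨n - (k + 1), by omega, hr₃, hw₃, fun h => ?_, by omega, by omega, ?_⟩
      · have := h0 h
        omega
      · rw [hk₃, Finset.sum_range_succ, hpre k hlt, Finset.sum_congr rfl fun i hi => by
          rw [hpre i ((Finset.mem_range.1 hi).trans hlt)], ← hx]
        omega
  · rintro _ u s₁ - ⟨hr₁, hw₁, h0, hle, -, hu⟩ hlt
    have hk : s₁.reg .k = s₁.reg .nw := le_antisymm hle (not_lt.1 hlt)
    exact ⟨hr₁, hw₁, h0, by rw [← hk]; omega⟩

theorem run_findNestedSCCs {n m a : ℕ} {s : Mem} {rp : ℕ → ℕ} {loc : ℕ → Location}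
    {I : Family → ℕ → Prop} (hg : HasGraph n m s) (hr : HasSets n rp s)
    (hrp : ∀ x < n, rp x < n) (hl : HasLists m loc I s) (hI : ∀ v < n, I .current v)
    (ha : I .back a) (hh : s.reg .h = a) :
    Run (setAmortization n) findNestedSCCs s fun u s' => HasSets n rp s' ∧
      s'.reg .np ≤ (edgesAt m loc .back a).card ∧
      HasSeq .preds (fun x => x < n ∧ rp x = x) s' ∧
      HasSeq .work (fun x => (x < n ∧ rp x = x) ∧ x ≠ a) s' ∧
      (s'.reg .np = 0 → s'.reg .nw = 0) ∧
      u ≤ 17 * (edgesAt m loc .back a).card + 8 + ∑ i ∈ Finset.range (s'.reg .nw),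
        (10 * (edgesAt m loc .current (s'.arr .wl i)).card + 5) := by
  have hF : findNestedSCCs.Frame s s := .refl _ _ _
  refine Run.set_seq (c := .seq findPreds _) (by decide) ?_
  replace hF := hF.setReg (z := .np) (c := 0) rfl
  refine (run_findPreds (hg.frame hF rfl rfl) hr hrp (hl.frame hF fun K => by cases K <;> rfl) ha
    hh rfl).bind ?_
  rintro u₁ s₁ ⟨hu₁, hr₁, hnp₁, hp₁⟩ hf₁
  replace hF := hF.trans ((hf₁.seq_left _).seq_right _)
  refine Run.set_seq (c := .seq initWorklist _) (by decide) ?_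
  replace hF := hF.setReg (z := .nw) (c := 0) rfl
  refine (run_initWorklist (s := s₁.setReg .nw 0)
    (hp₁.frame (Cmd.Frame.set .nw (.lit 0) s₁ 0) rfl rfl)
    ((hF.reg .h rfl).trans hh) rfl rfl).bind ?_
  rintro u₂ s₂ ⟨hu₂, hnw₂, hw₂⟩ hf₂
  replace hF := hF.trans ((((hf₂.seq_left _).seq_right _).seq_right _).seq_right _)
  have hp₂ := (hp₁.frame (Cmd.Frame.set .nw (.lit 0) s₁ 0) rfl rfl).frame hf₂ rfl rfl
  have hr₂ : HasSets n rp s₂ := HasSets.frame (s := s₁.setReg .nw 0) hr₁ hf₂ rfl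
  have hnp₂ : s₂.reg .np = s₁.reg .np := hf₂.reg .np rfl
  refine Run.set_seq (c := searchBackward) (by decide) ?_
  replace hF := hF.setReg (z := .k) (c := 0) rfl
  refine (run_searchBackward (s := s₂.setReg .k 0) (hg.frame hF rfl rfl)
    hr₂ hrp (hl.frame hF fun K => by cases K <;> rfl) hI
    ((hF.reg .h rfl).trans hh) rfl (hw₂.frame (Cmd.Frame.set .k (.lit 0) s₂ 0) rfl rfl)).imp ?_
  rintro u₃ s₃ ⟨hr₃, hw₃, h0, hu₃⟩ hf₃
  have hnp₃ : s₃.reg .np = s₁.reg .np := (hf₃.reg .np rfl).trans hnp₂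
  have h0 : s₂.reg .nw = 0 → s₃.reg .nw = 0 := h0
  refine ⟨hr₃, by omega, ?_, hw₃, fun h => h0 ?_, ?_⟩
  · exact (hp₂.frame (Cmd.Frame.set .k (.lit 0) s₂ 0) rfl rfl).frame hf₃ rfl rfl
  · have : (s₁.setReg .nw 0).reg .np = s₁.reg .np := rfl
    omega
  · have : (s₁.setReg .nw 0).reg .np = s₁.reg .np := rfl
    omega

/-! ### The constraints of a component -/

section ConstructWPOForSCC

open Reg Arr Exp

/-- The loop in `constructWPOForSCC` that adds the constraints on the vertices in `N_h`. -/
def constrainNested : Cmd :=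
  forRange k nw (
    v ≔ wl k ;;
    addConstraintsTo)

/-- The loop in `constructWPOForSCC` that adds the constraints on the new exit. -/
def constrainExit : Cmd :=
  forRange j np (
    rep q (pl j) ;;
    addConstraint (ex q) x)

/-- The last commands of `constructWPOForSCC`, which make `x` the exit of `h` and merge `N_h`
into `h`. -/
def mergeNested : Cmd :=
  nest⟦x⟧ ≔ h ;;
  ex⟦h⟧ ≔ x ;;
  forRange k nw (
    merge (wl k) h)

/-- The commands of `constructWPOForSCC` that follow `constrainNested`. -/
def addExit : Cmd :=
  x ≔ xc ;;
  xc ≔ succ xc ;;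
  fHd⟦x⟧ ≔ lit 0 ;;
  npred⟦x⟧ ≔ lit 0 ;;
  constrainExit ;;
  mergeNested

end ConstructWPOForSCC

theorem run_constrainNested {n m b : ℕ} {s : Mem} {rp : ℕ → ℕ} {loc : ℕ → Location}
    {I : Family → ℕ → Prop} (hg : HasGraph n m s) (hr : HasSets n rp s)
    (hrp : ∀ x < n, rp x < n) (hx : HasExits n s) (hl : HasLists m loc I s)
    (hI : ∀ v < n, I .current v) (hnw : s.reg .nw = b) (hw : ∀ i < b, s.arr .wl i < n) :
    Run (setAmortization n) constrainNested s fun u s' =>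
      u ≤ ∑ i ∈ Finset.range b, (24 * (edgesAt m loc .current (s.arr .wl i)).card + 8) + 2 ∧
      s'.reg .fc ≤ s.reg .fc + u ∧ HasSets n rp s' ∧ HasExits n s' := by
  refine Run.forRange b (fun k u s' =>
      u ≤ ∑ i ∈ Finset.range k, (24 * (edgesAt m loc .current (s.arr .wl i)).card + 8) + 1 ∧
      s'.reg .fc ≤ s.reg .fc + u ∧ HasSets n rp s' ∧ HasExits n s') (by decide) rfl
    (fun s' hF => (hF.reg .nw rfl).trans hnw) ⟨by simp, by simp, hr, hx.setReg _ rfl⟩ ?_ ?_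
  · rintro k u s₁ hF ⟨hu, hfc, hr, hx⟩ hi hk
    refine Run.set_seq (by decide) ?_
    simp only [Exp.eval, hi, hF.arr .wl rfl]
    replace hF := hF.setReg (z := .v) (c := s.arr .wl k) rfl
    refine (run_addConstraintsTo (hg.frame hF rfl rfl) hr hrp (hx.setReg _ rfl)
      (hl.frame hF fun K => by cases K <;> rfl) (by simp) (hI _ (hw k hk)) (hw k hk)).imp ?_
    rintro u₂ s₂ ⟨hu₂, hfc₂, hr₂, hx₂⟩ -
    simp only [Mem.setReg_reg, reduceCtorEq, if_false] at hfc₂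
    refine ⟨?_, ?_, hr₂, hx₂.setReg _ rfl⟩
    · rw [Finset.sum_range_succ]
      omega
    · simp only [Mem.setReg_reg, reduceCtorEq, if_false]
      omega
  · rintro u s₁ - ⟨hu, hfc, hr, hx⟩ -
    exact ⟨by omega, by omega, hr, hx⟩

/-- The memory after a new exit, without constraints, has been created. -/
def Mem.newExit (s : Mem) : Mem :=
  (((s.setReg .x (s.reg .xc)).setReg .xc (s.reg .xc + 1)).setArr .fHd (s.reg .xc) 0).setArr .npred
    (s.reg .xc) 0

theorem HasConstraints.newExit {s : Mem} (h : HasConstraints s) : HasConstraints s.newExit := by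
  constructor <;> simp only [Mem.newExit, Mem.setArr_arr, Mem.setArr_reg, Mem.setReg_reg,
    Mem.setReg_arr, reduceCtorEq, if_false, if_true]
  · exact fun c hc => (h.src_lt c hc).trans (Nat.lt_succ_self _)
  · exact fun c hc => (h.tgt_lt c hc).trans (Nat.lt_succ_self _)
  · refine Nat.forall_lt_succ_right.2 ⟨fun v hv => ?_, ?_⟩
    · rw [Function.update_of_ne hv.ne]
      exact h.list v hv
    · rw [Function.update_self, Finset.filter_eq_empty_iff.2 fun c hc =>
        (h.src_lt c (Finset.mem_range.1 hc)).ne]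
      exact .empty _
  · refine Nat.forall_lt_succ_right.2 ⟨fun v hv => ?_, ?_⟩
    · rw [Function.update_of_ne hv.ne]
      exact h.npred_eq v hv
    · rw [Function.update_self, Finset.filter_eq_empty_iff.2 fun c hc =>
        (h.tgt_lt c (Finset.mem_range.1 hc)).ne, Finset.card_empty]

theorem HasExits.newExit {n : ℕ} {s : Mem} (h : HasExits n s) : HasExits n s.newExit :=
  ⟨h.constraints.newExit, h.le_xc.trans (Nat.le_succ _),
    fun v hv => (h.ex_lt v hv).trans (Nat.lt_succ_self _)⟩

theorem run_constrainExit {n b : ℕ} {s : Mem} {rp : ℕ → ℕ} (hr : HasSets n rp s)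
    (hrp : ∀ x < n, rp x < n) (hx : HasExits n s) (hxc : s.reg .x < s.reg .xc)
    (hnp : s.reg .np = b) (hp : ∀ i < b, s.arr .pl i < n) :
    Run (setAmortization n) constrainExit s fun u s' => u = 11 * b + 2 ∧
      s'.reg .fc ≤ s.reg .fc + u ∧ HasSets n rp s' ∧ HasExits n s' := by
  refine Run.forRange b (fun k u s' => u = 11 * k + 1 ∧
      s'.reg .fc ≤ s.reg .fc + u ∧ HasSets n rp s' ∧ HasExits n s') (by decide) rfl
    (fun s' hF => (hF.reg .np rfl).trans hnp) ⟨rfl, by simp, hr, hx.setReg _ rfl⟩ ?_ ?_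
  · rintro k u s₁ hF ⟨hu, hfc, hr, hx⟩ hi hk
    have hpl : s₁.arr .pl = s.arr .pl := hF.arr .pl rfl
    refine (run_rep .q (a := .get .pl (.reg .j)) hr (by decide)
      (by simpa [hi, hpl] using (hp k hk).le)).bind ?_
    rintro _ s₂ ⟨rfl, hq, hr₂⟩ hf₂
    simp only [Exp.eval, hi, hpl] at hq
    have hx₂ := hx.frame hf₂ rfl rfl
    have hx_eq : s₂.reg .x = s.reg .x := (hf₂.reg .x rfl).trans (hF.reg .x rfl)
    have hxc_eq : s₂.reg .xc = s.reg .xc := (hf₂.reg .xc rfl).trans (hF.reg .xc rfl)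
    have hfc_eq : s₂.reg .fc = s₁.reg .fc := hf₂.reg .fc rfl
    refine run_addConstraint (x := s₂.arr .ex (rp (s.arr .pl k))) (y := s.reg .x) (by decide)
      (by decide) (fun s' hf => by simp [hf.arr .ex rfl, hf.reg .q rfl, hq])
      (fun s' hf => by simp [hf.reg .x rfl, hx_eq]) ⟨by omega, ?_, hr₂, ?_⟩
    · simp only [Mem.addConstraint, Mem.setArr_reg, Mem.setReg_reg, reduceCtorEq, if_false, if_true]
      omega
    · exact (hx₂.addConstraint (hx₂.ex_lt _ (hrp _ (hp k hk))) (hxc_eq ▸ hxc)).setReg _ rfl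
  · rintro u s₁ - ⟨hu, hfc, hr, hx⟩ -
    exact ⟨by omega, by omega, hr, hx⟩

theorem HasExits.setExit {n a c x : ℕ} {s : Mem} (h : HasExits n s) (hx : x < s.reg .xc) :
    HasExits n ((s.setArr .nest x c).setArr .ex a x) := by
  refine ⟨h.constraints.frame (R := fun _ => false) (A := fun b => b = .nest || b = .ex)
    (((AgreeOff.refl _ _ s).setArr rfl).setArr rfl) rfl rfl, h.le_xc, fun v hv => ?_⟩
  simp only [Mem.setArr_arr, Mem.setArr_reg, reduceCtorEq, if_false, if_true, Function.update_apply]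
  split_ifs
  exacts [hx, h.ex_lt v hv]

theorem run_mergeNested {n a b : ℕ} {s : Mem} {rp : ℕ → ℕ} (hr : HasSets n rp s)
    (hrp : ∀ x < n, rp x < n) (hx : HasExits n s) (hxc : s.reg .x < s.reg .xc)
    (hh : s.reg .h = a) (ha : a < n) (hnw : s.reg .nw = b) (hw : ∀ i < b, s.arr .wl i < n) :
    Run (setAmortization n) mergeNested s fun u s' => u = 16 * b + 4 ∧ HasExits n s' ∧
      ∃ rp', HasSets n rp' s' ∧ (∀ x < n, rp' x < n) ∧ (∀ z, rp' z = z → rp z = z ∨ z = a) ∧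
        ∀ i < b, rp' (s.arr .wl i) = a := by
  refine Run.store_seq (by decide) (by decide) (Run.store_seq (by decide) (by decide) ?_)
  simp only [Exp.eval, Mem.setArr_reg, hh]
  replace hx := hx.setExit (a := a) (c := a) hxc
  set s₀ := (s.setArr .nest (s.reg .x) a).setArr .ex a (s.reg .x)
  refine Run.forRange b (fun k u s' => u = 16 * k + 1 ∧ HasExits n s' ∧
    ∃ rp', HasSets n rp' s' ∧ (∀ x < n, rp' x < n) ∧ (∀ z, rp' z = z → rp z = z ∨ z = a) ∧
      ∀ i < k, rp' (s.arr .wl i) = a) (by decide) rfl (fun s' hF => (hF.reg .nw rfl).trans hnw)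
    ⟨rfl, hx.setReg _ rfl, rp, hr, hrp, fun z h => .inl h, by simp⟩ ?_ ?_
  · rintro k u s₁ hF ⟨hu, hx, rp₁, hr, hrp₁, hrep, hdead⟩ hi hk
    have hwl : s₁.arr .wl = s.arr .wl := hF.arr .wl rfl
    have hh₁ : s₁.reg .h = a := (hF.reg .h rfl).trans hh
    refine (run_merge (a := .get .wl (.reg .k)) (b := .reg .h) (x := s.arr .wl k) (y := a) hr
      (by decide) (by decide) (by simp [hi, hwl]) (fun s' hf => (hf.reg .h rfl).trans hh₁)
      (hw k hk).le ha.le).imp ?_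
    rintro _ s₂ ⟨rfl, hr₂⟩ hf₂
    refine ⟨by omega, (hx.frame hf₂ rfl rfl).setReg _ rfl, mergeRep rp₁ (s.arr .wl k) a, hr₂,
      fun x hx => ?_, fun z hz => ?_, fun i hi => ?_⟩
    · unfold mergeRep
      split_ifs
      exacts [ha, hrp₁ x hx]
    · unfold mergeRep at hz
      split_ifs at hz
      exacts [.inr hz.symm, hrep z hz]
    · unfold mergeRep
      split_ifs with h
      · rfl
      · obtain hik | rfl := Nat.lt_succ_iff_lt_or_eq.1 hi
        exacts [hdead i hik, absurd (.inl rfl) h]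
  · rintro u s₁ - ⟨hu, h⟩ -
    exact ⟨by omega, h⟩

theorem run_addExit {n a b c : ℕ} {s : Mem} {rp : ℕ → ℕ} (hr : HasSets n rp s)
    (hrp : ∀ x < n, rp x < n) (hx : HasExits n s) (hh : s.reg .h = a) (ha : a < n)
    (hnp : s.reg .np = c) (hp : ∀ i < c, s.arr .pl i < n)
    (hnw : s.reg .nw = b) (hw : ∀ i < b, s.arr .wl i < n) :
    Run (setAmortization n) addExit s fun u s' => u = 16 * b + 11 * c + 10 ∧ HasExits n s' ∧
      s'.reg .xc = s.reg .xc + 1 ∧ s'.reg .fc ≤ s.reg .fc + u ∧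
      ∃ rp', HasSets n rp' s' ∧ (∀ x < n, rp' x < n) ∧ (∀ z, rp' z = z → rp z = z ∨ z = a) ∧
        ∀ i < b, rp' (s.arr .wl i) = a := by
  refine Run.set_seq (by decide) (Run.set_seq (by decide) (Run.store_seq (by decide) (by decide)
    (Run.store_seq (by decide) (by decide) ?_)))
  change Run _ (.seq constrainExit mergeNested) s.newExit _
  refine (run_constrainExit (s := s.newExit) hr hrp hx.newExit (Nat.lt_succ_self _) hnp hp).bind ?_
  rintro _ s₁ ⟨rfl, hfc₁, hr₁, hx₁⟩ hf₁
  have hx_eq : s₁.reg .x = s.reg .xc := hf₁.reg .x rfl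
  have hxc_eq : s₁.reg .xc = s.reg .xc + 1 := hf₁.reg .xc rfl
  have hwl : s₁.arr .wl = s.arr .wl := hf₁.arr .wl rfl
  have hfc₁ : s₁.reg .fc ≤ s.reg .fc + (11 * c + 2) := hfc₁
  refine (run_mergeNested hr₁ hrp hx₁ (by omega) ((hf₁.reg .h rfl).trans hh) ha
    ((hf₁.reg .nw rfl).trans hnw) (hwl ▸ hw)).imp ?_
  rintro _ s₂ ⟨rfl, hx₂, rp', hr₂, hrp', hrep, hdead⟩ hf₂
  have hfc_eq : s₂.reg .fc = s₁.reg .fc := hf₂.reg .fc rfl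
  exact ⟨by omega, hx₂, (hf₂.reg .xc rfl).trans hxc_eq, by omega, rp', hr₂, hrp', hrep, hwl ▸ hdead⟩

theorem run_constructWPOForSCC {n m a : ℕ} {s : Mem} {rp : ℕ → ℕ} {loc : ℕ → Location}
    {I : Family → ℕ → Prop} (hg : HasGraph n m s) (hr : HasSets n rp s)
    (hrp : ∀ x < n, rp x < n) (hx : HasExits n s) (hl : HasLists m loc I s)
    (hI : ∀ v < n, I .current v) (ha : I .back a) (hh : s.reg .h = a) (han : a < n) :
    Run (setAmortization n) constructWPOForSCC s fun u s' => ∃ rp' : ℕ → ℕ, ∃ N : Finset ℕ,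
      HasSets n rp' s' ∧ (∀ x < n, rp' x < n) ∧ HasExits n s' ∧
      s'.reg .xc ≤ s.reg .xc + 1 ∧ s'.reg .fc ≤ s.reg .fc + u ∧
      (∀ v ∈ N, v < n ∧ rp v = v ∧ v ≠ a ∧ rp' v = a) ∧ (∀ z, rp' z = z → rp z = z ∨ z = a) ∧
      u ≤ 28 * (edgesAt m loc .back a).card + 21 +
        ∑ v ∈ N, (34 * (edgesAt m loc .current v).card + 29) := by
  refine (run_findNestedSCCs hg hr hrp hl hI ha hh).bind ?_
  rintro u₁ s₁ ⟨hr₁, hnp₁, hp₁, hw₁, h0, hu₁⟩ hf₁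
  have hx₁ := hx.frame hf₁ rfl rfl
  have hxc₁ : s₁.reg .xc = s.reg .xc := hf₁.reg .xc rfl
  have hfc₁ : s₁.reg .fc = s.reg .fc := hf₁.reg .fc rfl
  refine Run.onlyIf (c := .seq constrainNested addExit) (by decide) (fun _ => ?_) fun h => ?_
  swap
  · rw [h0 (not_not.1 h), Finset.range_zero, Finset.sum_empty] at hu₁
    exact ⟨rp, ∅, hr₁, hrp, hx₁, by omega, by omega, by simp, fun z h => .inl h,
      by rw [Finset.sum_empty]; omega⟩
  have hwn : ∀ i < s₁.reg .nw, s₁.arr .wl i < n := fun i hi => (hw₁.spec i hi).1.1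
  refine (run_constrainNested (hg.frame hf₁ rfl rfl) hr₁ hrp hx₁
    (hl.frame hf₁ fun K => by cases K <;> rfl) hI rfl hwn).bind ?_
  rintro u₂ s₂ ⟨hu₂, hfc₂, hr₂, hx₂⟩ hf₂
  have hwl : s₂.arr .wl = s₁.arr .wl := hf₂.arr .wl rfl
  refine (run_addExit hr₂ hrp hx₂ ((hf₂.reg .h rfl).trans ((hf₁.reg .h rfl).trans hh)) han
    (hf₂.reg .np rfl) (hf₂.arr .pl rfl ▸ fun i hi => (hp₁.spec i hi).1) (hf₂.reg .nw rfl)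
    (hwl ▸ hwn)).imp ?_
  rintro _ s₃ ⟨rfl, hx₃, hxc₃, hfc₃, rp', hr₃, hrp', hrep, hdead⟩ -
  have hxc₂ : s₂.reg .xc = s₁.reg .xc := hf₂.reg .xc rfl
  refine ⟨rp', (Finset.range (s₁.reg .nw)).image (s₁.arr .wl), hr₃, hrp', hx₃, by omega, by omega,
    fun v hv => ?_, hrep, ?_⟩
  · obtain ⟨i, hi, rfl⟩ := Finset.mem_image.1 hv
    obtain ⟨⟨hn, hrep⟩, hne⟩ := hw₁.spec i (Finset.mem_range.1 hi)
    exact ⟨hn, hrep, hne, hwl ▸ hdead i (Finset.mem_range.1 hi)⟩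
  · rw [Finset.sum_image (by rw [Finset.coe_range]; exact hw₁.injOn)]
    simp only [Finset.sum_add_distrib, ← Finset.mul_sum, Finset.sum_const, Finset.card_range,
      smul_eq_mul] at hu₁ hu₂ ⊢
    omega

/-! ### The main loop -/

section MainPotential

variable {n m i a : ℕ} {dfn rp rp' : ℕ → ℕ} {loc : ℕ → Location} {N : Finset ℕ}

/-- An upper bound for the number of times the list of current edges of a vertex can still be
searched: `rp` gives the representatives, and the vertices numbered below `i` have not yet been
processed. A search merges the vertex into another one, and only processing the vertex itself makes
it possible that it becomes a representative again. -/
def activity (dfn : ℕ → ℕ) (i : ℕ) (rp : ℕ → ℕ) (a : ℕ) : ℕ :=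
  (if rp a = a then 1 else 0) + if dfn a < i then 1 else 0

/-- The amortized time that an edge still has to pay in the main loop, depending on the list that
contains the edge. -/
def edgeWeight (dfn : ℕ → ℕ) (i : ℕ) (rp : ℕ → ℕ) : Location → ℕ
  | some (.back, a) => if dfn a < i then 28 else 0
  | some (.removed, _) => 76
  | some (.current, a) => 34 * activity dfn i rp a
  | _ => 0

theorem activity_le_two (dfn : ℕ → ℕ) (i : ℕ) (rp : ℕ → ℕ) (a : ℕ) : activity dfn i rp a ≤ 2 := by
  unfold activity
  split_ifs <;> omega

theorem edgeWeight_le (dfn : ℕ → ℕ) (i : ℕ) (rp : ℕ → ℕ) (k : Location) :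
    edgeWeight dfn i rp k ≤ 76 := by
  unfold edgeWeight
  split
  · split_ifs <;> omega
  · exact le_rfl
  · exact (Nat.mul_le_mul_left 34 (activity_le_two _ _ _ _)).trans (by omega)
  · omega

theorem sum_card_edgesAt (m : ℕ) (loc : ℕ → Location) (K : Family) (N : Finset ℕ) :
    ∑ v ∈ N, (edgesAt m loc K v).card =
      ∑ e ∈ Finset.range m, if ∃ v ∈ N, loc e = some (K, v) then 1 else 0 := by
  simp only [edgesAt, Finset.card_filter]
  rw [Finset.sum_comm]
  refine Finset.sum_congr rfl fun e _ => ?_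
  split_ifs with h
  · obtain ⟨v, hv, he⟩ := h
    simp [he, hv]
  · exact Finset.sum_eq_zero fun v hv => if_neg fun he => h ⟨v, hv, he⟩

theorem activity_add_indicator_le (ha : dfn a = i) (hN : ∀ v ∈ N, rp v = v ∧ v ≠ a ∧ rp' v = a)
    (hrep : ∀ z, rp' z = z → rp z = z ∨ z = a) (v : ℕ) :
    activity dfn i rp' v + (if v ∈ N then 1 else 0) ≤ activity dfn (i + 1) rp v := by
  unfold activity
  obtain rfl | hva := eq_or_ne v a
  · have hvN : v ∉ N := fun h => (hN v h).2.1 rfl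
    split_ifs <;> omega
  · have hreps : (if rp' v = v then 1 else 0) + (if v ∈ N then 1 else 0) ≤
        if rp v = v then 1 else 0 := by
      have := hN v
      have := hrep v
      split_ifs <;> simp_all
    have hnum : (if dfn v < i then 1 else 0) ≤ if dfn v < i + 1 then 1 else 0 := by
      split_ifs <;> omega
    omega

theorem sum_activity_add_card_le (ha : dfn a = i) (hN : ∀ v ∈ N, rp v = v ∧ v ≠ a ∧ rp' v = a)
    (hrep : ∀ z, rp' z = z → rp z = z ∨ z = a) (hNn : N ⊆ Finset.range n) :
    ∑ v ∈ Finset.range n, activity dfn i rp' v + N.card ≤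
      ∑ v ∈ Finset.range n, activity dfn (i + 1) rp v := by
  have hcard : N.card = ∑ v ∈ Finset.range n, if v ∈ N then 1 else 0 := by
    rw [← Finset.card_filter, Finset.filter_mem_eq_inter, Finset.inter_eq_right.2 hNn]
  rw [hcard, ← Finset.sum_add_distrib]
  exact Finset.sum_le_sum fun v _ => activity_add_indicator_le ha hN hrep v

theorem sum_edgeWeight_add_le (ha : dfn a = i) (hN : ∀ v ∈ N, rp v = v ∧ v ≠ a ∧ rp' v = a)
    (hrep : ∀ z, rp' z = z → rp z = z ∨ z = a) :
    ∑ e ∈ Finset.range m, edgeWeight dfn i rp' (loc e) + 28 * (edgesAt m loc .back a).card +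
      34 * ∑ v ∈ N, (edgesAt m loc .current v).card ≤
      ∑ e ∈ Finset.range m, edgeWeight dfn (i + 1) rp (loc e) := by
  rw [← Finset.sum_singleton (fun v => (edgesAt m loc .back v).card) a, sum_card_edgesAt,
    sum_card_edgesAt, Finset.mul_sum, Finset.mul_sum, ← Finset.sum_add_distrib,
    ← Finset.sum_add_distrib]
  refine Finset.sum_le_sum fun e _ => ?_
  obtain _ | ⟨K, v⟩ := loc e
  · simp [edgeWeight]
  cases K <;> simp only [edgeWeight, Finset.mem_singleton, exists_eq_left, Option.some.injEq,
    Prod.mk.injEq, reduceCtorEq, false_and, true_and, and_false, exists_false, exists_eq_right',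
    if_false, mul_zero, add_zero, le_refl]
  · by_cases hva : v = a
    · simp [hva, ha]
    · rw [if_neg hva]
      split_ifs <;> omega
  · have := activity_add_indicator_le ha hN hrep v
    omega

/-- The edge lists that the main loop may still use when the vertices numbered below `i` have not
yet been processed; `n` is the virtual root. -/
def IsPending (n : ℕ) (dfn : ℕ → ℕ) (i : ℕ) : Family → ℕ → Prop
  | .back, a => a < n ∧ dfn a < i
  | .removed, a => a = n ∨ (a < n ∧ dfn a < i)
  | .current, a => a < n
  | .cross, _ => False

/-- The amortized time that the main loop may still take when the vertices numbered below `i` have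
not yet been processed. -/
def mainPotential (n m : ℕ) (dfn : ℕ → ℕ) (i : ℕ) (rp : ℕ → ℕ) (loc : ℕ → Location) : ℕ :=
  ∑ e ∈ Finset.range m, edgeWeight dfn i rp (loc e) +
    29 * ∑ v ∈ Finset.range n, activity dfn i rp v + 26 * i

theorem mainPotential_le (n m : ℕ) (dfn : ℕ → ℕ) (rp : ℕ → ℕ) (loc : ℕ → Location) :
    mainPotential n m dfn n rp loc ≤ 76 * m + 84 * n := by
  have hedges := Finset.sum_le_card_nsmul (Finset.range m)
    (fun e => edgeWeight dfn n rp (loc e)) 76 fun e _ => edgeWeight_le _ _ _ _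
  have hvertices := Finset.sum_le_card_nsmul (Finset.range n) (fun v => activity dfn n rp v) 2
    fun v _ => activity_le_two _ _ _ _
  rw [Finset.card_range, smul_eq_mul] at hedges hvertices
  unfold mainPotential
  omega

end MainPotential

/-- The invariant of the main loop when the vertices numbered below `i` have not yet been
processed. -/
structure IsMainLoopState (n m : ℕ) (dfn : ℕ → ℕ) (i : ℕ) (rp : ℕ → ℕ) (loc : ℕ → Location)
    (s : Mem) : Prop where
  reg_i : s.reg .i = i
  sets : HasSets n rp s
  rep_lt : ∀ x < n, rp x < n
  exits : HasExits n s
  lists : HasLists m loc (IsPending n dfn i) s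

section ConstructWPOBU

open Reg Arr Exp

/-- The body of the main loop of `constructWPOBU`. -/
def processVertex : Cmd :=
  i ≔ pred i ;;
  h ≔ ord i ;;
  restoreCrossForwardEdges ;;
  constructWPOForSCC

/-- The main loop of `constructWPOBU`. -/
def mainLoop : Cmd :=
  .loop (lit 0 ≺ i) processVertex

/-- The part of `constructWPOBU` after the main loop. -/
def processVirtualRoot : Cmd :=
  h ≔ n ;;
  restoreCrossForwardEdges ;;
  connectWPOsOfMaximalSCCs

end ConstructWPOBU

theorem run_processVertex {n m i : ℕ} {s : Mem} {rp : ℕ → ℕ} {loc : ℕ → Location}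
    (hg : HasGraph n m s) (hord : Set.LeftInvOn (s.arr .ord) (s.arr .dfn) (Set.Iio n))
    (hi : i < n) (hs : IsMainLoopState n m (s.arr .dfn) (i + 1) rp loc s) :
    Run (setAmortization n) processVertex s fun u s' => ∃ rp' loc',
      IsMainLoopState n m (s.arr .dfn) i rp' loc' s' ∧ s'.reg .xc ≤ s.reg .xc + 1 ∧
      s'.reg .fc ≤ s.reg .fc + u ∧
      u + 1 + mainPotential n m (s.arr .dfn) i rp' loc' ≤
        mainPotential n m (s.arr .dfn) (i + 1) rp loc := by
  obtain ⟨a, han, hdfn⟩ : ∃ a < n, s.arr .dfn a = i := hg.dfn.surjOn hi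
  have ha : s.arr .ord i = a := hdfn ▸ hord han
  refine Run.set_seq (by decide) (Run.set_seq (by decide) ?_)
  simp only [Exp.eval, hs.reg_i, Nat.add_sub_cancel, Mem.setReg_reg, Mem.setReg_arr, if_true, ha]
  set s₀ := (s.setReg .i i).setReg .h a
  have hF : processVertex.Frame s s₀ := ((AgreeOff.refl _ _ s).setReg rfl).setReg rfl
  have hwt (q) : edgeWeight (s.arr .dfn) (i + 1) rp (some (.current, q)) + 8 ≤
      edgeWeight (s.arr .dfn) (i + 1) rp (some (.removed, a)) := by
    have := activity_le_two (s.arr .dfn) (i + 1) rp q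
    simp only [edgeWeight]
    omega
  refine (run_restoreCrossForwardEdges (edgeWeight (s.arr .dfn) (i + 1) rp) hwt
    (hg.frame hF rfl rfl) hs.sets hs.lists rfl
    (.inr ⟨han, by omega⟩)).bind ?_
  rintro u₁ s₁ ⟨loc₁, hr₁, hl₁, hu₁⟩ hf₁
  have hx₁ := ((hs.exits.setReg (z := .i) i rfl).setReg (z := .h) a rfl).frame hf₁ rfl rfl
  have hxc₁ : s₁.reg .xc = s.reg .xc := hf₁.reg .xc rfl
  have hfc₁ : s₁.reg .fc = s.reg .fc := hf₁.reg .fc rfl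
  refine (run_constructWPOForSCC ((hg.frame hF rfl rfl).frame hf₁ rfl rfl) hr₁ hs.rep_lt hx₁ hl₁
    (fun v hv => ⟨hv, by simp⟩) ⟨⟨han, by omega⟩, by simp⟩ (hf₁.reg .h rfl) han).imp ?_
  rintro u₂ s₂ ⟨rp', N, hr₂, hrp', hx₂, hxc₂, hfc₂, hN, hrep, hu₂⟩ hf₂
  refine ⟨rp', loc₁, ⟨(hf₂.reg .i rfl).trans (hf₁.reg .i rfl), hr₂, hrp', hx₂, ?_⟩, by omega,
    by omega, ?_⟩
  · refine (hl₁.frame hf₂ fun K => by cases K <;> rfl).mono fun K b hb => ?_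
    cases K <;> grind [IsPending]
  · have hedges := sum_edgeWeight_add_le (m := m) (loc := loc₁) hdfn (fun v hv => (hN v hv).2) hrep
    have hvertices := sum_activity_add_card_le hdfn (fun v hv => (hN v hv).2) hrep fun v hv =>
      Finset.mem_range.2 (hN v hv).1
    rw [Finset.sum_add_distrib, ← Finset.mul_sum, Finset.sum_const, smul_eq_mul] at hu₂
    unfold mainPotential
    omega

theorem run_mainLoop {n m : ℕ} {s : Mem} {rp : ℕ → ℕ} {loc : ℕ → Location} (hg : HasGraph n m s)
    (hord : Set.LeftInvOn (s.arr .ord) (s.arr .dfn) (Set.Iio n))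
    (hs : IsMainLoopState n m (s.arr .dfn) n rp loc s) :
    Run (setAmortization n) mainLoop s fun u s' => ∃ rp' loc',
      IsMainLoopState n m (s.arr .dfn) 0 rp' loc' s' ∧ s'.reg .xc ≤ s.reg .xc + n ∧
      s'.reg .fc ≤ s.reg .fc + u ∧
      u + ∑ e ∈ Finset.range m, edgeWeight (s.arr .dfn) 0 rp' (loc' e) ≤ 76 * m + 84 * n + 1 := by
  refine Run.loop (by decide) (fun i u s' => ∃ rp' loc', i ≤ n ∧
    IsMainLoopState n m (s.arr .dfn) i rp' loc' s' ∧ s'.reg .xc + i ≤ s.reg .xc + n ∧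
    s'.reg .fc ≤ s.reg .fc + u ∧
    u + mainPotential n m (s.arr .dfn) i rp' loc' ≤ 76 * m + 84 * n) (k₀ := n) ?_ ?_ ?_
  · exact ⟨rp, loc, le_rfl, hs, le_rfl, le_rfl, by simpa using mainPotential_le n m _ rp loc⟩
  · rintro k u s₁ hF ⟨rp₁, loc₁, hk, hs₁, hxc, hfc, hu⟩ hlt
    simp only [Test.Holds, Exp.eval, hs₁.reg_i] at hlt
    obtain ⟨i, rfl⟩ := Nat.exists_eq_add_one.2 hlt
    have hdfn : s₁.arr .dfn = s.arr .dfn := hF.arr .dfn rfl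
    refine (run_processVertex (hg.frame hF rfl rfl) (by rwa [hdfn, hF.arr .ord rfl]) hk
      (by rwa [hdfn])).imp ?_
    rintro u' s₂ ⟨rp₂, loc₂, hs₂, hxc₂, hfc₂, hu₂⟩ -
    rw [hdfn] at hs₂ hu₂
    exact ⟨i, i.lt_succ_self, rp₂, loc₂, by omega, hs₂, by omega, by omega, by omega⟩
  · rintro k u s₁ - ⟨rp₁, loc₁, -, hs₁, hxc, hfc, hu⟩ hlt
    simp only [Test.Holds, Exp.eval, hs₁.reg_i] at hlt
    obtain rfl : k = 0 := by omega
    unfold mainPotential at hu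
    exact ⟨rp₁, loc₁, hs₁, by omega, by omega, by omega⟩

theorem run_connectWPOsOfMaximalSCCs {n m : ℕ} {s : Mem} {rp : ℕ → ℕ} {loc : ℕ → Location}
    {I : Family → ℕ → Prop} (hg : HasGraph n m s) (hr : HasSets n rp s)
    (hrp : ∀ x < n, rp x < n) (hx : HasExits n s) (hl : HasLists m loc I s)
    (hI : ∀ v < n, I .current v) :
    Run (setAmortization n) connectWPOsOfMaximalSCCs s fun u s' =>
      u ≤ 24 * m + 12 * n + 2 ∧ s'.reg .fc ≤ s.reg .fc + u ∧ HasConstraints s' := by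
  refine Run.forRange n (fun k u s' =>
    u ≤ ∑ v ∈ Finset.range k, (24 * (edgesAt m loc .current v).card + 12) + 1 ∧
    s'.reg .fc ≤ s.reg .fc + u ∧ HasSets n rp s' ∧ HasExits n s') (by decide) rfl
    (fun s' hF => (hF.reg .n rfl).trans hg.n_eq) ⟨by simp, by simp, hr, hx.setReg _ rfl⟩ ?_ ?_
  · rintro k u s₁ hF ⟨hu, hfc, hr, hx⟩ hi hk
    refine (run_rep .q (rp := rp) hr (by decide) (by simpa [hi] using hk.le)).bind ?_
    rintro _ s₂ ⟨rfl, -, hr₂⟩ hf₂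
    have hx₂ := hx.frame hf₂ rfl rfl
    have hfc₂ : s₂.reg .fc = s₁.reg .fc := hf₂.reg .fc rfl
    rw [Finset.sum_range_succ]
    refine Run.onlyIf (by decide) (fun _ => ?_) fun _ => ?_
    · refine (run_addConstraintsTo ((hg.frame hF rfl rfl).frame hf₂ rfl rfl) hr₂ hrp hx₂
        ((hl.frame hF fun K => by cases K <;> rfl).frame hf₂ fun K => by cases K <;> rfl)
        ((hf₂.reg .v rfl).trans hi) (hI k hk) hk).imp ?_
      rintro u₃ s₃ ⟨hu₃, hfc₃, hr₃, hx₃⟩ -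
      exact ⟨by omega, by simpa using by omega, hr₃, hx₃.setReg _ rfl⟩
    · exact ⟨by omega, by simpa using by omega, hr₂, hx₂.setReg _ rfl⟩
  · rintro u s₁ - ⟨hu, hfc, hr, hx⟩ -
    have hcard : ∑ v ∈ Finset.range n, (edgesAt m loc .current v).card ≤ m := by
      rw [sum_card_edgesAt, ← Finset.card_filter]
      simpa using Finset.card_filter_le (Finset.range m) _
    rw [Finset.sum_add_distrib, ← Finset.mul_sum, Finset.sum_const, smul_eq_mul,
      Finset.card_range] at hu
    exact ⟨by omega, by omega, hx.constraints⟩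

theorem run_processVirtualRoot {n m : ℕ} {s : Mem} {dfn rp : ℕ → ℕ} {loc : ℕ → Location}
    (hg : HasGraph n m s) (hs : IsMainLoopState n m dfn 0 rp loc s) :
    Run (setAmortization n) processVirtualRoot s fun u s' =>
      u ≤ ∑ e ∈ Finset.range m, edgeWeight dfn 0 rp (loc e) + 24 * m + 12 * n + 5 ∧
      s'.reg .fc ≤ s.reg .fc + u ∧ HasConstraints s' := by
  refine Run.set_seq (by decide) ?_
  simp only [Exp.eval, hg.n_eq]
  have hF : processVirtualRoot.Frame s (s.setReg .h n) := (AgreeOff.refl _ _ s).setReg rfl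
  have hwt (q) : edgeWeight dfn 0 rp (some (.current, q)) + 8 ≤
      edgeWeight dfn 0 rp (some (.removed, n)) := by
    have := activity_le_two dfn 0 rp q
    simp only [edgeWeight]
    omega
  refine (run_restoreCrossForwardEdges (s := s.setReg .h n) _ hwt (hg.frame hF rfl rfl) hs.sets
    hs.lists rfl (.inl rfl)).bind ?_
  rintro u₁ s₁ ⟨loc₁, hr₁, hl₁, hu₁⟩ hf₁
  have hfc₁ : s₁.reg .fc = s.reg .fc := hf₁.reg .fc rfl
  refine (run_connectWPOsOfMaximalSCCs ((hg.frame hF rfl rfl).frame hf₁ rfl rfl) hr₁ hs.rep_lt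
    ((hs.exits.setReg (z := .h) n rfl).frame hf₁ rfl rfl) hl₁ fun v hv => ⟨hv, by simp⟩).imp ?_
  rintro u₂ s₂ ⟨hu₂, hfc₂, hc⟩ -
  exact ⟨by omega, by omega, hc⟩

theorem run_constructWPOBU {n m : ℕ} {s : Mem} (hg : HasGraph n m s) :
    Run (setAmortization n).plain constructWPOBU s fun u s' => u ≤ 150 * (n + m + 1) ∧
      s'.reg .xc ≤ 2 * n ∧ s'.reg .fc ≤ u ∧ HasConstraints s' := by
  refine (run_setUp hg).bind ?_
  rintro u₁ s₁ ⟨hu₁, hs₁⟩ hf₁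
  have hg₁ := hg.frame hf₁ rfl rfl
  refine (run_removeAllCrossForwardEdges hg₁ hs₁).bind ?_
  rintro u₂ s₂ ⟨hu₂, loc₂, hl₂⟩ hf₂
  have hg₂ := hg₁.frame hf₂ rfl rfl
  refine (run_makeSets hg₂.n_eq).plain_bind (k := n + 1) ?_
  rintro _ s₃ ⟨rfl, hpot, hr₃⟩ hf₃
  refine ⟨hpot, Run.set_seq (by decide) ?_⟩
  have hg₃ := hg₂.frame hf₃ rfl rfl
  simp only [Exp.eval, hg₃.n_eq]
  have hord : Set.LeftInvOn (s₃.arr .ord) (s₃.arr .dfn) (Set.Iio n) := by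
    rw [hf₃.arr .ord rfl, hf₂.arr .ord rfl, hf₃.arr .dfn rfl, hf₂.arr .dfn rfl]
    exact hs₁.ord
  have hl₃ : HasLists m loc₂ (IsPending n (s₃.arr .dfn) n) s₃ :=
    (hl₂.frame hf₃ fun K => by cases K <;> rfl).mono fun K a ha => by
      cases K <;> grind [IsPending, Family.bound]
  have hs₃ : IsMainLoopState n m (s₃.arr .dfn) n id loc₂ (s₃.setReg .i n) :=
    ⟨rfl, hr₃, fun x => id, ((hs₁.exits.frame hf₂ rfl rfl).frame hf₃ rfl rfl).setReg n rfl, hl₃⟩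
  have hxc₃ : s₃.reg .xc = n := (hf₃.reg .xc rfl).trans ((hf₂.reg .xc rfl).trans hs₁.xc_eq)
  have hfc₃ : s₃.reg .fc = 0 := (hf₃.reg .fc rfl).trans ((hf₂.reg .fc rfl).trans hs₁.fc_eq)
  have hg₄ : HasGraph n m (s₃.setReg .i n) := hg₃.frame (Cmd.Frame.set .i (.lit 0) _ _) rfl rfl
  refine Run.bind (c := mainLoop) (d := processVirtualRoot)
    (run_mainLoop (s := s₃.setReg .i n) hg₄ hord hs₃) ?_
  rintro u₅ s₅ ⟨rp, loc₅, hs₅, hxc₅, hfc₅, hu₅⟩ hf₅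
  refine (run_processVirtualRoot (hg₄.frame hf₅ rfl rfl) hs₅).imp ?_
  rintro u₆ s₆ ⟨hu₆, hfc₆, hc₆⟩ hf₆
  have hxc₆ : s₆.reg .xc = s₅.reg .xc := hf₆.reg .xc rfl
  have hxc₅ : s₅.reg .xc ≤ s₃.reg .xc + n := hxc₅
  have hfc₅ : s₅.reg .fc ≤ s₃.reg .fc + u₅ := hfc₅
  exact ⟨by omega, by omega, by omega, hc₆⟩

/-! ### The topological traversal -/

/-- The state of a topological traversal of the constraints `c < F` from `src c` to `tgt c` on the
elements below `X`: the elements of `D` have been popped, and the constraints in `E` have been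
counted. -/
structure IsTraversal (X F : ℕ) (src tgt : ℕ → ℕ) (D E : Finset ℕ) (sp : ℕ)
    (stack count : ℕ → ℕ) : Prop where
  popped_subset : D ⊆ Finset.range X
  counted_subset : E ⊆ Finset.range F
  stack_lt : ∀ i < sp, stack i < X
  stack_injOn : Set.InjOn stack (Set.Iio sp)
  stack_notMem : ∀ i < sp, stack i ∉ D
  src_mem : ∀ c ∈ E, src c ∈ D
  count_eq : ∀ v < X, count v = Finset.card {c ∈ E | tgt c = v}
  mem_counted : ∀ c < F, (tgt c ∈ D ∨ ∃ i < sp, stack i = tgt c) → c ∈ E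

namespace IsTraversal

variable {X F : ℕ} {src tgt : ℕ → ℕ} {D E : Finset ℕ} {sp : ℕ} {stack count : ℕ → ℕ}

theorem pop (h : IsTraversal X F src tgt D E (sp + 1) stack count) :
    IsTraversal X F src tgt (insert (stack sp) D) E sp stack count where
  popped_subset := Finset.insert_subset (Finset.mem_range.2 (h.stack_lt sp sp.lt_succ_self))
    h.popped_subset
  counted_subset := h.counted_subset
  stack_lt i hi := h.stack_lt i (hi.trans sp.lt_succ_self)
  stack_injOn := h.stack_injOn.mono (Set.Iio_subset_Iio sp.le_succ)
  stack_notMem i hi hmem := by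
    have hi' : i < sp + 1 := hi.trans sp.lt_succ_self
    obtain heq | hD := Finset.mem_insert.1 hmem
    exacts [hi.ne (h.stack_injOn hi' sp.lt_succ_self heq), h.stack_notMem i hi' hD]
  src_mem c hc := Finset.mem_insert_of_mem (h.src_mem c hc)
  count_eq := h.count_eq
  mem_counted c hc hv := by
    refine h.mem_counted c hc ?_
    obtain hmem | ⟨i, hi, heq⟩ := hv
    · obtain heq | hD := Finset.mem_insert.1 hmem
      exacts [.inr ⟨sp, sp.lt_succ_self, heq.symm⟩, .inl hD]
    · exact .inr ⟨i, hi.trans sp.lt_succ_self, heq⟩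

theorem visit (h : IsTraversal X F src tgt D E sp stack count) {e : ℕ} (he : e < F) (heE : e ∉ E)
    (hsrc : src e ∈ D) : IsTraversal X F src tgt D (insert e E) sp stack
      (Function.update count (tgt e) (count (tgt e) + 1)) where
  popped_subset := h.popped_subset
  counted_subset := Finset.insert_subset (Finset.mem_range.2 he) h.counted_subset
  stack_lt := h.stack_lt
  stack_injOn := h.stack_injOn
  stack_notMem := h.stack_notMem
  src_mem := Finset.forall_mem_insert _ _ _ |>.2 ⟨hsrc, h.src_mem⟩
  count_eq v hv := by
    rw [Finset.filter_insert, Function.update_apply]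
    split_ifs with hve hev hev
    · rw [Finset.card_insert_of_notMem (by simp [heE]), hve, h.count_eq _ (hve ▸ hv)]
    · exact absurd hve.symm hev
    · exact absurd hev.symm hve
    · exact h.count_eq v hv
  mem_counted c hc hv := Finset.mem_insert_of_mem (h.mem_counted c hc hv)

theorem mem_counted_of_card_le_count (h : IsTraversal X F src tgt D E sp stack count) {c : ℕ}
    (hc : c < F) (hX : tgt c < X)
    (hcount : Finset.card {d ∈ Finset.range F | tgt d = tgt c} ≤ count (tgt c)) : c ∈ E := by
  have heq := Finset.eq_of_subset_of_card_le
    (Finset.filter_subset_filter (fun d => tgt d = tgt c) h.counted_subset)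
    (h.count_eq _ hX ▸ hcount)
  have hmem : c ∈ {d ∈ Finset.range F | tgt d = tgt c} := by simp [hc]
  exact (Finset.mem_filter.1 (heq ▸ hmem)).1

theorem push (h : IsTraversal X F src tgt D E sp stack count) {w : ℕ} (hw : w < X) (hD : w ∉ D)
    (hstack : ∀ i < sp, stack i ≠ w)
    (hcount : Finset.card {c ∈ Finset.range F | tgt c = w} ≤ count w) :
    IsTraversal X F src tgt D E (sp + 1) (Function.update stack sp w) count where
  popped_subset := h.popped_subset
  counted_subset := h.counted_subset
  stack_lt i hi := by
    have := h.stack_lt i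
    grind
  stack_injOn i hi j hj hij := by
    have := @h.stack_injOn i
    grind
  stack_notMem i hi := by
    have := h.stack_notMem i
    grind
  src_mem := h.src_mem
  count_eq := h.count_eq
  mem_counted c hc hv := by
    by_cases hcw : tgt c = w
    · subst hcw
      exact h.mem_counted_of_card_le_count hc hw hcount
    · refine h.mem_counted c hc (hv.imp_right ?_)
      rintro ⟨i, hi, heq⟩
      obtain hlt | rfl := Nat.lt_succ_iff_lt_or_eq.1 hi
      · exact ⟨i, hlt, by rwa [Function.update_of_ne hlt.ne] at heq⟩
      · exact absurd (heq.symm.trans (Function.update_self ..)) hcw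

end IsTraversal

section ConstructWTOBU

open Reg Arr Exp

/-- The loop in `constructWTOBU` that clears the counters and pushes the elements without
predecessor. -/
def initTraversal : Cmd :=
  forRange v xc (
    count⟦v⟧ ≔ lit 0 ;;
    onlyIf (npred v ≐ lit 0) (
      stack⟦sp⟧ ≔ v ;;
      sp ≔ succ sp))

/-- The command in `constructWTOBU` that adds a constraint from the previous element to `v`. -/
def constrainPrev : Cmd :=
  onlyIf (.not (prev ≐ lit 0)) (addConstraint (pred prev) v)

/-- The loop in `constructWTOBU` over the constraints from `v`. -/
def countSuccessors : Cmd :=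
  forList fHd fNxt v (
    w ≔ ftgt e ;;
    count⟦w⟧ ≔ succ (count w) ;;
    onlyIf (count w ≐ npred w) (
      stack⟦sp⟧ ≔ w ;;
      sp ≔ succ sp))

/-- The body of the last loop in `constructWTOBU`. -/
def popElement : Cmd :=
  sp ≔ pred sp ;;
  v ≔ stack sp ;;
  constrainPrev ;;
  prev ≔ succ v ;;
  countSuccessors

/-- The last loop in `constructWTOBU`. -/
def traverse : Cmd :=
  .loop (lit 0 ≺ sp) popElement

end ConstructWTOBU

theorem run_initTraversal {A : Amortization} {s : Mem} (hc : HasConstraints s)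
    (hsp : s.reg .sp = 0) :
    Run A initTraversal s fun u s' => u ≤ 6 * s.reg .xc + 2 ∧
      IsTraversal (s.reg .xc) (s.reg .fc) (s.arr .fsrc) (s.arr .ftgt) ∅ ∅ (s'.reg .sp)
        (s'.arr .stack) (s'.arr .count) := by
  refine Run.forRange (s.reg .xc) (fun k u s' => u ≤ 6 * k + 1 ∧
    IsTraversal k (s.reg .fc) (s.arr .fsrc) (s.arr .ftgt) ∅ ∅ (s'.reg .sp) (s'.arr .stack)
      (s'.arr .count)) (by decide) rfl (fun s' hF => hF.reg .xc rfl) ?_ ?_ ?_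
  · refine ⟨le_rfl, ?_⟩
    constructor <;> simp [hsp]
  · rintro k u s₁ hF ⟨hu, ht⟩ hi hk
    have hnpred : s₁.arr .npred = s.arr .npred := hF.arr .npred rfl
    refine Run.store_seq (by decide) (by decide) ?_
    simp only [Exp.eval, hi]
    have ht' : IsTraversal (k + 1) (s.reg .fc) (s.arr .fsrc) (s.arr .ftgt) ∅ ∅ (s₁.reg .sp)
        (s₁.arr .stack) (Function.update (s₁.arr .count) k 0) :=
      { ht with
        popped_subset := Finset.empty_subset _
        stack_lt := fun i hi => (ht.stack_lt i hi).trans k.lt_succ_self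
        count_eq := fun v hv => by
          have := ht.count_eq v
          grind }
    refine Run.onlyIf (by decide) (fun heq => ?_) fun _ => ?_
    · simp only [Test.Holds, Exp.eval, Mem.setArr_arr, reduceCtorEq, if_false, Mem.setArr_reg, hi,
        hnpred] at heq
      refine Run.store_seq (by decide) (by decide) (Run.set (by decide) ⟨by omega, ?_⟩)
      simp only [Exp.eval, Mem.setArr_arr, Mem.setReg_reg, Mem.setReg_arr, if_true,
        reduceCtorEq, if_false, Mem.setArr_reg, hi]
      refine ht'.push k.lt_succ_self (Finset.notMem_empty k) (fun i hi => (ht.stack_lt i hi).ne) ?_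
      rw [← hc.npred_eq k hk, heq]
      exact Nat.zero_le _
    · exact ⟨by omega, by simpa using ht'⟩
  · rintro u s₁ - ⟨hu, ht⟩ -
    exact ⟨by omega, ht⟩

/-- The memory represents the constraints `c < F` from `src c` to `tgt c` on the elements below
`X`, together with constraints that the traversal has added from elements of `D`. -/
structure ExtendsConstraints (X F : ℕ) (src tgt : ℕ → ℕ) (D : Finset ℕ) (s : Mem) : Prop where
  constraints : HasConstraints s
  xc_eq : s.reg .xc = X
  le_fc : F ≤ s.reg .fc
  src_eqOn : Set.EqOn (s.arr .fsrc) src (Set.Iio F)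
  tgt_eqOn : Set.EqOn (s.arr .ftgt) tgt (Set.Iio F)
  new_src_mem : ∀ c < s.reg .fc, F ≤ c → s.arr .fsrc c ∈ D

theorem HasConstraints.extendsConstraints {s : Mem} (h : HasConstraints s) (D : Finset ℕ) :
    ExtendsConstraints (s.reg .xc) (s.reg .fc) (s.arr .fsrc) (s.arr .ftgt) D s :=
  ⟨h, rfl, le_rfl, fun _ _ => rfl, fun _ _ => rfl, fun _ hc hle => absurd hc hle.not_gt⟩

namespace ExtendsConstraints

variable {X F : ℕ} {src tgt : ℕ → ℕ} {D : Finset ℕ} {s : Mem}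

theorem frame {R : Reg → Bool} {A : Arr → Bool} {s' : Mem}
    (h : ExtendsConstraints X F src tgt D s) (hf : AgreeOff R A s s')
    (hR : (R .xc || R .fc) = false)
    (hA : (A .fsrc || A .ftgt || A .fHd || A .fNxt || A .npred) = false) :
    ExtendsConstraints X F src tgt D s' := by
  have hc := h.constraints.frame hf hR hA
  simp only [Bool.or_eq_false_iff] at hR hA
  obtain ⟨hxc, hfc⟩ := hR
  obtain ⟨⟨⟨⟨hfsrc, hftgt⟩, -⟩, -⟩, -⟩ := hA
  obtain ⟨-, h₁, h₂, h₃, h₄, h₅⟩ := h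
  refine ⟨hc, ?_, ?_, ?_, ?_, ?_⟩ <;>
    simpa only [hf.reg _ hxc, hf.reg _ hfc, hf.arr _ hfsrc, hf.arr _ hftgt]

theorem addConstraint (h : ExtendsConstraints X F src tgt D s) {x y : ℕ} (hx : x ∈ D)
    (hxX : x < X) (hyX : y < X) : ExtendsConstraints X F src tgt D (s.addConstraint x y) := by
  have hF := h.le_fc
  refine ⟨h.constraints.addConstraint (h.xc_eq ▸ hxX) (h.xc_eq ▸ hyX), h.xc_eq, ?_, ?_, ?_, ?_⟩ <;>
    simp only [Mem.addConstraint, Mem.setArr_arr, Mem.setArr_reg, Mem.setReg_reg, Mem.setReg_arr,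
      reduceCtorEq, if_false, if_true]
  · omega
  · exact fun c hc => (Function.update_of_ne (hc.trans_le hF).ne _ _).trans (h.src_eqOn hc)
  · exact fun c hc => (Function.update_of_ne (hc.trans_le hF).ne _ _).trans (h.tgt_eqOn hc)
  · intro c hc hFc
    rw [Function.update_apply]
    split_ifs
    · exact hx
    · exact h.new_src_mem c (by omega) hFc

theorem lt_of_src_eq (h : ExtendsConstraints X F src tgt D s) {a c : ℕ} (ha : a ∉ D)
    (hc : c < s.reg .fc) (hca : s.arr .fsrc c = a) : c < F ∧ src c = a := by
  have hcF : c < F := by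
    by_contra! hcF
    exact ha (hca ▸ h.new_src_mem c hc hcF)
  exact ⟨hcF, (h.src_eqOn hcF).symm.trans hca⟩

theorem card_le_npred (h : ExtendsConstraints X F src tgt D s) {v : ℕ} (hv : v < X) :
    Finset.card {c ∈ Finset.range F | tgt c = v} ≤ s.arr .npred v := by
  rw [h.constraints.npred_eq v (h.xc_eq ▸ hv)]
  refine Finset.card_le_card fun c hc => ?_
  obtain ⟨hcF, rfl⟩ := by simpa using hc
  simpa using ⟨hcF.trans_le h.le_fc, h.tgt_eqOn hcF⟩

end ExtendsConstraints

theorem run_constrainPrev {A : Amortization} {X F a : ℕ} {src tgt : ℕ → ℕ} {D : Finset ℕ}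
    {s : Mem} (h : ExtendsConstraints X F src tgt D s) (hD : D ⊆ Finset.range X)
    (hprev : s.reg .prev ≠ 0 → s.reg .prev - 1 ∈ D) (hv : s.reg .v = a) (ha : a < X) :
    Run A constrainPrev s fun u s' => u ≤ 7 ∧ ExtendsConstraints X F src tgt D s' := by
  refine Run.onlyIf (by decide) (fun hne => ?_) fun _ => ⟨by omega, h⟩
  have hmem := hprev hne
  exact run_addConstraint (by decide) (by decide) (fun s' hf => by simp [hf.reg .prev rfl])
    (fun s' hf => by simp [hf.reg .v rfl, hv])
    ⟨by omega, h.addConstraint hmem (Finset.mem_range.1 (hD hmem)) ha⟩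

theorem run_countSuccessors {A : Amortization} {X F a : ℕ} {src tgt : ℕ → ℕ} {D E : Finset ℕ}
    {s : Mem} (h : ExtendsConstraints X F src tgt D s) (ha : a ∉ D) (hE : ∀ e ∈ E, src e ≠ a)
    (ht : IsTraversal X F src tgt (insert a D) E (s.reg .sp) (s.arr .stack) (s.arr .count))
    (hv : s.reg .v = a) :
    Run A countSuccessors s fun u s' => ∃ E', u + 8 * E.card ≤ 8 * E'.card + 2 ∧
      IsTraversal X F src tgt (insert a D) E' (s'.reg .sp) (s'.arr .stack) (s'.arr .count) := by
  have haX : a < X := Finset.mem_range.1 (ht.popped_subset (Finset.mem_insert_self a D))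
  obtain ⟨l, hl, hnodup, hmem⟩ := h.constraints.list a (h.xc_eq.symm ▸ haX)
  refine Run.forList (l := l) (by simpa [hv] using hl) (fun l' u s' => ∃ E',
    u + 8 * E.card ≤ 8 * E'.card + 1 ∧ IsTraversal X F src tgt (insert a D) E' (s'.reg .sp)
      (s'.arr .stack) (s'.arr .count) ∧ l'.Nodup ∧ ∀ e ∈ l', e < F ∧ e ∉ E' ∧ src e = a)
    (by decide) rfl rfl ?_ ?_ ?_
  · refine ⟨E, by omega, by simpa using ht, hnodup, fun e he => ?_⟩
    rw [← List.mem_toFinset, hmem, Finset.mem_filter, Finset.mem_range] at he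
    obtain ⟨heF, hsrc⟩ := h.lt_of_src_eq ha he.1 he.2
    exact ⟨heF, fun heE => hE e heE hsrc, hsrc⟩
  · rintro e l' u s₁ p hF ⟨E', hu, ht, hnodup, hmem⟩
    obtain ⟨⟨heF, heE, hsrc⟩, hmem⟩ := List.forall_mem_cons.1 hmem
    obtain ⟨hel, hnodup⟩ := List.nodup_cons.1 hnodup
    have hcard : (insert e E').card = E'.card + 1 := Finset.card_insert_of_notMem heE
    have hmem' : ∀ x ∈ l', x < F ∧ x ∉ insert e E' ∧ src x = a := by grind
    have h₁ := h.frame hF rfl rfl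
    have htgt : s₁.arr .ftgt e = tgt e := h₁.tgt_eqOn heF
    have hw : tgt e < X := by
      rw [← htgt, ← h₁.xc_eq]
      exact h₁.constraints.tgt_lt e (heF.trans_le h₁.le_fc)
    have ht' := ht.visit heF heE (hsrc ▸ Finset.mem_insert_self a D)
    refine Run.set_seq (by decide) (Run.store_seq (by decide) (by decide) ?_)
    simp only [Exp.eval, Mem.setReg_reg, Mem.setReg_arr, if_true, reduceCtorEq, if_false, htgt]
    refine Run.onlyIf (by decide) (fun heq => ?_) fun _ =>
      ⟨insert e E', by omega, by simpa using ht', hnodup, hmem'⟩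
    simp only [Test.Holds, Exp.eval, Mem.setArr_arr, Mem.setReg_reg, Mem.setReg_arr, if_true,
      reduceCtorEq, if_false, Mem.setArr_reg, Function.update_self] at heq
    refine Run.store_seq (by decide) (by decide) (Run.set (by decide)
      ⟨insert e E', by omega, ?_, hnodup, hmem'⟩)
    simp only [Exp.eval, Mem.setArr_arr, Mem.setReg_reg, Mem.setReg_arr, if_true,
      reduceCtorEq, if_false, Mem.setArr_reg]
    refine ht'.push hw (fun hD => heE (ht.mem_counted e heF (.inl hD)))
      (fun i hi heq => heE (ht.mem_counted e heF (.inr ⟨i, hi, heq⟩))) ?_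
    rw [Function.update_self, heq]
    exact h₁.card_le_npred hw
  · rintro u s₁ - ⟨E', hu, ht, -, -⟩
    exact ⟨E', by omega, ht⟩

/-- The invariant of `traverse`, where the elements of `D` have been popped, and the constraints in
`E` have been counted. -/
structure IsTraversalState (X F : ℕ) (src tgt : ℕ → ℕ) (D E : Finset ℕ) (s : Mem) : Prop where
  traversal : IsTraversal X F src tgt D E (s.reg .sp) (s.arr .stack) (s.arr .count)
  extends_constraints : ExtendsConstraints X F src tgt D s
  prev_mem : s.reg .prev ≠ 0 → s.reg .prev - 1 ∈ D

theorem run_popElement {A : Amortization} {X F : ℕ} {src tgt : ℕ → ℕ} {D E : Finset ℕ} {s : Mem}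
    (h : IsTraversalState X F src tgt D E s) (hsp : 0 < s.reg .sp) :
    Run A popElement s fun u s' => ∃ D' E', D'.card = D.card + 1 ∧
      IsTraversalState X F src tgt D' E' s' ∧ u + 8 * E.card ≤ 8 * E'.card + 12 := by
  obtain ⟨ht, hc, hprev⟩ := h
  obtain ⟨r, hr⟩ := Nat.exists_eq_add_one.2 hsp
  rw [hr] at ht
  refine Run.set_seq (by decide) (Run.set_seq (by decide) ?_)
  simp only [Exp.eval, hr, Nat.add_sub_cancel, Mem.setReg_reg, Mem.setReg_arr, if_true]
  set a := s.arr .stack r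
  have haX : a < X := ht.stack_lt r r.lt_succ_self
  have haD : a ∉ D := ht.stack_notMem r r.lt_succ_self
  have hc₁ : ExtendsConstraints X F src tgt D ((s.setReg .sp r).setReg .v a) :=
    hc.frame (((AgreeOff.refl (fun z => z = .sp || z = .v) (fun _ => false) s).setReg rfl).setReg
      rfl) rfl rfl
  refine (run_constrainPrev hc₁ ht.popped_subset (by simpa using hprev) (by simp) haX).bind ?_
  rintro u₂ s₂ ⟨hu₂, hc₂⟩ hf₂
  have hv₂ : s₂.reg .v = a := (hf₂.reg .v rfl).trans (by simp)
  refine Run.set_seq (by decide) ?_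
  simp only [Exp.eval, hv₂]
  have hc₃ := hc₂.frame (Cmd.Frame.set .prev (.lit 0) s₂ (a + 1)) rfl rfl
  have ht₃ : IsTraversal X F src tgt (insert a D) E ((s₂.setReg .prev (a + 1)).reg .sp)
      ((s₂.setReg .prev (a + 1)).arr .stack) ((s₂.setReg .prev (a + 1)).arr .count) := by
    simpa [hf₂.reg .sp rfl, hf₂.arr .stack rfl, hf₂.arr .count rfl] using ht.pop
  refine (run_countSuccessors hc₃ haD (fun e he heq => haD (heq ▸ ht.src_mem e he)) ht₃
    (by simpa using hv₂)).imp ?_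
  rintro u₄ s₄ ⟨E', hu₄, ht₄⟩ hf₄
  have hc₄ := hc₃.frame hf₄ rfl rfl
  have hprev₄ : s₄.reg .prev = a + 1 := (hf₄.reg .prev rfl).trans (by simp)
  exact ⟨insert a D, E', Finset.card_insert_of_notMem haD, ⟨ht₄, { hc₄ with
    new_src_mem := fun c hc hFc => Finset.mem_insert_of_mem (hc₄.new_src_mem c hc hFc) },
    fun _ => by simp [hprev₄]⟩, by omega⟩

theorem run_traverse {A : Amortization} {X F : ℕ} {src tgt : ℕ → ℕ} {s : Mem}
    (h : IsTraversalState X F src tgt ∅ ∅ s) :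
    Run A traverse s fun u _ => u ≤ 13 * X + 8 * F + 1 := by
  refine Run.loop (by decide) (fun k u s' => ∃ D E, k = X - D.card ∧
    IsTraversalState X F src tgt D E s' ∧ u ≤ 8 * E.card + 13 * D.card) (k₀ := X)
    ⟨∅, ∅, by simp, h, by simp⟩ ?_ ?_
  · rintro _ u s₁ - ⟨D, E, rfl, h₁, hu⟩ hlt
    refine (run_popElement h₁ hlt).imp ?_
    rintro u' s₂ ⟨D', E', hcard, h₂, hu'⟩ -
    have hD' : D'.card ≤ X := by simpa using Finset.card_le_card h₂.traversal.popped_subset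
    exact ⟨X - D'.card, by omega, D', E', rfl, h₂, by omega⟩
  · rintro _ u s₁ - ⟨D, E, -, h₁, hu⟩ -
    have hD : D.card ≤ X := by simpa using Finset.card_le_card h₁.traversal.popped_subset
    have hE : E.card ≤ F := by simpa using Finset.card_le_card h₁.traversal.counted_subset
    omega

theorem run_constructWTOBU {n m : ℕ} {s : Mem} (hg : HasGraph n m s) :
    Run (setAmortization n).plain constructWTOBU s fun u _ => u ≤ 1400 * (n + m + 1) := by
  have hg₁ := hg.frame (Cmd.Frame.set .lift (.lit 0) s 1) rfl rfl
  refine Run.set_seq (by decide) ((run_constructWPOBU hg₁).bind ?_)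
  rintro u₁ s₁ ⟨hu₁, hxc₁, hfc₁, hc₁⟩ -
  refine Run.set_seq (by decide) ?_
  have hc₂ := hc₁.frame (Cmd.Frame.set .sp (.lit 0) s₁ 0) rfl rfl
  refine Run.bind (c := initTraversal) (run_initTraversal hc₂ (by simp)) ?_
  rintro u₃ s₃ ⟨hu₃, ht₃⟩ hf₃
  refine Run.set_seq (by decide) ?_
  have hc₄ := (((hc₂.extendsConstraints ∅).frame hf₃ rfl rfl).frame
    (Cmd.Frame.set .prev (.lit 0) s₃ 0) rfl rfl)
  refine Run.imp (c := traverse) (run_traverse ⟨by simpa using ht₃, hc₄, by simp⟩) ?_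
  rintro u₅ s₅ hu₅ -
  simp only [Mem.setReg_reg, reduceCtorEq, if_false] at hu₃ hu₅
  omega

theorem DFSStep.stack_finished_perm_discovered {V : Type} [DecidableEq V] {G : Digraph V}
    {S S' : DFSState V} (h : DFSStep G S S')
    (hS : (S.stack ++ S.finished).Perm S.discovered ∧ S.discovered.Nodup) :
    (S'.stack ++ S'.finished).Perm S'.discovered ∧ S'.discovered.Nodup := by
  obtain ⟨hperm, hnodup⟩ := hS
  cases h with
  | root d f p v hv | discover st d f p u v huv hv =>
    exact ⟨(hperm.cons v).trans (List.perm_append_singleton v d).symm,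
      List.nodup_append_comm.1 (List.nodup_cons.2 ⟨hv, hnodup⟩)⟩
  | finish st d f p u hu =>
    refine ⟨List.Perm.trans ?_ hperm, hnodup⟩
    rw [← List.append_assoc]
    exact List.perm_append_singleton u (st ++ f)

theorem bijOn_idxOf {n : ℕ} {l : List (Fin n)} (hl : l.Nodup) (hmem : ∀ v, v ∈ l) :
    Set.BijOn (l.idxOf ·) Set.univ (Set.Iio n) := by
  have huniv : l.toFinset = Finset.univ :=
    Finset.eq_univ_iff_forall.2 fun v => List.mem_toFinset.2 (hmem v)
  have hlen : l.length = n := by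
    rw [← List.toFinset_card_of_nodup hl, huniv, Finset.card_fin]
  refine ⟨fun v _ => ?_, fun u _ v _ => (List.idxOf_inj (hmem u)).1, fun i hi => ?_⟩
  · exact (List.idxOf_lt_length_of_mem (hmem v)).trans_eq hlen
  · have hi' : i < l.length := hi.trans_eq hlen.symm
    exact ⟨l[i], trivial, hl.idxOf_getElem i hi'⟩

theorem IsDepthFirstForest.bijOn {n : ℕ} {G : Digraph (Fin n)} {D : NumberedForest n}
    (h : IsDepthFirstForest G D) :
    Set.BijOn D.dfn Set.univ (Set.Iio n) ∧ Set.BijOn D.post Set.univ (Set.Iio n) := by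
  obtain ⟨d, f, hsteps, hmem, hdfn, hpost⟩ := h
  have hinv : ∀ S, Relation.ReflTransGen (DFSStep G) ⟨[], [], [], fun _ => none⟩ S →
      (S.stack ++ S.finished).Perm S.discovered ∧ S.discovered.Nodup := by
    intro S hS
    induction hS with
    | refl => simp
    | tail _ hstep ih => exact hstep.stack_finished_perm_discovered ih
  obtain ⟨hperm, hnodup⟩ := hinv _ hsteps
  rw [funext hdfn, funext hpost]
  exact ⟨bijOn_idxOf hnodup hmem,
    bijOn_idxOf (hperm.nodup_iff.2 hnodup) fun v => hperm.mem_iff.2 (hmem v)⟩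

theorem bijOn_Iio_of_bijOn_univ {n : ℕ} {f : ℕ → ℕ} {g : Fin n → ℕ} {T : Set ℕ}
    (hg : Set.BijOn g Set.univ T) (hfg : ∀ v : Fin n, f v = g v) : Set.BijOn f (Set.Iio n) T := by
  have himage : Fin.val '' (Set.univ : Set (Fin n)) = Set.Iio n := by simp
  rw [← himage, ← Set.bijOn_comp_iff Fin.val_injective.injOn]
  exact hg.congr fun v _ => (hfg v).symm

theorem HoldsInput.hasGraph {n : ℕ} {edges : List (Fin n × Fin n)} {D : NumberedForest n} {s : Mem}
    (h : HoldsInput s edges D) (hdfn : Set.BijOn D.dfn Set.univ (Set.Iio n))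
    (hpost : Set.BijOn D.post Set.univ (Set.Iio n)) : HasGraph n edges.length s where
  n_eq := h.n_eq
  m_eq := h.m_eq
  src_lt e he := (h.src_eq ⟨e, he⟩).trans_lt (edges.get ⟨e, he⟩).1.2
  tgt_lt e he := (h.tgt_eq ⟨e, he⟩).trans_lt (edges.get ⟨e, he⟩).2.2
  par_le v hv := by
    refine (h.par_eq ⟨v, hv⟩).trans_le ?_
    cases D.parent ⟨v, hv⟩ with
    | none => exact le_rfl
    | some w => exact w.2.le
  dfn := bijOn_Iio_of_bijOn_univ hdfn h.dfn_eq
  post := bijOn_Iio_of_bijOn_univ hpost h.post_eq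

end WTO

theorem mainTheorem7_general :
    ∃ C : ℕ, ∀ (n : ℕ) (edges : List (Fin n × Fin n)) (D : WTO.NumberedForest n) (s : WTO.Mem),
      Set.BijOn D.dfn Set.univ (Set.Iio n) → Set.BijOn D.post Set.univ (Set.Iio n) →
      WTO.HoldsInput s edges D →
      ∃ (t : ℕ) (s' : WTO.Mem), WTO.Exec WTO.constructWTOBU s t s' ∧
        t ≤ C * (n + edges.length + 1) * (WTO.invAck n + 1) := by
  refine ⟨500 * 1400, fun n edges D s hdfn hpost hs => ?_⟩
  obtain ⟨u, s', t, hexec, ht, hu⟩ := WTO.run_constructWTOBU (hs.hasGraph hdfn hpost)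
  refine ⟨t, s', hexec, ?_⟩
  simp only [WTO.Amortization.plain, WTO.setAmortization, add_zero, zero_add] at ht
  calc t ≤ 100 * (WTO.invAck n + 5) * u := ht
    _ ≤ 500 * (WTO.invAck n + 1) * (1400 * (n + edges.length + 1)) :=
      Nat.mul_le_mul (by omega) hu
    _ = 500 * 1400 * (n + edges.length + 1) * (WTO.invAck n + 1) := by ring

theorem mainTheorem7 :
    ∃ C : ℕ, ∀ (n : ℕ) (G : Digraph (Fin n)) (edges : List (Fin n × Fin n))
      (D : WTO.NumberedForest n) (s : WTO.Mem),
      WTO.IsEdgeList G edges → WTO.IsDepthFirstForest G D → WTO.HoldsInput s edges D →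
      ∃ (t : ℕ) (s' : WTO.Mem), WTO.Exec WTO.constructWTOBU s t s' ∧
        t ≤ C * (n + edges.length + 1) * (WTO.invAck n + 1) := by
  exact mainTheorem7_general.imp fun _ h n _ edges D s _ hD => h n edges D s hD.bijOn.1 hD.bijOn.2
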